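/- **Conventions.** Let $\Gamma$ be a groupoid with set of objects $\Gamma_0$, identified with its set of morphisms (an object $e$ being identified with its identity morphism); $d(\gamma)$ and $r(\gamma)$ are the domain and the range of $\gamma$, and $\gamma\delta$ is defined iff $d(\gamma)=r(\delta)$. Rings are associative, not necessarily unital. A $\Gamma$-graded ring is a ring $R=\bigoplus_{\gamma\in\Gamma}R_\gamma$ with $R_\gamma R_\delta\subseteq R_{\gamma\delta}$ (where $X_{\gamma\delta}:=0$ if $\gamma\delta$ is not defined), always assumed object unital: each $R_e$, $e\in\Gamma_0$, has an identity $1_e$, and $1_{r(\gamma)}a=a=a1_{d(\gamma)}$ for $a\in R_\gamma$. A gr-isomorphism $\cong_{gr}$ is a degree preserving isomorphism (for rings, mapping $1_e$ to $1_e$). A $\Gamma$-graded right module $M=\bigoplus_\gamma M_\gamma$ satisfies $M_\sigma R_\tau\subseteq M_{\sigma\tau}$ and is assumed unital ($MR=M$); left modules similarly. The shift $M(\sigma)$ has components $M(\sigma)_\gamma=M_{\sigma\gamma}$; $\Gamma_0'(M)=\{e\in\Gamma_0: M(e)\neq 0\}$, $\Gamma_0'(R)=\Gamma_0'(R_R)$,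 and $R(\Delta_0)=\bigoplus_{e\in\Delta_0}R(e)$ for $\Delta_0\subseteq\Gamma_0$. A pseudo-basis of $M$ is a family of homogeneous elements $x_i\in M_{\gamma_i}$ $(i\in I)$ which generates $M$ and such that the only finitely supported family $(a_i)$ with $a_i\in 1_{d(\gamma_i)}R$ and $\sum_i x_ia_i=0$ is zero; $M$ is pseudo-free if it has a pseudo-basis (for left modules: $a_i\in R1_{r(\gamma_i)}$ and $\sum_i a_ix_i=0$). $R$ is a pfm ring if every $\Gamma$-graded right $R$-module is pseudo-free. A graded module is gr-simple if it is nonzero and has no graded submodules other than $0$ and itself; it is $\Gamma_0$-simple if $M(e)$ is gr-simple for all $e\in\Gamma_0'(M)$; it is $\Gamma_0$-artinian if each $M(e)$, $e\in\Gamma_0$, has the descending chain condition on graded submodules. $R$ is gr-simple if $R\ne0$ and its only graded ideals are $0$ and $R$; gr-prime if $R\neq 0$ and $IJ\ne0$ for all nonzero graded ideals $I,J$; right $\Gamma_0$-artinian if $R_R$ is $\Gamma_0$-artinian (left: if ${}_RR$ is, that is, for each $e\in\Gamma_0$ the descending chain condition holds for graded left ideals inside $\bigoplus_{d(\gamma)=e}R_\gamma$);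 right gr-primitive if it has a faithful gr-simple graded right module. A $\Gamma$-graded division ring is a graded ring $D\ne0$ such that each nonzero $a\in D_\gamma$ has some $b\in D_{\gamma^{-1}}$ with $ab=1_{r(\gamma)}$, $ba=1_{d(\gamma)}$; $\operatorname{supp}(D)=\{\gamma: D_\gamma\neq0\}$. A family $\overline\sigma=(\sigma_k)_{k\in K}\in\Gamma^K$ is $d$-finite if $\{k:d(\sigma_k)=e\}$ is finite for all $e\in\Gamma_0$; then $M_K(D)(\overline\sigma)$ is the ring of $K\times K$ matrices spanned by its components $M_K(D)(\overline\sigma)_\gamma=\{(a_{ij})\text{ with finitely many nonzero entries}: a_{ij}\in D_{\sigma_i\gamma\sigma_j^{-1}}\}$. The graded product $\prod^{gr}_jR_j$ has components $\prod_j(R_j)_\gamma$, and the family $(R_j)$ is summable if $\prod^{gr}_jR_j=\bigoplus_jR_j$. For gr-simple rings "$\Gamma_0$-artinian" may be read as "right $\Gamma_0$-artinian" or as "left $\Gamma_0$-artinian": below, each item with "$\Gamma_0$-artinian" without a side stands for two statements, one for each reading, and both belong to the list of equivalent statements. **Theorem.** Let $R$ be a $\Gamma$-graded ring. **(A)** The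 following are equivalent. 1. $R$ is a pfm ring. 2. There are a family $(K_j)_{j\in J}$ of nonempty sets, $(e_j)_{j\in J},(f_j)_{j\in J}\in\Gamma_0^J$ and, for each $j$, a $\Gamma$-graded division ring $D_j$ with $\operatorname{supp}(D_j)\subseteq e_j\Gamma e_j$ and a $d$-finite $\overline\sigma_j=(\sigma_{jk})_{k\in K_j}\in(e_j\Gamma)^{K_j}$ such that the family $(M_{K_j}(D_j)(\overline\sigma_j))_{j\in J}$ is summable, $R\cong_{gr}\prod^{gr}_{j\in J}M_{K_j}(D_j)(\overline\sigma_j)$ and, for each $j\in J$, exactly one $k\in K_j$ satisfies $d(\sigma_{jk})=f_j$, and $\{j'\in J:\exists k\in K_{j'},\ d(\sigma_{j'k})=f_j\}=\{j\}$. 3. There are a summable family $(R_j)_{j\in J}$ of gr-prime pfm rings and $(f_j)_{j\in J}\in\Gamma_0^J$ with $R\cong_{gr}\prod^{gr}_{j\in J}R_j$ such that, for each $j$, $R(f_j)$ is gr-simple and $R_j(f_j)\neq0$. 4. The same as 3 with "gr-simple rings" in place of "gr-prime pfm rings". 5. There is $\Delta_0\subseteq\Gamma_0'(R)$ such that $R(\Delta_0)$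 is $\Gamma_0$-simple and $R_R$ is gr-isomorphic to a direct sum of shifts of elements of $\{R(e):e\in\Delta_0\}$. 6. There are a summable family $(R_j)_{j\in J}$ of gr-simple $\Gamma_0$-artinian rings and $(f_j)_{j\in J}\in\Gamma_0^J$ with $R\cong_{gr}\prod^{gr}_{j\in J}R_j$ such that, for each $j$, $R_{f_j}$ is a division ring and $(R_{j'})_{f_j}=0$ for all $j'\in J\setminus\{j\}$. **(B)** The following are equivalent. 1. $R$ is a gr-simple pfm ring. 2. $R$ is a gr-prime pfm ring. 3. There are $e_0,e\in\Gamma_0$, a $\Gamma$-graded division ring $D$ with $\operatorname{supp}(D)\subseteq e_0\Gamma e_0$, a nonempty set $I$ and a $d$-finite $\overline\sigma=(\sigma_i)_{i\in I}\in(e_0\Gamma)^I$ such that $R\cong_{gr}M_I(D)(\overline\sigma)$ and exactly one $i\in I$ satisfies $d(\sigma_i)=e$. 4. $R$ is gr-simple and $R(e)$ is a gr-simple module for some $e\in\Gamma_0$. 5. There is $e\in\Gamma_0$ such that $R(e)$ is a gr-simple module and $R_R$ is gr-isomorphic to a direct sum of shifts of $R(e)$. 6. $R$ is a gr-simple $\Gamma_0$-artinian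 ring and $R_e$ is a division ring for some $e\in\Gamma_0$. 7. $R$ is a right gr-primitive right $\Gamma_0$-artinian ring and $R_e$ is a division ring for some $e\in\Gamma_0$. **(C)** $R$ is a pfm ring if and only if every $\Gamma$-graded left $R$-module is pseudo-free. -/

import Mathlib

universe u u' u'' v w

open CategoryTheory

noncomputable section

namespace GroupoidGraded

/-! ## Groupoids as sets of morphisms -/

/-- An element `γ` of a groupoid, i.e. a morphism with domain `d γ` and range `r γ`. -/
structure Mor (Γ : Type v) [Groupoid.{w} Γ] where
  d : Γ
  r : Γ
  hom : d ⟶ r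

namespace Mor

variable {Γ : Type v} [Groupoid.{w} Γ]

instance : DecidableEq (Mor Γ) := Classical.decEq _

/-- The object `e`, seen as the identity morphism of `e`. -/
abbrev id (e : Γ) : Mor Γ := ⟨e, e, 𝟙 e⟩

/-- The inverse `γ⁻¹`. -/
abbrev inv (γ : Mor Γ) : Mor Γ := ⟨γ.r, γ.d, Groupoid.inv γ.hom⟩

/-- The product `γδ` (first `δ`, then `γ`), which is defined only if `d γ = r δ`. -/
abbrev mul (γ δ : Mor Γ) (h : γ.d = δ.r) : Mor Γ :=
  ⟨δ.d, γ.r, δ.hom ≫ eqToHom h.symm ≫ γ.hom⟩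

theorem mul_left_inj {σ γ δ : Mor Γ} (h : σ.d = γ.r) (h' : σ.d = δ.r)
    (e : σ.mul γ h = σ.mul δ h') : γ = δ := by
  obtain ⟨a, b, s⟩ := σ
  obtain ⟨c, a₁, g⟩ := γ
  obtain ⟨c', a₂, g'⟩ := δ
  simp only at h h'
  subst h; subst h'
  simp only [mul, Mor.mk.injEq] at e
  obtain ⟨rfl, -, e⟩ := e
  simp only [eqToHom_refl, Category.id_comp] at e
  rw [(cancel_mono s).1 (eq_of_heq e)]

theorem mul_right_inj {τ γ δ : Mor Γ} (h : γ.d = τ.r) (h' : δ.d = τ.r)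
    (e : γ.mul τ h = δ.mul τ h') : γ = δ := by
  obtain ⟨a, b, s⟩ := τ
  obtain ⟨c, a₁, g⟩ := γ
  obtain ⟨c', a₂, g'⟩ := δ
  simp only at h h'
  subst h; subst h'
  simp only [mul, Mor.mk.injEq] at e
  obtain ⟨-, rfl, e⟩ := e
  simp only [eqToHom_refl, Category.id_comp] at e
  rw [(cancel_epi s).1 (eq_of_heq e)]

theorem mul_assoc {α β γ : Mor Γ} (h : α.d = β.r) (h' : β.d = γ.r) :
    (α.mul β h).mul γ h' = α.mul (β.mul γ h') h := by
  obtain ⟨a, b, s⟩ := α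
  obtain ⟨c, a₁, g⟩ := β
  obtain ⟨c', a₂, g'⟩ := γ
  simp only at h h'
  subst h; subst h'
  simp only [mul, eqToHom_refl]
  simp only [Category.id_comp, Category.assoc]

theorem mul_id_mul_inv {σ : Mor Γ} {e : Γ} (h : σ.d = e) :
    (σ.mul (id e) h).mul σ.inv h.symm = id σ.r := by
  subst h
  simp [mul, inv, id]

theorem mul_mul_inv_mul {σ γ ρ δ τ : Mor Γ} (h₁ : σ.d = γ.r) (h₂ : γ.d = ρ.d)
    (h₃ : ρ.d = δ.r) (h₄ : δ.d = τ.d) :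
    ((σ.mul γ h₁).mul ρ.inv h₂).mul ((ρ.mul δ h₃).mul τ.inv h₄) rfl =
      (σ.mul (γ.mul δ (h₂.trans h₃)) h₁).mul τ.inv h₄ := by
  obtain ⟨σd, σr, s⟩ := σ
  obtain ⟨γd, γr, g⟩ := γ
  obtain ⟨ρd, ρr, p⟩ := ρ
  obtain ⟨δd, δr, q⟩ := δ
  obtain ⟨τd, τr, t⟩ := τ
  simp only at h₁ h₂ h₃ h₄
  subst h₁; subst h₂; subst h₃; subst h₄
  simp [mul, inv]

end Mor

/-! ## Graded additive groups -/

section Graded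

variable {Γ : Type v} [Groupoid.{w} Γ] {G : Type u} [AddCommGroup G]

open Classical in
/-- `X_{στ}`, with the convention `X_{στ} = 0` if `στ` is not defined. -/
def compAt (X : Mor Γ → AddSubgroup G) (σ τ : Mor Γ) : AddSubgroup G :=
  if h : σ.d = τ.r then X (σ.mul τ h) else ⊥

open Classical in
/-- `X_{σγτ⁻¹}`, with the convention `X_{σγτ⁻¹} = 0` if `σγτ⁻¹` is not defined. -/
def compAt₃ (X : Mor Γ → AddSubgroup G) (σ γ τ : Mor Γ) : AddSubgroup G :=
  if h : σ.d = γ.r ∧ γ.d = τ.d then X ((σ.mul γ h.1).mul τ.inv h.2) else ⊥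

end Graded

section Indep

variable {ι : Type*} {ι' : Type*} {G : Type*} [AddCommGroup G]

/-- The sum of a family of subgroups is direct. -/
def FinIndep (A : ι → AddSubgroup G) : Prop :=
  ∀ (s : Finset ι) (x : ι → G), (∀ i ∈ s, x i ∈ A i) → ∑ i ∈ s, x i = 0 → ∀ i ∈ s, x i = 0

theorem isInternal_iff [DecidableEq ι] (A : ι → AddSubgroup G) :
    DirectSum.IsInternal A ↔ FinIndep A ∧ ⨆ i, A i = ⊤ := by
  have hcoe : DirectSum.coeAddMonoidHom A = DFinsupp.sumAddHom fun i => (A i).subtype := rfl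
  have hr : (DirectSum.coeAddMonoidHom A).range = ⨆ i, A i := by
    refine le_antisymm ?_ (iSup_le fun i x hx => ⟨DirectSum.of (fun i => A i) i ⟨x, hx⟩, by simp⟩)
    rintro _ ⟨f, rfl⟩
    induction f using DirectSum.induction_on with
    | zero => rw [map_zero]; exact zero_mem _
    | of i x =>
      rw [DirectSum.coeAddMonoidHom_of]; exact AddSubgroup.mem_iSup_of_mem i x.2
    | add f g hf hg => rw [map_add]; exact add_mem hf hg
  rw [DirectSum.IsInternal, Function.Bijective, ← AddMonoidHom.range_eq_top, hr]
  refine and_congr_left fun _ => ⟨fun h s x hx h0 i hi => ?_, fun h => ?_⟩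
  · have := (injective_iff_map_eq_zero _).1 h
      (∑ i ∈ s.attach, DirectSum.of (fun i => A i) i.1 ⟨x i.1, hx _ i.2⟩) (by
        rw [map_sum]; simpa [Finset.sum_attach s x] using h0)
    let ev : (DirectSum ι fun i => A i) →+ G :=
      (A i).subtype.comp (DFinsupp.evalAddMonoidHom i)
    have hev : ∀ j y, ev (DirectSum.of (fun i => A i) j y) = if j = i then (y : G) else 0 := by
      intro j y
      change ((DirectSum.of (fun i => A i) j y i : A i) : G) = _
      split_ifs with hj
      · subst hj; rw [DirectSum.of_eq_same]
      · rw [DirectSum.of_eq_of_ne _ _ _ (Ne.symm hj)]; rfl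
    have h2 := congrArg ev this
    rw [map_sum, map_zero, Finset.sum_eq_single ⟨i, hi⟩] at h2
    · simpa [hev] using h2
    · intro b _ hb
      rw [hev, if_neg fun h => hb (Subtype.ext h)]
    · simp
  · classical
    refine (injective_iff_map_eq_zero _).2 fun f hf => ?_
    have h0 : ∑ i ∈ DFinsupp.support f, ((f i : A i) : G) = 0 := by
      rw [← hf, hcoe, DFinsupp.sumAddHom_apply, DFinsupp.sum]; rfl
    have := h _ (fun i => ((f i : A i) : G)) (fun i _ => (f i).2) h0
    refine DFinsupp.ext fun i => ?_
    by_contra hi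
    exact hi (Subtype.ext (this i (DFinsupp.mem_support_toFun f i |>.2 hi)))

theorem FinIndep.reindex {A : ι → AddSubgroup G} (hA : FinIndep A) (B : ι' → AddSubgroup G)
    (P : ι' → Prop) (f : ι' → ι) (hf : ∀ i j, P i → P j → f i = f j → i = j)
    (hB : ∀ i, P i → B i ≤ A (f i)) (hB' : ∀ i, ¬ P i → B i = ⊥) : FinIndep B := by
  classical
  intro s x hx h0 i hi
  have hxP : ∀ i ∈ s, ¬ P i → x i = 0 := fun i hi hP => by
    have := hx i hi; rwa [hB' i hP, AddSubgroup.mem_bot] at this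
  by_cases hP : P i
  swap
  · exact hxP i hi hP
  set t := s.filter P with ht
  have hinj : Set.InjOn f t := fun a ha b hb hab => by
    simp only [ht, Finset.coe_filter, Set.mem_ofPred_eq] at ha hb
    exact hf a b ha.2 hb.2 hab
  have : Nonempty ι' := ⟨i⟩
  have hl : ∀ a ∈ t, Function.invFunOn f t (f a) = a := fun a ha => hinj.leftInvOn_invFunOn ha
  have h1 : ∑ k ∈ t.image f, x (Function.invFunOn f t k) = 0 := by
    rw [Finset.sum_image hinj, ← h0, ht, Finset.sum_filter]
    refine Finset.sum_congr rfl fun a ha => ?_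
    split_ifs with h
    · rw [← ht, hl a (by simp [ht, ha, h])]
    · exact (hxP a ha h).symm
  have hit : i ∈ t := by simp [ht, hi, hP]
  have := hA (t.image f) _ (fun k hk => by
    obtain ⟨a, ha, rfl⟩ := Finset.mem_image.1 hk
    rw [hl a ha]
    have ha' := Finset.mem_filter.1 ha
    exact hB a ha'.2 (hx a ha'.1)) h1 (f i) (Finset.mem_image_of_mem f hit)
  rwa [hl i hit] at this

theorem FinIndep.isInternal_subtype [DecidableEq ι] {A : ι → AddSubgroup G} (hA : FinIndep A) :
    DirectSum.IsInternal fun i => (A i).addSubgroupOf (⨆ i, A i) := by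
  rw [isInternal_iff]
  refine ⟨fun s x hx h0 i hi => ?_, ?_⟩
  · have := hA s (fun i => (x i : G)) (fun i hi => hx i hi) (by
      rw [← AddSubmonoidClass.coe_finsetSum, h0]; rfl) i hi
    exact Subtype.ext this
  · rw [eq_top_iff]
    rintro ⟨x, hx⟩ -
    induction hx using AddSubgroup.iSup_induction' with
    | hp i x hx => exact AddSubgroup.mem_iSup_of_mem i hx
    | h1 => exact zero_mem _
    | hadd x y hx hy h1 h2 => exact add_mem h1 h2

end Indep

section Graded

variable {Γ : Type v} [Groupoid.{w} Γ] {G : Type u} [AddCommGroup G]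

theorem finIndep_compAt {X : Mor Γ → AddSubgroup G} (hX : FinIndep X) (σ : Mor Γ) :
    FinIndep fun γ => compAt X σ γ := by
  classical
  refine hX.reindex _ (fun γ => σ.d = γ.r) (fun γ => if h : σ.d = γ.r then σ.mul γ h else γ)
    (fun i j hi hj h => ?_) (fun i hi => ?_) (fun i hi => ?_)
  · simp only [dif_pos hi, dif_pos hj] at h
    exact Mor.mul_left_inj hi hj h
  · simp only [compAt, dif_pos hi, le_refl]
  · simp only [compAt, dif_neg hi]

theorem finIndep_compAt₃ {X : Mor Γ → AddSubgroup G} (hX : FinIndep X) (σ τ : Mor Γ) :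
    FinIndep fun γ => compAt₃ X σ γ τ := by
  classical
  refine hX.reindex _ (fun γ => σ.d = γ.r ∧ γ.d = τ.d)
    (fun γ => if h : σ.d = γ.r ∧ γ.d = τ.d then (σ.mul γ h.1).mul τ.inv h.2 else γ)
    (fun i j hi hj h => ?_) (fun i hi => ?_) (fun i hi => ?_)
  · simp only [dif_pos hi, dif_pos hj] at h
    exact Mor.mul_left_inj hi.1 hj.1 (Mor.mul_right_inj (τ := τ.inv) hi.2 hj.2 h)
  · simp only [compAt₃, dif_pos hi, le_refl]
  · simp only [compAt₃, dif_neg hi]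

end Graded

/-! ## Groupoid graded rings -/

/-- An object unital `Γ`-graded ring (associative, not necessarily unital). -/
structure GrRing (Γ : Type v) [Groupoid.{w} Γ] where
  carrier : Type u
  [ring : NonUnitalRing carrier]
  /-- The homogeneous component of degree `γ`. -/
  comp : Mor Γ → AddSubgroup carrier
  isInternal : DirectSum.IsInternal comp
  mul_mem : ∀ {γ δ : Mor Γ} {a b : carrier}, a ∈ comp γ → b ∈ comp δ → a * b ∈ compAt comp γ δ
  /-- Object unitality: every component `R_e` has an identity element, which acts as an identity
  from the left on the `R_γ` with `r γ = e` and from the right on those with `d γ = e`. -/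
  exists_one : ∀ e : Γ, ∃ u ∈ comp (Mor.id e), ∀ γ : Mor Γ, ∀ a ∈ comp γ,
    (γ.r = e → u * a = a) ∧ (γ.d = e → a * u = a)

namespace GrRing

variable {Γ : Type v} [Groupoid.{w} Γ]

instance : CoeSort (GrRing.{u} Γ) (Type u) := ⟨GrRing.carrier⟩

attribute [instance] GrRing.ring

/-- The identity element `1_e` of the ring `R_e`. -/
def one (R : GrRing.{u} Γ) (e : Γ) : R := (R.exists_one e).choose

theorem one_mem (R : GrRing.{u} Γ) (e : Γ) : R.one e ∈ R.comp (Mor.id e) :=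
  (R.exists_one e).choose_spec.1

theorem one_mul (R : GrRing.{u} Γ) {γ : Mor Γ} {a : R} (ha : a ∈ R.comp γ) :
    R.one γ.r * a = a :=
  ((R.exists_one γ.r).choose_spec.2 γ a ha).1 rfl

theorem mul_one (R : GrRing.{u} Γ) {γ : Mor Γ} {a : R} (ha : a ∈ R.comp γ) :
    a * R.one γ.d = a :=
  ((R.exists_one γ.d).choose_spec.2 γ a ha).2 rfl

theorem finIndep (R : GrRing.{u} Γ) : FinIndep R.comp := ((isInternal_iff _).1 R.isInternal).1

theorem iSup_comp (R : GrRing.{u} Γ) : ⨆ γ, R.comp γ = ⊤ := ((isInternal_iff _).1 R.isInternal).2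

theorem mul_mem_iSup {X : Type u} [NonUnitalRing X] {A : Mor Γ → AddSubgroup X}
    (hmul : ∀ {γ δ : Mor Γ} {a b : X}, a ∈ A γ → b ∈ A δ → a * b ∈ compAt A γ δ)
    {a b : X} (ha : a ∈ ⨆ γ, A γ) (hb : b ∈ ⨆ γ, A γ) : a * b ∈ ⨆ γ, A γ := by
  induction ha using AddSubgroup.iSup_induction' with
  | hp γ a ha =>
    induction hb using AddSubgroup.iSup_induction' with
    | hp δ b hb =>
      have := hmul ha hb
      unfold compAt at this
      split_ifs at this with h
      · exact AddSubgroup.mem_iSup_of_mem _ this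
      · rw [AddSubgroup.mem_bot.1 this]; exact zero_mem _
    | h1 => rw [mul_zero]; exact zero_mem _
    | hadd x y _ _ h1 h2 => rw [mul_add]; exact add_mem h1 h2
  | h1 => rw [zero_mul]; exact zero_mem _
  | hadd x y _ _ h1 h2 => rw [add_mul]; exact add_mem h1 h2

/-- The graded ring `⨁_γ A_γ ⊆ X` determined by a suitable family of additive subgroups `A_γ` of a
ring `X`. -/
def ofFinIndep {X : Type u} [NonUnitalRing X] (A : Mor Γ → AddSubgroup X) (hA : FinIndep A)
    (hmul : ∀ {γ δ : Mor Γ} {a b : X}, a ∈ A γ → b ∈ A δ → a * b ∈ compAt A γ δ)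
    (hone : ∀ e : Γ, ∃ u ∈ A (Mor.id e), ∀ γ : Mor Γ, ∀ a ∈ A γ,
      (γ.r = e → u * a = a) ∧ (γ.d = e → a * u = a)) : GrRing.{u} Γ where
  carrier := ({ (⨆ γ, A γ : AddSubgroup X) with
    mul_mem' := fun ha hb => mul_mem_iSup hmul ha hb } : NonUnitalSubring X)
  comp γ := (A γ).addSubgroupOf (⨆ γ, A γ)
  isInternal := hA.isInternal_subtype
  mul_mem {γ δ a b} ha hb := by
    have := hmul (γ := γ) (δ := δ) ha hb
    unfold compAt at this ⊢
    split_ifs at this ⊢ with h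
    · exact this
    · exact AddSubgroup.mem_bot.2 (Subtype.ext (AddSubgroup.mem_bot.1 this))
  exists_one e := by
    obtain ⟨u, hu, h⟩ := hone e
    exact ⟨⟨u, AddSubgroup.mem_iSup_of_mem _ hu⟩, hu, fun γ a ha =>
      ⟨fun hr => Subtype.ext ((h γ a ha).1 hr), fun hd => Subtype.ext ((h γ a ha).2 hd)⟩⟩

/-- `R ≅_gr S` as `Γ`-graded rings. -/
def Iso (R : GrRing.{u} Γ) (S : GrRing.{u'} Γ) : Prop :=
  ∃ φ : R ≃+* S, (∀ γ, ∀ a ∈ R.comp γ, φ a ∈ S.comp γ) ∧ ∀ e, φ (R.one e) = S.one e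

/-! ### Graded direct products -/

section Prod

variable {J : Type u} (F : J → GrRing.{u} Γ)

/-- The component `∏_j (R_j)_γ` of the graded direct product. -/
def prodComp (γ : Mor Γ) : AddSubgroup (∀ j, F j) :=
  AddSubgroup.pi Set.univ fun j => (F j).comp γ

theorem mem_prodComp {γ : Mor Γ} {x : ∀ j, F j} :
    x ∈ prodComp F γ ↔ ∀ j, x j ∈ (F j).comp γ := by
  simp [prodComp, AddSubgroup.mem_pi]

/-- The graded direct product `∏^gr_j R_j`. -/
def prod : GrRing.{u} Γ :=
  ofFinIndep (prodComp F)
    (fun s x hx h0 i hi => funext fun j =>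
      (F j).finIndep s (fun γ => x γ j) (fun γ hγ => (mem_prodComp F).1 (hx γ hγ) j)
        (by simpa using congrFun h0 j) i hi)
    (fun {γ δ a b} ha hb => by
      rw [mem_prodComp] at ha hb
      have := fun j => (F j).mul_mem (ha j) (hb j)
      unfold compAt at this ⊢
      split_ifs at this ⊢ with h
      · exact (mem_prodComp F).2 this
      · exact AddSubgroup.mem_bot.2 (funext fun j => AddSubgroup.mem_bot.1 (this j)))
    (fun e => ⟨fun j => (F j).one e, (mem_prodComp F).2 fun j => (F j).one_mem e,
      fun γ a ha => by
        rw [mem_prodComp] at ha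
        refine ⟨fun h => funext fun j => ?_, fun h => funext fun j => ?_⟩
        · subst h; exact (F j).one_mul (ha j)
        · subst h; exact (F j).mul_one (ha j)⟩)

/-- The family `R_j` is summable: `∏^gr_j R_j = ⨁_j R_j`, as subsets of `∏_j R_j`. -/
def Summable : Prop :=
  ((⨆ γ, prodComp F γ : AddSubgroup (∀ j, F j)) : Set (∀ j, F j)) = {x | {j | x j ≠ 0}.Finite}

end Prod

/-! ### Graded matrix rings -/

section Matrix

variable (K : Type u) (D : Type u) [NonUnitalRing D]

/-- `K × K` matrices with only finitely many nonzero entries. -/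
def FinMatrix : AddSubgroup (Matrix K K D) where
  carrier := {A | {p : K × K | A p.1 p.2 ≠ 0}.Finite}
  zero_mem' := by simp
  add_mem' {A B} hA hB := (Set.Finite.union hA hB).subset fun p hp => by
    by_contra h
    simp only [Set.mem_union, Set.mem_ofPred_eq, not_or, not_not] at h
    exact hp (by simp [h])
  neg_mem' {A} hA := by simpa using hA

variable {K D}

namespace FinMatrix

theorem finite_row (A : FinMatrix K D) (i : K) : {k | A.1 i k ≠ 0}.Finite :=
  (A.2.image Prod.snd).subset fun k hk => ⟨(i, k), hk, rfl⟩

theorem finite_cols (A : FinMatrix K D) : {k | ∃ i, A.1 i k ≠ 0}.Finite :=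
  (A.2.image Prod.snd).subset fun k ⟨i, hk⟩ => ⟨(i, k), hk, rfl⟩

theorem finite_rows (A : FinMatrix K D) : {i | ∃ k, A.1 i k ≠ 0}.Finite :=
  (A.2.image Prod.fst).subset fun i ⟨k, hk⟩ => ⟨(i, k), hk, rfl⟩

/-- The usual product of matrices. -/
def mulFun (A B : Matrix K K D) : Matrix K K D := fun i j => ∑ᶠ k, A i k * B k j

theorem mulFun_eq_sum (A B : Matrix K K D) (s : Finset K) (i j : K)
    (hs : ∀ k, A i k ≠ 0 → k ∈ s) : mulFun A B i j = ∑ k ∈ s, A i k * B k j :=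
  finsum_eq_sum_of_support_subset _ fun k hk => hs k fun h => hk (by simp [h])

instance : Mul (FinMatrix K D) where
  mul A B := ⟨mulFun A.1 B.1, by
    refine ((finite_rows A).prod (finite_cols B)).subset fun p hp => ?_
    obtain ⟨k, hk⟩ : ∃ k, A.1 p.1 k * B.1 k p.2 ≠ 0 := by
      by_contra! h
      exact hp (finsum_eq_zero_of_forall_eq_zero h)
    exact ⟨⟨k, fun h => hk (by simp [h])⟩, ⟨k, fun h => hk (by simp [h])⟩⟩⟩

theorem mul_apply (A B : FinMatrix K D) (i j : K) :
    (A * B).1 i j = ∑ᶠ k, A.1 i k * B.1 k j := rfl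

theorem mul_apply_sum (A B : FinMatrix K D) (i j : K) (s : Finset K)
    (hs : ∀ k, A.1 i k ≠ 0 → k ∈ s) : (A * B).1 i j = ∑ k ∈ s, A.1 i k * B.1 k j :=
  mulFun_eq_sum A.1 B.1 s i j hs

theorem coe_add (A B : FinMatrix K D) (i j : K) : (A + B).1 i j = A.1 i j + B.1 i j := rfl

/-- The `(i,j)` entry. -/
def entry (i j : K) : FinMatrix K D →+ D where
  toFun A := A.1 i j
  map_zero' := rfl
  map_add' _ _ := rfl

theorem coe_zero (i j : K) : (0 : FinMatrix K D).1 i j = 0 := rfl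

@[ext] theorem ext {A B : FinMatrix K D} (h : ∀ i j, A.1 i j = B.1 i j) : A = B :=
  Subtype.ext (funext fun i => funext fun j => h i j)

instance : NonUnitalRing (FinMatrix K D) :=
  { (inferInstance : AddCommGroup (FinMatrix K D)),
    (inferInstance : Mul (FinMatrix K D)) with
    left_distrib := fun A B C => by
      ext i j
      have hs := fun k (hk : A.1 i k ≠ 0) => (finite_row A i).mem_toFinset.2 hk
      rw [coe_add, mul_apply_sum A _ i j _ hs, mul_apply_sum A _ i j _ hs,
        mul_apply_sum A _ i j _ hs, ← Finset.sum_add_distrib]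
      simp only [coe_add, mul_add]
    right_distrib := fun A B C => by
      classical
      ext i j
      have hA := fun k (hk : A.1 i k ≠ 0) =>
        Finset.mem_union_left (finite_row B i).toFinset ((finite_row A i).mem_toFinset.2 hk)
      have hB := fun k (hk : B.1 i k ≠ 0) =>
        Finset.mem_union_right (finite_row A i).toFinset ((finite_row B i).mem_toFinset.2 hk)
      have hAB : ∀ k, (A + B).1 i k ≠ 0 →
          k ∈ (finite_row A i).toFinset ∪ (finite_row B i).toFinset := fun k hk => by
        by_cases h : A.1 i k = 0
        · exact hB k fun h' => hk (by rw [coe_add, h, h', add_zero])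
        · exact hA k h
      rw [coe_add, mul_apply_sum _ _ i j _ hAB, mul_apply_sum A _ i j _ hA,
        mul_apply_sum B _ i j _ hB, ← Finset.sum_add_distrib]
      simp only [coe_add, add_mul]
    zero_mul := fun A => by ext i j; simp [mul_apply, coe_zero]
    mul_zero := fun A => by ext i j; simp [mul_apply, coe_zero]
    mul_assoc := fun A B C => by
      ext i j
      have hA := fun k (hk : A.1 i k ≠ 0) => (finite_row A i).mem_toFinset.2 hk
      have hB := fun k l (hk : B.1 k l ≠ 0) =>
        (finite_cols B).mem_toFinset.2 ⟨k, hk⟩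
      have hAB : ∀ l, (A * B).1 i l ≠ 0 → l ∈ (finite_cols B).toFinset := fun l hl => by
        rw [mul_apply_sum A B i l _ hA] at hl
        obtain ⟨k, -, hk⟩ := Finset.exists_ne_zero_of_sum_ne_zero hl
        exact hB k l fun h => hk (by rw [h, mul_zero])
      rw [mul_apply_sum (A * B) C i j _ hAB, mul_apply_sum A (B * C) i j _ hA]
      simp only [mul_apply_sum A B i _ _ hA, fun k => mul_apply_sum B C k j _ (hB k),
        Finset.sum_mul, Finset.mul_sum, mul_assoc]
      exact Finset.sum_comm }

end FinMatrix

/-- A sequence `(σ_k)_{k ∈ K}` in `Γ` is `d`-finite. -/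
def DFinite (σ : K → Mor Γ) : Prop := ∀ e : Γ, {k | (σ k).d = e}.Finite

/-- The component `M_K(D)(σ)_γ`: matrices whose `(i,j)` entry lies in `D_{σ_i γ σ_j⁻¹}`. -/
def matrixComp (D : GrRing.{u} Γ) (σ : K → Mor Γ) (γ : Mor Γ) : AddSubgroup (FinMatrix K D) where
  carrier := {A | ∀ i j, A.1 i j ∈ compAt₃ D.comp (σ i) γ (σ j)}
  zero_mem' _ _ := zero_mem _
  add_mem' hA hB i j := add_mem (hA i j) (hB i j)
  neg_mem' hA i j := neg_mem (hA i j)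

theorem mem_matrixComp {D : GrRing.{u} Γ} {σ : K → Mor Γ} {γ : Mor Γ} {A : FinMatrix K D} :
    A ∈ matrixComp D σ γ ↔ ∀ i j, A.1 i j ∈ compAt₃ D.comp (σ i) γ (σ j) := Iff.rfl

theorem one_mul_of_mem_compAt₃ {D : GrRing.{u} Γ} {σ γ τ : Mor Γ} {a : D}
    (ha : a ∈ compAt₃ D.comp σ γ τ) : D.one σ.r * a = a := by
  unfold compAt₃ at ha
  split_ifs at ha
  · have h := D.one_mul ha
    exact h
  · rw [AddSubgroup.mem_bot.1 ha, mul_zero]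

theorem mul_one_of_mem_compAt₃ {D : GrRing.{u} Γ} {σ γ τ : Mor Γ} {a : D}
    (ha : a ∈ compAt₃ D.comp σ γ τ) : a * D.one τ.r = a := by
  unfold compAt₃ at ha
  split_ifs at ha
  · have h := D.mul_one ha
    exact h
  · rw [AddSubgroup.mem_bot.1 ha, zero_mul]

open Classical in
/-- The identity matrix `𝕀_e`, with entry `1_{r(σ_k)}` at `(k,k)` for each `k` with `d(σ_k) = e`. -/
def matrixOne (D : GrRing.{u} Γ) (σ : K → Mor Γ) (hσ : DFinite σ) (e : Γ) : FinMatrix K D :=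
  ⟨fun i j => if i = j ∧ (σ i).d = e then D.one (σ i).r else 0, by
    refine ((hσ e).image fun k => (k, k)).subset fun p hp => ?_
    simp only [ne_eq, ite_eq_right_iff, Classical.not_imp, Set.mem_ofPred_eq] at hp
    exact ⟨p.1, hp.1.2, Prod.ext rfl hp.1.1⟩⟩

theorem matrixOne_mem (D : GrRing.{u} Γ) (σ : K → Mor Γ) (hσ : DFinite σ) (e : Γ) :
    matrixOne D σ hσ e ∈ matrixComp D σ (Mor.id e) := by
  intro i j
  by_cases h : i = j ∧ (σ i).d = e
  · obtain ⟨rfl, h⟩ := h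
    simp only [matrixOne, compAt₃, h, and_self, if_true, dite_true]
    rw [Mor.mul_id_mul_inv h]
    exact D.one_mem _
  · simp only [matrixOne, h, if_false]
    exact zero_mem _

theorem matrixOne_mul (D : GrRing.{u} Γ) (σ : K → Mor Γ) (hσ : DFinite σ) {γ : Mor Γ}
    {A : FinMatrix K D} (hA : A ∈ matrixComp D σ γ) : matrixOne D σ hσ γ.r * A = A := by
  ext i j
  rw [FinMatrix.mul_apply, finsum_eq_single _ i fun k hk => by simp [matrixOne, hk.symm]]
  by_cases h : (σ i).d = γ.r
  · simp only [matrixOne, h, and_self, if_true]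
    exact one_mul_of_mem_compAt₃ (hA i j)
  · have h0 := hA i j
    rw [compAt₃, dif_neg fun h' => h h'.1, AddSubgroup.mem_bot] at h0
    rw [h0, mul_zero]

theorem mul_matrixOne (D : GrRing.{u} Γ) (σ : K → Mor Γ) (hσ : DFinite σ) {γ : Mor Γ}
    {A : FinMatrix K D} (hA : A ∈ matrixComp D σ γ) : A * matrixOne D σ hσ γ.d = A := by
  ext i j
  rw [FinMatrix.mul_apply, finsum_eq_single _ j fun k hk => by simp [matrixOne, hk]]
  by_cases h : (σ j).d = γ.d
  · simp only [matrixOne, h, and_self, if_true]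
    exact mul_one_of_mem_compAt₃ (hA i j)
  · have h0 := hA i j
    rw [compAt₃, dif_neg fun h' => h h'.2.symm, AddSubgroup.mem_bot] at h0
    rw [h0, zero_mul]

/-- The graded matrix ring `M_K(D)(σ)` of a `d`-finite sequence `σ`. -/
def matrix (D : GrRing.{u} Γ) (σ : K → Mor Γ) (hσ : DFinite σ) : GrRing.{u} Γ :=
  ofFinIndep (matrixComp D σ)
    (fun s x hx h0 i hi => FinMatrix.ext fun k l =>
      finIndep_compAt₃ D.finIndep (σ k) (σ l) s (fun γ => (x γ).1 k l) (fun γ hγ => hx γ hγ k l)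
        (by
          have h := congrArg (FinMatrix.entry k l) h0
          rwa [map_sum, map_zero] at h) i hi)
    (fun {γ δ A B} hA hB => by
      have key : ∀ i j k, A.1 i k * B.1 k j = 0 ∨ ∃ h : γ.d = δ.r,
          A.1 i k * B.1 k j ∈ compAt₃ D.comp (σ i) (γ.mul δ h) (σ j) := by
        intro i j k
        have h1 := hA i k
        have h2 := hB k j
        unfold compAt₃ at h1 h2
        split_ifs at h1 with hh1
        swap
        · left; rw [AddSubgroup.mem_bot.1 h1, zero_mul]
        split_ifs at h2 with hh2
        swap
        · left; rw [AddSubgroup.mem_bot.1 h2, mul_zero]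
        refine .inr ⟨hh1.2.trans hh2.1, ?_⟩
        have h3 := D.mul_mem h1 h2
        unfold compAt at h3
        rw [dif_pos rfl, Mor.mul_mul_inv_mul] at h3
        unfold compAt₃
        rw [dif_pos ⟨hh1.1, hh2.2⟩]
        exact h3
      unfold compAt
      split_ifs with h
      · intro i j
        refine finsum_induction (· ∈ compAt₃ D.comp (σ i) (γ.mul δ h) (σ j)) (zero_mem _)
          (fun _ _ => add_mem) fun k => ?_
        rcases key i j k with h0 | ⟨_, h0⟩
        · rw [h0]; exact zero_mem _
        · exact h0
      · refine AddSubgroup.mem_bot.2 (FinMatrix.ext fun i j => ?_)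
        rw [FinMatrix.mul_apply]
        refine finsum_eq_zero_of_forall_eq_zero fun k => ?_
        rcases key i j k with h0 | ⟨h0, _⟩
        · exact h0
        · exact absurd h0 h)
    (fun e => ⟨matrixOne D σ hσ e, matrixOne_mem D σ hσ e, fun γ A hA =>
      ⟨fun h => h ▸ matrixOne_mul D σ hσ hA, fun h => h ▸ mul_matrixOne D σ hσ hA⟩⟩)

end Matrix

end GrRing

/-! ## Graded modules -/

/-- A `Γ`-graded right `R`-module (not necessarily unital), with action `act m a = m a`. -/
structure GrMod {Γ : Type v} [Groupoid.{w} Γ] (R : GrRing.{u} Γ) where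
  carrier : Type u'
  [addCommGroup : AddCommGroup carrier]
  act : carrier →+ R →+ carrier
  act_mul : ∀ m a b, act (act m a) b = act m (a * b)
  comp : Mor Γ → AddSubgroup carrier
  isInternal : DirectSum.IsInternal comp
  act_mem : ∀ {σ τ : Mor Γ} {m : carrier} {a : R}, m ∈ comp σ → a ∈ R.comp τ →
    act m a ∈ compAt comp σ τ

/-- A `Γ`-graded left `R`-module (not necessarily unital), with action `act a m = a m`. -/
structure GrLeftMod {Γ : Type v} [Groupoid.{w} Γ] (R : GrRing.{u} Γ) where
  carrier : Type u'
  [addCommGroup : AddCommGroup carrier]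
  act : R →+ carrier →+ carrier
  mul_act : ∀ a b m, act (a * b) m = act a (act b m)
  comp : Mor Γ → AddSubgroup carrier
  isInternal : DirectSum.IsInternal comp
  act_mem : ∀ {σ τ : Mor Γ} {a : R} {m : carrier}, a ∈ R.comp σ → m ∈ comp τ →
    act a m ∈ compAt comp σ τ

namespace GrMod

variable {Γ : Type v} [Groupoid.{w} Γ] {R : GrRing.{u} Γ}

instance : CoeSort (GrMod.{u, u'} R) (Type u') := ⟨GrMod.carrier⟩

attribute [instance] GrMod.addCommGroup

theorem finIndep (M : GrMod.{u, u'} R) : FinIndep M.comp := ((isInternal_iff _).1 M.isInternal).1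

theorem iSup_comp (M : GrMod.{u, u'} R) : ⨆ γ, M.comp γ = ⊤ :=
  ((isInternal_iff _).1 M.isInternal).2

/-- `M` is unital: `M R = M`. -/
def IsUnital (M : GrMod.{u, u'} R) : Prop :=
  AddSubgroup.closure {x | ∃ (m : M) (a : R), x = M.act m a} = ⊤

/-- `N` is a graded submodule of `M`. -/
def IsGrSubmodule (M : GrMod.{u, u'} R) (N : AddSubgroup M) : Prop :=
  (∀ n ∈ N, ∀ a : R, M.act n a ∈ N) ∧ N = ⨆ γ, N ⊓ M.comp γ

/-- `M` is gr-simple. -/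
def IsGrSimple (M : GrMod.{u, u'} R) : Prop :=
  Nontrivial M ∧ ∀ N, M.IsGrSubmodule N → N = ⊥ ∨ N = ⊤

/-- `M` is gr-artinian: the descending chain condition holds for graded submodules. -/
def IsGrArtinian (M : GrMod.{u, u'} R) : Prop :=
  ∀ N : ℕ → AddSubgroup M, (∀ n, M.IsGrSubmodule (N n)) → Antitone N → ∃ n, ∀ m ≥ n, N m = N n

/-- The sequence `(x_i)` of homogeneous elements `x_i ∈ M_{γ_i}` is a pseudo-basis of `M`: it
generates `M` as an `R`-module and it is pseudo-linearly independent, i.e. the only finitely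
supported sequence `(a_i)` with `a_i ∈ 1_{d(γ_i)} R` and `∑ x_i a_i = 0` is the zero sequence. -/
def IsPseudoBasis (M : GrMod.{u, u'} R) {I : Type*} (γ : I → Mor Γ) (x : I → M) : Prop :=
  (∀ i, x i ∈ M.comp (γ i)) ∧
  (∀ N : AddSubgroup M, (∀ n ∈ N, ∀ a : R, M.act n a ∈ N) → (∀ i, x i ∈ N) → N = ⊤) ∧
  ∀ a : I →₀ R, (∀ i, ∃ b : R, a i = R.one (γ i).d * b) →
    (a.sum fun i r => M.act (x i) r) = 0 → a = 0

/-- `M` is pseudo-free: it has a pseudo-basis. -/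
def IsPseudoFree (M : GrMod.{u, u'} R) : Prop :=
  ∃ (I : Type u') (γ : I → Mor Γ) (x : I → M), M.IsPseudoBasis γ x

/-- `M ≅_gr N` as `Γ`-graded right modules. -/
def Iso (M : GrMod.{u, u'} R) (N : GrMod.{u, u''} R) : Prop :=
  ∃ φ : M ≃+ N, (∀ m a, φ (M.act m a) = N.act (φ m) a) ∧ ∀ γ, ∀ m ∈ M.comp γ, φ m ∈ N.comp γ

theorem act_mem_iSup {X : Type u'} [AddCommGroup X] (act : X →+ R →+ X)
    {A : Mor Γ → AddSubgroup X}
    (hact : ∀ {σ τ : Mor Γ} {m : X} {a : R}, m ∈ A σ → a ∈ R.comp τ → act m a ∈ compAt A σ τ)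
    {m : X} (hm : m ∈ ⨆ γ, A γ) (a : R) : act m a ∈ ⨆ γ, A γ := by
  have ha : a ∈ ⨆ γ, R.comp γ := by rw [R.iSup_comp]; trivial
  induction hm using AddSubgroup.iSup_induction' with
  | hp γ m hm =>
    induction ha using AddSubgroup.iSup_induction' with
    | hp δ b hb =>
      have := hact hm hb
      unfold compAt at this
      split_ifs at this with h
      · exact AddSubgroup.mem_iSup_of_mem _ this
      · rw [AddSubgroup.mem_bot.1 this]; exact zero_mem _
    | h1 => rw [map_zero]; exact zero_mem _
    | hadd x y _ _ h1 h2 => rw [map_add]; exact add_mem h1 h2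
  | h1 => rw [map_zero]; exact zero_mem _
  | hadd x y _ _ h1 h2 => rw [map_add]; exact add_mem h1 h2

/-- The graded module `⨁_γ A_γ ⊆ X` determined by a suitable family of additive subgroups `A_γ` of
a right `R`-module `X`. -/
def ofFinIndep {X : Type u'} [AddCommGroup X] (act : X →+ R →+ X)
    (act_mul : ∀ m a b, act (act m a) b = act m (a * b))
    (A : Mor Γ → AddSubgroup X) (hA : FinIndep A)
    (hact : ∀ {σ τ : Mor Γ} {m : X} {a : R}, m ∈ A σ → a ∈ R.comp τ → act m a ∈ compAt A σ τ) :
    GrMod.{u, u'} R where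
  carrier := (⨆ γ, A γ : AddSubgroup X)
  act := AddMonoidHom.mk'
    (fun m => AddMonoidHom.mk' (fun a => ⟨act m.1 a, act_mem_iSup act hact m.2 a⟩)
      fun a b => Subtype.ext (by simp))
    fun m n => AddMonoidHom.ext fun a => Subtype.ext (by simp)
  act_mul m a b := Subtype.ext (act_mul m.1 a b)
  comp γ := (A γ).addSubgroupOf (⨆ γ, A γ)
  isInternal := hA.isInternal_subtype
  act_mem {σ τ m a} hm ha := by
    have := hact (σ := σ) (τ := τ) hm ha
    unfold compAt at this ⊢
    split_ifs at this ⊢ with h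
    · exact this
    · exact AddSubgroup.mem_bot.2 (Subtype.ext (AddSubgroup.mem_bot.1 this))

/-- The regular module `R_R`. -/
abbrev regular (R : GrRing.{u} Γ) : GrMod.{u, u} R where
  carrier := R
  act := AddMonoidHom.mul
  act_mul m a b := mul_assoc m a b
  comp := R.comp
  isInternal := R.isInternal
  act_mem := R.mul_mem

/-- The shift `M(σ) = ⨁_γ M_{σγ}`, with `M(σ)_γ = M_{σγ}`. -/
def shift (M : GrMod.{u, u'} R) (σ : Mor Γ) : GrMod.{u, u'} R :=
  ofFinIndep M.act M.act_mul (fun γ => compAt M.comp σ γ) (finIndep_compAt M.finIndep σ)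
    (fun {γ τ m a} hm ha => by
      have key : act M m a = 0 ∨ ∃ h : γ.d = τ.r, M.act m a ∈ compAt M.comp σ (γ.mul τ h) := by
        unfold compAt at hm
        split_ifs at hm with h1
        swap
        · left; rw [AddSubgroup.mem_bot.1 hm, map_zero]; rfl
        have h2 := M.act_mem hm ha
        unfold compAt at h2
        split_ifs at h2 with h3
        · right
          refine ⟨h3, ?_⟩
          unfold compAt
          rw [dif_pos h1]
          rwa [Mor.mul_assoc h1 h3] at h2
        · exact .inl (AddSubgroup.mem_bot.1 h2)
      rcases key with h | ⟨h, h'⟩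
      · rw [h]; exact zero_mem _
      · rw [compAt, dif_pos h]; exact h')

/-- `M(e)` for an object `e`, i.e. the shift by the identity of `e`. -/
abbrev part (M : GrMod.{u, u'} R) (e : Γ) : GrMod.{u, u'} R := M.shift (Mor.id e)

/-- The set `Γ'₀(M)` of objects `e` with `M(e) ≠ 0`. -/
def objSupport (M : GrMod.{u, u'} R) : Set Γ := {e | Nontrivial (M.part e)}

/-- `M` is `Γ₀`-simple: `M(e)` is gr-simple for each `e ∈ Γ'₀(M)`. -/
def IsGammaSimple (M : GrMod.{u, u'} R) : Prop := ∀ e ∈ M.objSupport, (M.part e).IsGrSimple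

/-- `M` is `Γ₀`-artinian: `M(e)` is gr-artinian for each object `e`. -/
def IsGammaArtinian (M : GrMod.{u, u'} R) : Prop := ∀ e, (M.part e).IsGrArtinian

section DirectSum

variable {I : Type*} (M : I → GrMod.{u, u'} R)

/-- The component `⨁_i (M_i)_γ` of a direct sum. -/
def directSumComp (γ : Mor Γ) : AddSubgroup (DirectSum I fun i => M i) where
  carrier := {x | ∀ i, x i ∈ (M i).comp γ}
  zero_mem' _ := zero_mem _
  add_mem' hx hy i := add_mem (hx i) (hy i)
  neg_mem' hx i := neg_mem (hx i)

theorem directSum_isInternal : DirectSum.IsInternal (directSumComp M) := by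
  classical
  rw [isInternal_iff]
  refine ⟨fun s x hx h0 γ hγ => DFinsupp.ext fun i => ?_, ?_⟩
  · refine (M i).finIndep s (fun γ => x γ i) (fun γ hγ => hx γ hγ i) ?_ γ hγ
    have h := congrArg (DFinsupp.evalAddMonoidHom i) h0
    rw [map_sum, map_zero] at h
    exact h
  · rw [eq_top_iff]
    rintro x -
    induction x using DirectSum.induction_on with
    | zero => exact zero_mem _
    | add x y hx hy => exact add_mem hx hy
    | of i m =>
      have hm : m ∈ ⨆ γ, (M i).comp γ := by rw [(M i).iSup_comp]; trivial
      induction hm using AddSubgroup.iSup_induction' with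
      | hp γ m hm =>
        refine AddSubgroup.mem_iSup_of_mem γ fun j => ?_
        by_cases h : i = j
        · subst h; rwa [DirectSum.of_eq_same]
        · rw [DirectSum.of_eq_of_ne _ _ _ (Ne.symm h)]; exact zero_mem _
      | h1 => rw [map_zero]; exact zero_mem _
      | hadd x y _ _ h1 h2 => rw [map_add]; exact add_mem h1 h2

/-- The direct sum `⨁_i M_i` of graded modules. -/
def directSum : GrMod R where
  carrier := DirectSum I fun i => M i
  act := (AddMonoidHom.mk' (fun a : R => DirectSum.map fun i => (M i).act.flip a) fun a b => by
    ext; simp).flip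
  act_mul x a b := DFinsupp.ext fun i => by
    exact (M i).act_mul (x i) a b
  comp := directSumComp M
  isInternal := directSum_isInternal M
  act_mem {σ τ x a} hx ha := by
    have := fun i => (M i).act_mem (hx i) ha
    unfold compAt at this ⊢
    split_ifs at this ⊢ with h
    · exact this
    · exact AddSubgroup.mem_bot.2 (DFinsupp.ext fun i => AddSubgroup.mem_bot.1 (this i))

end DirectSum

/-- `R(Δ₀) = ⨁_{e ∈ Δ₀} R(e)` for a set `Δ₀` of objects. -/
def ofObjects (R : GrRing.{u} Γ) (Δ : Set Γ) : GrMod R :=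
  directSum fun e : Δ => (regular R).part e

end GrMod

namespace GrLeftMod

variable {Γ : Type v} [Groupoid.{w} Γ] {R : GrRing.{u} Γ}

instance : CoeSort (GrLeftMod.{u, u'} R) (Type u') := ⟨GrLeftMod.carrier⟩

attribute [instance] GrLeftMod.addCommGroup

/-- `L` is unital: `R L = L`. -/
def IsUnital (L : GrLeftMod.{u, u'} R) : Prop :=
  AddSubgroup.closure {x | ∃ (a : R) (m : L), x = L.act a m} = ⊤

/-- The sequence `(x_i)` of homogeneous elements `x_i ∈ L_{γ_i}` is a pseudo-basis of `L`: it
generates `L` as an `R`-module and the only finitely supported sequence `(a_i)` with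
`a_i ∈ R 1_{r(γ_i)}` and `∑ a_i x_i = 0` is the zero sequence. -/
def IsPseudoBasis (L : GrLeftMod.{u, u'} R) {I : Type*} (γ : I → Mor Γ) (x : I → L) : Prop :=
  (∀ i, x i ∈ L.comp (γ i)) ∧
  (∀ N : AddSubgroup L, (∀ a : R, ∀ n ∈ N, L.act a n ∈ N) → (∀ i, x i ∈ N) → N = ⊤) ∧
  ∀ a : I →₀ R, (∀ i, ∃ b : R, a i = b * R.one (γ i).r) →
    (a.sum fun i r => L.act r (x i)) = 0 → a = 0

/-- `L` is pseudo-free: it has a pseudo-basis. -/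
def IsPseudoFree (L : GrLeftMod.{u, u'} R) : Prop :=
  ∃ (I : Type u') (γ : I → Mor Γ) (x : I → L), L.IsPseudoBasis γ x

end GrLeftMod

/-! ## Properties of graded rings -/

namespace GrRing

variable {Γ : Type v} [Groupoid.{w} Γ]

/-- `R` is a (right) pfm ring: every (unital) `Γ`-graded right `R`-module is pseudo-free. -/
def IsPfm (R : GrRing.{u} Γ) : Prop := ∀ M : GrMod.{u, u} R, M.IsUnital → M.IsPseudoFree

/-- `R` is left pfm: every (unital) `Γ`-graded left `R`-module is pseudo-free. -/
def IsLeftPfm (R : GrRing.{u} Γ) : Prop := ∀ L : GrLeftMod.{u, u} R, L.IsUnital → L.IsPseudoFree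

/-- `I` is a graded left ideal of `R`. -/
def IsGrLeftIdeal (R : GrRing.{u} Γ) (I : AddSubgroup R) : Prop :=
  (∀ a : R, ∀ x ∈ I, a * x ∈ I) ∧ I = ⨆ γ, I ⊓ R.comp γ

/-- `I` is a graded (two-sided) ideal of `R`. -/
def IsGrIdeal (R : GrRing.{u} Γ) (I : AddSubgroup R) : Prop :=
  (∀ a : R, ∀ x ∈ I, a * x ∈ I ∧ x * a ∈ I) ∧ I = ⨆ γ, I ⊓ R.comp γ

/-- `R` is a gr-simple ring. -/
def IsGrSimple (R : GrRing.{u} Γ) : Prop :=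
  Nontrivial R ∧ ∀ I, R.IsGrIdeal I → I = ⊥ ∨ I = ⊤

/-- `R` is a gr-prime ring: `R ≠ 0`, and `I J ≠ 0` for all nonzero graded ideals `I`, `J`. -/
def IsGrPrime (R : GrRing.{u} Γ) : Prop :=
  Nontrivial R ∧ ∀ I J, R.IsGrIdeal I → R.IsGrIdeal J → I ≠ ⊥ → J ≠ ⊥ →
    ∃ a ∈ I, ∃ b ∈ J, a * b ≠ 0

/-- `R` is right gr-primitive: there is a graded right module `S` which is gr-simple (`S R ≠ 0` and
`S` has only the trivial graded submodules) and faithful. -/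
def IsRightGrPrimitive (R : GrRing.{u} Γ) : Prop :=
  ∃ S : GrMod.{u, u} R, (∃ m a, S.act m a ≠ 0) ∧ (∀ N, S.IsGrSubmodule N → N = ⊥ ∨ N = ⊤) ∧
    ∀ a : R, (∀ m, S.act m a = 0) → a = 0

/-- `R` is right `Γ₀`-artinian: `R_R` is a `Γ₀`-artinian module. -/
def IsRightGammaArtinian (R : GrRing.{u} Γ) : Prop := (GrMod.regular R).IsGammaArtinian

/-- `R` is left `Γ₀`-artinian: for each object `e`, the descending chain condition holds for the
graded left ideals contained in `(e)R = ⨁_{d(γ) = e} R_γ`. -/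
def IsLeftGammaArtinian (R : GrRing.{u} Γ) : Prop :=
  ∀ (e : Γ) (I : ℕ → AddSubgroup R),
    (∀ n, R.IsGrLeftIdeal (I n) ∧ I n ≤ ⨆ γ, compAt R.comp γ (Mor.id e)) →
    Antitone I → ∃ n, ∀ m ≥ n, I m = I n

/-- `D` is a gr-division ring. -/
def IsGrDivisionRing (D : GrRing.{u} Γ) : Prop :=
  Nontrivial D ∧ ∀ γ, ∀ a ∈ D.comp γ, a ≠ 0 →
    ∃ b ∈ D.comp γ.inv, a * b = D.one γ.r ∧ b * a = D.one γ.d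

/-- `supp D ⊆ e Γ e`. -/
def SupportedAt (D : GrRing.{u} Γ) (e : Γ) : Prop := ∀ γ, D.comp γ ≠ ⊥ → γ.d = e ∧ γ.r = e

/-- The ring `R_e`, with identity element `1_e`, is a division ring. -/
def IsDivisionRingAt (R : GrRing.{u} Γ) (e : Γ) : Prop :=
  R.one e ≠ 0 ∧ ∀ a ∈ R.comp (Mor.id e), a ≠ 0 →
    ∃ b ∈ R.comp (Mor.id e), a * b = R.one e ∧ b * a = R.one e

end GrRing

end GroupoidGraded

end

open GroupoidGraded

noncomputable section

namespace GroupoidGraded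

/-! ## Calculus in the groupoid -/

namespace Mor

variable {Γ : Type v} [Groupoid.{w} Γ]

/-! Everything reduces to one condition on elements, `SimplyGen Δ`: for each `f ∈ Δ` the right ideal
`1_f R` is gr-simple (every nonzero homogeneous `a ∈ 1_f R` satisfies `a b = 1_f` for some `b`), and
the ideal generated by the `1_f`, `f ∈ Δ`, contains all `1_e`. The core is that `R` is pfm iff such
a `Δ` exists.

If `Δ` exists, the usual proof that vector spaces have bases works (`exists_isPseudoBasis`).
Homogeneous elements whose degree has domain in `Δ` generate any unital module, and a relation
involving such an element `y` can be solved for `y`, because homogeneous coefficients in `1_f R` are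
right invertible. A maximal pseudo-independent set of such elements therefore generates.

Conversely (`IsPfm.simplyGen`), let `T` be the ideal generated by all `1_f` with `1_f R` gr-simple,
suppose `1_e ∉ T`, and take a graded right ideal `N ⊇ T` maximal with `1_e ∉ N`. A pseudo-basis of
`R / N` contains a nonzero element of range `e`; lift it to a homogeneous `c` with domain `f`.
Independence says that `c a ∈ N` forces `a = 0` for `a ∈ 1_f R`. Maximality gives `1_e ∈ N + c a R`
for every nonzero homogeneous `a ∈ 1_f R`, and multiplying by `c` on the right produces a right
inverse of `a`. So `1_f R` is gr-simple and `c = c 1_f ∈ T ⊆ N`, a contradiction.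

`SimplyGen Δ` is left-right symmetric (`RSimple.lSimple`, `simplyGen_op`). This gives the symmetry
of pfm rings, and lets the left artinian statements follow from the right ones over the opposite
ring.

For the matrix form, call `f, g ∈ Δ` linked if `1_f R 1_g ≠ 0`. This is an equivalence relation, and
representatives `f_j` of the classes still generate. A pseudo-basis `x_i` of `R_R` adapted to the
`f_j` has a dual family `y_i` (`SimplyGen.exists_isDualBasis`), and `a ↦ (y_k a x_l)` identifies `R`
with a product of matrix rings over the graded division rings `1_{f_j} R 1_{f_j}`
(`IsDualBasis.iso_prod_matrix`). That exactly one index has range `f_j` reflects the simplicity of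
`1_{f_j} R`.

The artinian items rest on two facts about gr-prime rings. If `R_f` is a division ring and `1_f R`
has the descending chain condition, then `1_f R` is gr-simple (`IsGrPrime.rSimple`, Brauer's lemma
on minimal right ideals). If moreover all `1_g R` have the chain condition, then `1_f` generates `R`
(`IsGrPrime.gen`). Conversely `SimplyGen Δ` makes every `1_e R` a submodule of a finite sum of zero
and gr-simple modules (`SimplyGen.rArt`). -/

theorem inv_inv (γ : Mor Γ) : γ.inv.inv = γ := by
  simp [inv]

theorem inv_injective : Function.Injective (inv : Mor Γ → Mor Γ) :=
  Function.LeftInverse.injective inv_inv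

theorem mul_id (γ : Mor Γ) {e : Γ} (h : γ.d = e) : γ.mul (id e) h = γ := by
  subst h; simp [mul, id]

theorem id_mul (γ : Mor Γ) {e : Γ} (h : e = γ.r) : (id e).mul γ h = γ := by
  subst h; simp [mul, id]

theorem mul_inv_self (γ : Mor Γ) : γ.mul γ.inv rfl = id γ.r := by
  simp [mul, inv, id]

theorem mul_inv_cancel_left (γ δ : Mor Γ) (h : γ.r = δ.r) :
    γ.mul (γ.inv.mul δ h) rfl = δ := by
  obtain ⟨a, b, g⟩ := γ
  obtain ⟨c, b', g'⟩ := δ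
  simp only at h
  subst h
  simp [mul, inv]

theorem mul_inv_rev (γ δ : Mor Γ) (h : γ.d = δ.r) :
    (γ.mul δ h).inv = δ.inv.mul γ.inv h.symm := by
  obtain ⟨a, b, g⟩ := γ
  obtain ⟨c, b', g'⟩ := δ
  simp only at h
  subst h
  simp [mul, inv]

end Mor

/-! ## Projections to homogeneous components -/

section Proj

variable {ι : Type*} {G : Type*} [AddCommGroup G] [DecidableEq ι] {A : ι → AddSubgroup G}

/-- The projection to a component of an internal direct sum. -/
def proj (hA : DirectSum.IsInternal A) (i : ι) : G →+ G :=
  (A i).subtype.comp ((DFinsupp.evalAddMonoidHom i).comp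
    (AddEquiv.ofBijective (DirectSum.coeAddMonoidHom A) hA).symm.toAddMonoidHom)

theorem proj_mem (hA : DirectSum.IsInternal A) (i : ι) (x : G) : proj hA i x ∈ A i :=
  SetLike.coe_mem _

theorem proj_of_mem (hA : DirectSum.IsInternal A) {i : ι} {x : G} (hx : x ∈ A i) (j : ι) :
    proj hA j x = if i = j then x else 0 := by
  have h : (AddEquiv.ofBijective (DirectSum.coeAddMonoidHom A) hA).symm x =
      DirectSum.of (fun i => A i) i ⟨x, hx⟩ := by
    rw [AddEquiv.symm_apply_eq]
    exact (DirectSum.coeAddMonoidHom_of A i ⟨x, hx⟩).symm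
  change (((AddEquiv.ofBijective (DirectSum.coeAddMonoidHom A) hA).symm x) j : G) = _
  rw [h]
  split_ifs with hij
  · subst hij; rw [DirectSum.of_eq_same]
  · rw [DirectSum.of_eq_of_ne _ _ _ (Ne.symm hij)]; rfl

theorem proj_same (hA : DirectSum.IsInternal A) {i : ι} {x : G} (hx : x ∈ A i) :
    proj hA i x = x := by rw [proj_of_mem hA hx, if_pos rfl]

theorem proj_ne (hA : DirectSum.IsInternal A) {i j : ι} {x : G} (hx : x ∈ A i) (h : i ≠ j) :
    proj hA j x = 0 := by rw [proj_of_mem hA hx, if_neg h]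

-- The components generate the group. Most identities below are additive in each argument, so this
-- reduces them to homogeneous elements.
@[elab_as_elim]
theorem homogeneous_induction (hA : DirectSum.IsInternal A) {p : G → Prop} (x : G)
    (hom : ∀ i, ∀ x ∈ A i, p x) (zero : p 0) (add : ∀ x y, p x → p y → p (x + y)) : p x := by
  have hx : x ∈ ⨆ i, A i := by rw [((isInternal_iff A).1 hA).2]; trivial
  exact AddSubgroup.iSup_induction A (C := p) hx hom zero add

theorem mem_of_proj_mem (hA : DirectSum.IsInternal A) {x : G} (N : AddSubgroup G)
    (h : ∀ i, proj hA i x ∈ N) : x ∈ N := by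
  have : ∃ s : Finset ι, x = ∑ i ∈ s, proj hA i x ∧ ∀ i ∉ s, proj hA i x = 0 := by
    clear h
    induction x using homogeneous_induction hA with
    | hom i x hx =>
      refine ⟨{i}, by simp [proj_same hA hx], fun j hj => proj_ne hA hx ?_⟩
      rintro rfl; simp at hj
    | zero => exact ⟨∅, by simp, by simp⟩
    | add x y hx hy =>
      obtain ⟨s, hs, hs'⟩ := hx
      obtain ⟨t, ht, ht'⟩ := hy
      refine ⟨s ∪ t, ?_, fun i hi => ?_⟩
      · simp only [map_add, Finset.sum_add_distrib]
        congr 1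
        · rw [← Finset.sum_subset Finset.subset_union_left fun i _ hi => hs' i hi]; exact hs
        · rw [← Finset.sum_subset Finset.subset_union_right fun i _ hi => ht' i hi]; exact ht
      · rw [Finset.mem_union, not_or] at hi
        rw [map_add, hs' i hi.1, ht' i hi.2, add_zero]
  obtain ⟨s, hs, -⟩ := this
  rw [hs]
  exact sum_mem fun i _ => h i

theorem eq_zero_of_proj (hA : DirectSum.IsInternal A) {x : G} (h : ∀ i, proj hA i x = 0) :
    x = 0 :=
  AddSubgroup.mem_bot.1 (mem_of_proj_mem hA ⊥ fun i => AddSubgroup.mem_bot.2 (h i))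

theorem exists_proj_ne_zero (hA : DirectSum.IsInternal A) {x : G} (h : x ≠ 0) :
    ∃ i, proj hA i x ≠ 0 := by
  by_contra! h'
  exact h (eq_zero_of_proj hA h')

/-- Stability under all projections is the form of gradedness that survives images, preimages and
intersections without effort. -/
theorem graded_iff (hA : DirectSum.IsInternal A) {N : AddSubgroup G} :
    N = ⨆ i, N ⊓ A i ↔ ∀ n ∈ N, ∀ i, proj hA i n ∈ N := by
  refine ⟨fun h n hn i => ?_, fun h => le_antisymm (fun n hn => ?_) (iSup_le fun i => inf_le_left)⟩
  · rw [h] at hn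
    induction hn using AddSubgroup.iSup_induction' with
    | hp j x hx =>
      rw [proj_of_mem hA hx.2]
      split_ifs
      · exact hx.1
      · exact zero_mem _
    | h1 => rw [map_zero]; exact zero_mem _
    | hadd x y _ _ h1 h2 => rw [map_add]; exact add_mem h1 h2
  · exact mem_of_proj_mem hA _ fun i => AddSubgroup.mem_iSup_of_mem i ⟨h n hn i, proj_mem hA i n⟩

theorem exists_homogeneous_of_ne_bot (hA : DirectSum.IsInternal A) {N : AddSubgroup G}
    (hN : N = ⨆ i, N ⊓ A i) (h : N ≠ ⊥) : ∃ i, ∃ x ∈ N, x ∈ A i ∧ x ≠ 0 := by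
  obtain ⟨x, hx, h0⟩ := N.bot_or_exists_ne_zero.resolve_left h
  obtain ⟨i, hi⟩ := exists_proj_ne_zero hA h0
  exact ⟨i, _, (graded_iff hA).1 hN _ hx i, proj_mem hA i _, hi⟩

theorem graded_closure (hA : DirectSum.IsInternal A) {S : Set G} (hS : ∀ x ∈ S, ∃ i, x ∈ A i) :
    AddSubgroup.closure S = ⨆ i, AddSubgroup.closure S ⊓ A i := by
  rw [graded_iff hA]
  intro n hn i
  induction hn using AddSubgroup.closure_induction with
  | mem x hx =>
    obtain ⟨j, hj⟩ := hS x hx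
    rw [proj_of_mem hA hj]
    split_ifs
    · exact AddSubgroup.subset_closure hx
    · exact zero_mem _
  | zero => rw [map_zero]; exact zero_mem _
  | add x y _ _ h1 h2 => rw [map_add]; exact add_mem h1 h2
  | neg x _ h => rw [map_neg]; exact neg_mem h

theorem graded_sup (hA : DirectSum.IsInternal A) {M N : AddSubgroup G} (hM : M = ⨆ i, M ⊓ A i)
    (hN : N = ⨆ i, N ⊓ A i) : M ⊔ N = ⨆ i, (M ⊔ N) ⊓ A i := by
  rw [graded_iff hA] at hM hN ⊢
  intro n hn i
  obtain ⟨a, ha, b, hb, rfl⟩ := AddSubgroup.mem_sup.1 hn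
  rw [map_add]
  exact add_mem (AddSubgroup.mem_sup_left (hM a ha i)) (AddSubgroup.mem_sup_right (hN b hb i))

theorem graded_inf (hA : DirectSum.IsInternal A) {M N : AddSubgroup G} (hM : M = ⨆ i, M ⊓ A i)
    (hN : N = ⨆ i, N ⊓ A i) : M ⊓ N = ⨆ i, (M ⊓ N) ⊓ A i := by
  rw [graded_iff hA] at hM hN ⊢
  exact fun n hn i => ⟨hM n hn.1 i, hN n hn.2 i⟩

end Proj

theorem mem_compAt {Γ : Type v} [Groupoid.{w} Γ] {G : Type u} [AddCommGroup G]
    {X : Mor Γ → AddSubgroup G} {σ τ : Mor Γ} (h : σ.d = τ.r) {x : G} :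
    x ∈ compAt X σ τ ↔ x ∈ X (σ.mul τ h) := by rw [compAt, dif_pos h]

theorem compAt_of_ne {Γ : Type v} [Groupoid.{w} Γ] {G : Type u} [AddCommGroup G]
    {X : Mor Γ → AddSubgroup G} {σ τ : Mor Γ} (h : σ.d ≠ τ.r) : compAt X σ τ = ⊥ := by
  rw [compAt, dif_neg h]

/-! ## Homogeneous elements of graded modules and rings -/

namespace GrMod

variable {Γ : Type v} [Groupoid.{w} Γ] {R : GrRing.{u} Γ}

theorem act_mem_mul (M : GrMod.{u, u'} R) {σ τ : Mor Γ} (h : σ.d = τ.r) {m : M} {a : R}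
    (hm : m ∈ M.comp σ) (ha : a ∈ R.comp τ) : M.act m a ∈ M.comp (σ.mul τ h) :=
  (mem_compAt h).1 (M.act_mem hm ha)

theorem act_eq_zero (M : GrMod.{u, u'} R) {σ τ : Mor Γ} (h : σ.d ≠ τ.r) {m : M} {a : R}
    (hm : m ∈ M.comp σ) (ha : a ∈ R.comp τ) : M.act m a = 0 := by
  have := M.act_mem hm ha
  rwa [compAt_of_ne h, AddSubgroup.mem_bot] at this

/-- The homogeneous component of degree `γ` of an element. -/
abbrev pr (M : GrMod.{u, u'} R) (γ : Mor Γ) : M →+ M := proj M.isInternal γ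

/-- By left cancellation in the groupoid, only the component of `a` of degree `τ` contributes in
degree `στ`. This turns arbitrary solutions of homogeneous equations into homogeneous ones. -/
theorem pr_act (M : GrMod.{u, u'} R) {σ τ : Mor Γ} (h : σ.d = τ.r) {m : M} (hm : m ∈ M.comp σ)
    (a : R) : M.pr (σ.mul τ h) (M.act m a) = M.act m (proj R.isInternal τ a) := by
  induction a using homogeneous_induction R.isInternal with
  | hom ρ a ha =>
    rw [proj_of_mem _ ha]
    by_cases hρ : σ.d = ρ.r
    · rw [pr, proj_of_mem _ (M.act_mem_mul hρ hm ha)]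
      by_cases h' : ρ = τ
      · subst h'; simp
      · rw [if_neg h', if_neg fun h'' => h' (Mor.mul_left_inj hρ h h''), map_zero]
    · rw [M.act_eq_zero hρ hm ha, map_zero]
      split_ifs with h'
      · exact absurd (h' ▸ h) hρ
      · rw [map_zero]
  | zero => simp
  | add x y hx hy => simp only [map_add, hx, hy]

end GrMod

namespace GrRing

variable {Γ : Type v} [Groupoid.{w} Γ] (R : GrRing.{u} Γ)

/-- The homogeneous component of degree `γ` of an element. -/
abbrev pr (γ : Mor Γ) : R →+ R := proj R.isInternal γ

variable {R}

theorem mul_mem_mul {γ δ : Mor Γ} (h : γ.d = δ.r) {a b : R}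
    (ha : a ∈ R.comp γ) (hb : b ∈ R.comp δ) : a * b ∈ R.comp (γ.mul δ h) :=
  (mem_compAt h).1 (R.mul_mem ha hb)

theorem mul_eq_zero_of_ne {γ δ : Mor Γ} (h : γ.d ≠ δ.r) {a b : R}
    (ha : a ∈ R.comp γ) (hb : b ∈ R.comp δ) : a * b = 0 :=
  (GrMod.regular R).act_eq_zero h ha hb

theorem homogeneous_mul {γ δ : Mor Γ} {a b : R} (ha : a ∈ R.comp γ) (hb : b ∈ R.comp δ) :
    ∃ ρ, a * b ∈ R.comp ρ := by
  by_cases h : γ.d = δ.r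
  · exact ⟨_, mul_mem_mul h ha hb⟩
  · exact ⟨γ, by rw [mul_eq_zero_of_ne h ha hb]; exact zero_mem _⟩

theorem mul_mem_of_ne_zero {γ δ : Mor Γ} {a b : R} (ha : a ∈ R.comp γ) (hb : b ∈ R.comp δ)
    (h : a * b ≠ 0) : ∃ h : γ.d = δ.r, a * b ∈ R.comp (γ.mul δ h) := by
  by_cases h' : γ.d = δ.r
  · exact ⟨h', mul_mem_mul h' ha hb⟩
  · exact absurd (mul_eq_zero_of_ne h' ha hb) h

theorem pr_mul {σ τ : Mor Γ} (h : σ.d = τ.r) {a : R} (ha : a ∈ R.comp σ) (b : R) :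
    R.pr (σ.mul τ h) (a * b) = a * R.pr τ b :=
  (GrMod.regular R).pr_act h ha b

theorem one_mul_of_r {γ : Mor Γ} {a : R} {e : Γ} (h : γ.r = e) (ha : a ∈ R.comp γ) :
    R.one e * a = a := by subst h; exact R.one_mul ha

theorem mul_one_of_d {γ : Mor Γ} {a : R} {e : Γ} (h : γ.d = e) (ha : a ∈ R.comp γ) :
    a * R.one e = a := by subst h; exact R.mul_one ha

theorem one_mul_of_r_ne {γ : Mor Γ} {a : R} {e : Γ} (h : γ.r ≠ e) (ha : a ∈ R.comp γ) :
    R.one e * a = 0 := mul_eq_zero_of_ne (Ne.symm h) (R.one_mem e) ha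

theorem mul_one_of_d_ne {γ : Mor Γ} {a : R} {e : Γ} (h : γ.d ≠ e) (ha : a ∈ R.comp γ) :
    a * R.one e = 0 := mul_eq_zero_of_ne h ha (R.one_mem e)

theorem one_mul_one (e : Γ) : R.one e * R.one e = R.one e :=
  one_mul_of_r (γ := Mor.id e) rfl (R.one_mem e)

theorem one_mul_one_of_ne {e f : Γ} (h : e ≠ f) : R.one e * R.one f = 0 :=
  mul_one_of_d_ne (γ := Mor.id e) h (R.one_mem e)

theorem one_mul_one_mul (e : Γ) (a : R) : R.one e * (R.one e * a) = R.one e * a := by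
  rw [← mul_assoc, one_mul_one]

theorem one_unique {e : Γ} {u : R} (hu : u ∈ R.comp (Mor.id e))
    (h : ∀ γ : Mor Γ, ∀ a ∈ R.comp γ, γ.r = e → u * a = a) : u = R.one e := by
  rw [← h (Mor.id e) _ (R.one_mem e) rfl]
  exact (R.mul_one hu).symm

/-- Identity elements of different objects are orthogonal idempotents. Consequently the objects with
nonzero identity inject into `R`, which later bounds the size of index sets. -/
theorem one_injOn {e f : Γ} (he : R.one e ≠ 0) (h : R.one e = R.one f) : e = f := by
  by_contra hne
  apply he
  have := one_mul_one_of_ne (R := R) hne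
  rwa [← h, one_mul_one] at this

theorem r_eq_of_one_mul {γ : Mor Γ} {a : R} {e : Γ} (ha : a ∈ R.comp γ) (h : R.one e * a ≠ 0) :
    γ.r = e := by
  by_contra hne
  exact h (one_mul_of_r_ne hne ha)

theorem one_mul_pr {e : Γ} {γ : Mor Γ} {a : R} (ha : R.one e * a = a) :
    R.one e * R.pr γ a = R.pr γ a := by
  by_cases h : e = γ.r
  · have := pr_mul (σ := Mor.id e) (τ := γ) h (R.one_mem e) a
    rw [Mor.id_mul, ha] at this
    exact this.symm
  · have h0 := one_mul_of_r_ne (R := R) (Ne.symm h) (proj_mem R.isInternal γ a)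
    rw [h0]
    rw [← ha]
    clear ha h0
    induction a using homogeneous_induction R.isInternal with
    | hom ρ a ha =>
      by_cases hρ : ρ.r = e
      · rw [one_mul_of_r hρ ha, pr, proj_ne _ ha fun h' => h (by rw [← h', hρ])]
      · rw [one_mul_of_r_ne hρ ha, map_zero]
    | zero => simp
    | add x y hx hy => rw [mul_add, map_add, ← hx, ← hy, add_zero]

theorem pr_eq_zero_of_r_ne {e : Γ} {γ : Mor Γ} {a : R} (ha : R.one e * a = a) (h : γ.r ≠ e) :
    R.pr γ a = 0 := by
  rw [← one_mul_pr ha]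
  exact one_mul_of_r_ne h (proj_mem _ _ _)

/-- A right inverse of a homogeneous element may be chosen to be homogeneous. -/
theorem exists_homogeneous_inv {γ : Mor Γ} {f : Γ} {a b : R} (h : γ.r = f) (ha : a ∈ R.comp γ)
    (hab : a * b = R.one f) : ∃ b ∈ R.comp γ.inv, a * b = R.one f := by
  refine ⟨_, proj_mem R.isInternal γ.inv b, ?_⟩
  subst h
  have := pr_mul (τ := γ.inv) rfl ha b
  rw [hab, Mor.mul_inv_self, pr, proj_same _ (R.one_mem _)] at this
  exact this.symm

theorem one_ne_zero_of_mem {γ : Mor Γ} {a : R} (ha : a ∈ R.comp γ) (h : a ≠ 0) :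
    R.one γ.r ≠ 0 ∧ R.one γ.d ≠ 0 :=
  ⟨fun h' => h (by rw [← R.one_mul ha, h', zero_mul]),
    fun h' => h (by rw [← R.mul_one ha, h', mul_zero])⟩

/-! ### Opposite rings -/

theorem finIndep_inv : FinIndep fun γ : Mor Γ => R.comp γ.inv :=
  R.finIndep.reindex _ (fun _ => True) Mor.inv (fun _ _ _ _ h => Mor.inv_injective h)
    (fun _ _ => le_rfl) (fun _ h => absurd trivial h)

variable (R) in
/-- The opposite ring, with the component of degree `γ` formed by the elements of degree `γ⁻¹`. -/
def op : GrRing.{u} Γ where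
  carrier := Rᵐᵒᵖ
  comp γ := (R.comp γ.inv).comap (MulOpposite.opAddEquiv (α := R)).symm.toAddMonoidHom
  isInternal := by
    rw [isInternal_iff]
    refine ⟨fun s x hx h0 i hi => ?_, ?_⟩
    · have h := congrArg (MulOpposite.opAddEquiv (α := R)).symm h0
      rw [map_sum, map_zero] at h
      exact MulOpposite.unop_injective
        (R.finIndep_inv s (fun i => MulOpposite.unop (x i)) hx h i hi)
    · rw [eq_top_iff]
      rintro x -
      obtain ⟨x, rfl⟩ := MulOpposite.op_surjective x
      induction x using homogeneous_induction R.isInternal with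
      | hom γ x hx =>
        refine AddSubgroup.mem_iSup_of_mem γ.inv ?_
        change x ∈ R.comp γ.inv.inv
        rwa [Mor.inv_inv]
      | zero => exact zero_mem _
      | add x y hx hy => exact add_mem hx hy
  mul_mem {γ δ a b} ha hb := by
    by_cases h : γ.d = δ.r
    · rw [mem_compAt h]
      -- The inversion of degrees compensates the reversed product: `(γδ)⁻¹ = δ⁻¹γ⁻¹`.
      change b.unop * a.unop ∈ R.comp (γ.mul δ h).inv
      rw [Mor.mul_inv_rev]
      exact mul_mem_mul h.symm hb ha
    · rw [compAt_of_ne h, AddSubgroup.mem_bot]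
      exact MulOpposite.unop_injective (mul_eq_zero_of_ne (Ne.symm h) hb ha)
  exists_one e := by
    refine ⟨MulOpposite.op (R.one e), ?_, fun γ a ha => ⟨fun h => ?_, fun h => ?_⟩⟩
    · change R.one e ∈ R.comp (Mor.id e).inv
      simpa [Mor.inv, Mor.id] using R.one_mem e
    · exact MulOpposite.unop_injective (mul_one_of_d (γ := γ.inv) h ha)
    · exact MulOpposite.unop_injective (one_mul_of_r (γ := γ.inv) h ha)

variable (R) in
/-- The identity map from a ring to its opposite. -/
def toOp : R ≃+ R.op := MulOpposite.opAddEquiv (α := R)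

theorem toOp_mul (a b : R) : R.toOp (a * b) = R.toOp b * R.toOp a := rfl

theorem toOp_mem {γ : Mor Γ} {a : R} : R.toOp a ∈ R.op.comp γ ↔ a ∈ R.comp γ.inv := Iff.rfl

theorem toOp_mem_inv {γ : Mor Γ} {a : R} : R.toOp a ∈ R.op.comp γ.inv ↔ a ∈ R.comp γ := by
  rw [toOp_mem, Mor.inv_inv]

theorem op_one (e : Γ) : R.op.one e = R.toOp (R.one e) := by
  refine (one_unique (R := R.op) ?_ fun γ a ha h => ?_).symm
  · change R.one e ∈ R.comp (Mor.id e).inv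
    simpa [Mor.inv, Mor.id] using R.one_mem e
  · exact MulOpposite.unop_injective (mul_one_of_d (γ := γ.inv) h ha)

end GrRing

end GroupoidGraded

end

noncomputable section

namespace GroupoidGraded

namespace GrRing

variable {Γ : Type v} [Groupoid.{w} Γ] {R : GrRing.{u} Γ}

/-! ## Ideals generated by identity elements -/

variable (R) in
/-- The right module `1_f R` is gr-simple, in terms of elements. -/
def RSimple (f : Γ) : Prop :=
  R.one f ≠ 0 ∧ ∀ γ : Mor Γ, γ.r = f → ∀ a ∈ R.comp γ, a ≠ 0 → ∃ b, a * b = R.one f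

variable (R) in
/-- The left module `R 1_f` is gr-simple, in terms of elements. -/
def LSimple (f : Γ) : Prop :=
  R.one f ≠ 0 ∧ ∀ γ : Mor Γ, γ.d = f → ∀ a ∈ R.comp γ, a ≠ 0 → ∃ b, b * a = R.one f

variable (R) in
/-- The additive subgroup generated by the products `x s y` with `s ∈ S`. -/
def genIdeal (S : Set R) : AddSubgroup R :=
  AddSubgroup.closure {z | ∃ s ∈ S, ∃ x y, z = x * s * y}

theorem mul_mul_mem_genIdeal {S : Set R} {s : R} (hs : s ∈ S) (x y : R) :
    x * s * y ∈ R.genIdeal S := AddSubgroup.subset_closure ⟨s, hs, x, y, rfl⟩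

theorem mem_genIdeal {S : Set R} {γ : Mor Γ} {s : R} (hs : s ∈ S) (h : s ∈ R.comp γ) :
    s ∈ R.genIdeal S := by
  have := mul_mul_mem_genIdeal hs (R.one γ.r) (R.one γ.d)
  rwa [R.one_mul h, R.mul_one h] at this

theorem genIdeal_mul_mem {S : Set R} (a : R) {x : R} (hx : x ∈ R.genIdeal S) :
    a * x ∈ R.genIdeal S ∧ x * a ∈ R.genIdeal S := by
  induction hx using AddSubgroup.closure_induction with
  | mem x hx =>
    obtain ⟨s, hs, x, y, rfl⟩ := hx
    refine ⟨?_, ?_⟩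
    · rw [← mul_assoc, ← mul_assoc]; exact mul_mul_mem_genIdeal hs _ _
    · rw [mul_assoc]; exact mul_mul_mem_genIdeal hs _ _
  | zero => simp [zero_mem]
  | add x y _ _ hx hy => rw [mul_add, add_mul]; exact ⟨add_mem hx.1 hy.1, add_mem hx.2 hy.2⟩
  | neg x _ hx => rw [mul_neg, neg_mul]; exact ⟨neg_mem hx.1, neg_mem hx.2⟩

theorem isGrIdeal_genIdeal {S : Set R} (hS : ∀ s ∈ S, ∃ γ, s ∈ R.comp γ) :
    R.IsGrIdeal (R.genIdeal S) := by
  refine ⟨fun a x hx => genIdeal_mul_mem a hx, ?_⟩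
  -- Expanding both outer factors into components shows that homogeneous products generate the same
  -- group, so `graded_closure` applies.
  have key : R.genIdeal S = AddSubgroup.closure
      {z | (∃ γ, z ∈ R.comp γ) ∧ ∃ s ∈ S, ∃ x y, z = x * s * y} := by
    refine le_antisymm ((AddSubgroup.closure_le _).2 ?_) (AddSubgroup.closure_mono fun z hz => hz.2)
    rintro _ ⟨s, hs, x, y, rfl⟩
    obtain ⟨γ, hγ⟩ := hS s hs
    rw [SetLike.mem_coe]
    induction x using homogeneous_induction R.isInternal with
    | hom α x hx =>
      induction y using homogeneous_induction R.isInternal with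
      | hom β y hy =>
        refine AddSubgroup.subset_closure ⟨?_, s, hs, x, y, rfl⟩
        obtain ⟨ρ, hρ⟩ := homogeneous_mul hx hγ
        exact homogeneous_mul hρ hy
      | zero => rw [mul_zero]; exact zero_mem _
      | add y y' h h' => rw [mul_add]; exact add_mem h h'
    | zero => rw [zero_mul, zero_mul]; exact zero_mem _
    | add y y' h h' => rw [add_mul, add_mul]; exact add_mem h h'
  rw [key]
  exact graded_closure R.isInternal fun x hx => hx.1

theorem genIdeal_le {S : Set R} {I : AddSubgroup R} (hI : ∀ a : R, ∀ x ∈ I, a * x ∈ I ∧ x * a ∈ I)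
    (h : S ⊆ I) : R.genIdeal S ≤ I := by
  refine (AddSubgroup.closure_le _).2 ?_
  rintro _ ⟨s, hs, x, y, rfl⟩
  exact (hI _ _ (hI _ _ (h hs)).1).2

variable (R) in
/-- The ideal generated by the identity elements `1_f`, `f ∈ Δ`. -/
def objIdeal (Δ : Set Γ) : AddSubgroup R := R.genIdeal (R.one '' Δ)

theorem mul_one_mul_mem_objIdeal {Δ : Set Γ} {f : Γ} (hf : f ∈ Δ) (x y : R) :
    x * R.one f * y ∈ R.objIdeal Δ := mul_mul_mem_genIdeal (Set.mem_image_of_mem _ hf) x y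

variable (R) in
/-- The identity elements `1_f`, `f ∈ Δ`, generate `R` as an ideal. -/
def Gen (Δ : Set Γ) : Prop := ∀ e, R.one e ∈ R.objIdeal Δ

theorem isGrIdeal_objIdeal (Δ : Set Γ) : R.IsGrIdeal (R.objIdeal Δ) :=
  isGrIdeal_genIdeal (by rintro _ ⟨f, -, rfl⟩; exact ⟨_, R.one_mem f⟩)

theorem eq_top_of_one_mem {N : AddSubgroup R} (hN : ∀ n ∈ N, ∀ a : R, n * a ∈ N)
    (h : ∀ e, R.one e ∈ N) : N = ⊤ := by
  rw [eq_top_iff]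
  rintro x -
  induction x using homogeneous_induction R.isInternal with
  | hom γ x hx => rw [← R.one_mul hx]; exact hN _ (h _) _
  | zero => exact zero_mem _
  | add x y hx hy => exact add_mem hx hy

theorem Gen.objIdeal_eq_top {Δ : Set Γ} (h : R.Gen Δ) : R.objIdeal Δ = ⊤ :=
  eq_top_of_one_mem (fun n hn a => ((isGrIdeal_objIdeal Δ).1 a n hn).2) h

theorem Gen.mono {Δ Δ' : Set Γ} (h : R.Gen Δ) (hΔ : ∀ f ∈ Δ, R.one f ∈ R.objIdeal Δ') :
    R.Gen Δ' := fun e =>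
  genIdeal_le (isGrIdeal_objIdeal Δ').1 (by rintro _ ⟨f, hf, rfl⟩; exact hΔ f hf) (h e)

theorem exists_one_ne_zero [Nontrivial R] : ∃ e, R.one e ≠ 0 := by
  obtain ⟨x, hx⟩ := exists_ne (0 : R)
  obtain ⟨γ, hγ⟩ := exists_proj_ne_zero R.isInternal hx
  exact ⟨_, (one_ne_zero_of_mem (proj_mem _ _ _) hγ).1⟩

theorem Gen.nonempty [Nontrivial R] {Δ : Set Γ} (h : R.Gen Δ) : Δ.Nonempty := by
  obtain ⟨e, he⟩ := exists_one_ne_zero (R := R)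
  by_contra hΔ
  rw [Set.not_nonempty_iff_eq_empty] at hΔ
  apply he
  have := h e
  simpa [objIdeal, genIdeal, hΔ] using this

/-- Otherwise the ideal generated by the `1_f`, `f ∈ Δ`, would annihilate `a` from the left; but it
contains the identity `1_{r(γ)}`, which fixes `a`. -/
theorem Gen.exists_mul_ne_zero {Δ : Set Γ} (h : R.Gen Δ) {γ : Mor Γ} {a : R} (ha : a ∈ R.comp γ)
    (h0 : a ≠ 0) : ∃ f ∈ Δ, ∃ δ : Mor Γ, δ.r = f ∧ ∃ b ∈ R.comp δ, b * a ≠ 0 := by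
  by_contra! H
  apply h0
  rw [← R.one_mul ha]
  have : ∀ t ∈ R.objIdeal Δ, t * a = 0 := by
    intro t ht
    induction ht using AddSubgroup.closure_induction with
    | mem t ht =>
      obtain ⟨_, ⟨f, hf, rfl⟩, x, y, rfl⟩ := ht
      rw [mul_assoc, mul_assoc]
      suffices R.one f * (y * a) = 0 by rw [this, mul_zero]
      induction y using homogeneous_induction R.isInternal with
      | hom δ y hy =>
        rw [← mul_assoc]
        by_cases hδ : δ.r = f
        · rw [one_mul_of_r hδ hy]; exact H f hf δ hδ y hy
        · rw [one_mul_of_r_ne hδ hy, zero_mul]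
      | zero => simp
      | add y y' h h' => rw [add_mul, mul_add, h, h', add_zero]
    | zero => simp
    | add x y _ _ hx hy => rw [add_mul, hx, hy, add_zero]
    | neg x _ hx => rw [neg_mul, hx, neg_zero]
  exact this _ (h _)

/-- Generation supplies `b` with range `g ∈ Δ` and `b a ≠ 0`. Simplicity at `g` gives `b a c = 1_g`,
and simplicity at `f` gives `c d = 1_f`. Then `c b a = c b a c d = c d = 1_f`, so `c b` is a left
inverse of `a`. -/
theorem RSimple.lSimple {Δ : Set Γ} (hΔ : ∀ f ∈ Δ, R.RSimple f) (h : R.Gen Δ) {f : Γ}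
    (hf : f ∈ Δ) : R.LSimple f := by
  refine ⟨(hΔ f hf).1, fun γ hγ a ha h0 => ?_⟩
  obtain ⟨g, hg, δ, hδ, b, hb, hba⟩ := h.exists_mul_ne_zero ha h0
  obtain ⟨hδγ, hmem⟩ := mul_mem_of_ne_zero hb ha hba
  obtain ⟨c, hc⟩ := (hΔ g hg).2 (δ.mul γ hδγ) hδ _ hmem hba
  obtain ⟨c, hcm, hc⟩ := exists_homogeneous_inv (γ := δ.mul γ hδγ) hδ hmem hc
  have hc0 : c ≠ 0 := fun h' => (hΔ g hg).1 (by rw [← hc, h', mul_zero])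
  obtain ⟨d, hd⟩ := (hΔ f hf).2 _ hγ c hcm hc0
  refine ⟨c * b, ?_⟩
  calc c * b * a = c * (b * (a * R.one f)) := by rw [mul_one_of_d hγ ha, mul_assoc]
    _ = c * ((b * a) * c) * d := by simp only [← hd, mul_assoc]
    _ = R.one f := by rw [hc, mul_one_of_d (γ := (δ.mul γ hδγ).inv) hδ hcm, hd]

theorem rSimple_op {f : Γ} : R.op.RSimple f ↔ R.LSimple f := by
  unfold RSimple LSimple
  rw [op_one]
  refine and_congr (not_congr R.toOp.map_eq_zero_iff)
    ⟨fun h γ hγ a ha h0 => ?_, fun h γ hγ a ha h0 => ?_⟩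
  · obtain ⟨b, hb⟩ := h γ.inv hγ (R.toOp a) (toOp_mem_inv.2 ha) (R.toOp.map_ne_zero_iff.2 h0)
    obtain ⟨b, rfl⟩ := R.toOp.surjective b
    exact ⟨b, R.toOp.injective hb⟩
  · obtain ⟨a, rfl⟩ := R.toOp.surjective a
    obtain ⟨b, hb⟩ := h γ.inv hγ a ha (R.toOp.map_ne_zero_iff.1 h0)
    exact ⟨R.toOp b, by rw [← toOp_mul, hb]⟩

theorem lSimple_op {f : Γ} : R.op.LSimple f ↔ R.RSimple f := by
  unfold RSimple LSimple
  rw [op_one]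
  refine and_congr (not_congr R.toOp.map_eq_zero_iff)
    ⟨fun h γ hγ a ha h0 => ?_, fun h γ hγ a ha h0 => ?_⟩
  · obtain ⟨b, hb⟩ := h γ.inv hγ (R.toOp a) (toOp_mem_inv.2 ha) (R.toOp.map_ne_zero_iff.2 h0)
    obtain ⟨b, rfl⟩ := R.toOp.surjective b
    exact ⟨b, R.toOp.injective hb⟩
  · obtain ⟨a, rfl⟩ := R.toOp.surjective a
    obtain ⟨b, hb⟩ := h γ.inv hγ a ha (R.toOp.map_ne_zero_iff.1 h0)
    exact ⟨R.toOp b, by rw [← toOp_mul, hb]⟩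

theorem mem_objIdeal_op {Δ : Set Γ} {x : R} :
    R.toOp x ∈ R.op.objIdeal Δ ↔ x ∈ R.objIdeal Δ := by
  have h1 : R.op.objIdeal Δ ≤ (R.objIdeal Δ).comap R.toOp.symm.toAddMonoidHom := by
    refine (AddSubgroup.closure_le _).2 ?_
    rintro _ ⟨_, ⟨f, hf, rfl⟩, x, y, rfl⟩
    obtain ⟨x, rfl⟩ := R.toOp.surjective x
    obtain ⟨y, rfl⟩ := R.toOp.surjective y
    rw [op_one, ← toOp_mul, ← toOp_mul, ← mul_assoc]
    exact mul_one_mul_mem_objIdeal hf _ _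
  have h2 : R.objIdeal Δ ≤ (R.op.objIdeal Δ).comap R.toOp.toAddMonoidHom := by
    refine (AddSubgroup.closure_le _).2 ?_
    rintro _ ⟨_, ⟨f, hf, rfl⟩, x, y, rfl⟩
    have := mul_one_mul_mem_objIdeal (R := R.op) hf (R.toOp y) (R.toOp x)
    rw [op_one, ← toOp_mul, ← toOp_mul, ← mul_assoc] at this
    exact this
  exact ⟨fun h => h1 h, fun h => h2 h⟩

theorem gen_op {Δ : Set Γ} : R.op.Gen Δ ↔ R.Gen Δ := by
  unfold Gen
  simp only [op_one, mem_objIdeal_op]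

variable (R) in
/-- The condition that `1_f R` is gr-simple for all `f ∈ Δ` and that `R = R 1_Δ R`. -/
def SimplyGen (Δ : Set Γ) : Prop := (∀ f ∈ Δ, R.RSimple f) ∧ R.Gen Δ

theorem simplyGen_op {Δ : Set Γ} : R.op.SimplyGen Δ ↔ R.SimplyGen Δ :=
  ⟨fun h => ⟨fun _ hf => lSimple_op.1 (RSimple.lSimple h.1 h.2 hf), gen_op.1 h.2⟩,
    fun h => ⟨fun _ hf => rSimple_op.2 (RSimple.lSimple h.1 h.2 hf), gen_op.2 h.2⟩⟩

/-- Right inverses of elements of `R_f` can be taken in `R_f`, and a right inverse has a right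
inverse itself, so it is two-sided. -/
theorem RSimple.isDivisionRingAt {f : Γ} (h : R.RSimple f) : R.IsDivisionRingAt f := by
  have key : ∀ a ∈ R.comp (Mor.id f), a ≠ 0 → ∃ b ∈ R.comp (Mor.id f), a * b = R.one f := by
    intro a ha h0
    obtain ⟨b, hb⟩ := h.2 (Mor.id f) rfl a ha h0
    obtain ⟨b, hbm, hb⟩ := exists_homogeneous_inv (γ := Mor.id f) rfl ha hb
    exact ⟨b, by simpa [Mor.inv, Mor.id] using hbm, hb⟩
  refine ⟨h.1, fun a ha h0 => ?_⟩
  obtain ⟨b, hbm, hb⟩ := key a ha h0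
  obtain ⟨c, hcm, hc⟩ := key b hbm fun h' => h.1 (by rw [← hb, h', mul_zero])
  refine ⟨b, hbm, hb, ?_⟩
  have : a = c := by
    rw [← mul_one_of_d (γ := Mor.id f) rfl ha, ← hc, ← mul_assoc, hb,
      one_mul_of_r (γ := Mor.id f) rfl hcm]
  rw [this, hc]

/-! ## Gr-simple and gr-prime rings -/

theorem IsGrPrime.exists_mul_mul_ne_zero (h : R.IsGrPrime) {α γ : Mor Γ} {a c : R}
    (ha : a ∈ R.comp α) (hc : c ∈ R.comp γ) (ha0 : a ≠ 0) (hc0 : c ≠ 0) :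
    ∃ β, ∃ b ∈ R.comp β, a * b * c ≠ 0 := by
  by_contra! H
  have H' : ∀ b, a * b * c = 0 := fun b => by
    induction b using homogeneous_induction R.isInternal with
    | hom β b hb => exact H β b hb
    | zero => simp
    | add x y hx hy => rw [mul_add, add_mul, hx, hy, add_zero]
  obtain ⟨p, hp, q, hq, hpq⟩ := h.2 (R.genIdeal {a}) (R.genIdeal {c})
    (isGrIdeal_genIdeal (by simpa using ⟨α, ha⟩)) (isGrIdeal_genIdeal (by simpa using ⟨γ, hc⟩))
    (fun h => ha0 (AddSubgroup.mem_bot.1 (h ▸ mem_genIdeal rfl ha)))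
    (fun h => hc0 (AddSubgroup.mem_bot.1 (h ▸ mem_genIdeal rfl hc)))
  apply hpq
  clear hpq
  induction hp using AddSubgroup.closure_induction with
  | mem p hp =>
    obtain ⟨s, hs, x, y, rfl⟩ := hp
    obtain rfl : s = a := hs
    induction hq using AddSubgroup.closure_induction with
    | mem q hq =>
      obtain ⟨t, ht, x', y', rfl⟩ := hq
      obtain rfl : t = c := ht
      have := H' (y * x')
      calc _ = x * (s * (y * x') * t) * y' := by simp only [mul_assoc]
        _ = 0 := by rw [this]; simp
    | zero => simp
    | add x y _ _ hx hy => rw [mul_add, hx, hy, add_zero]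
    | neg x _ hx => rw [mul_neg, hx, neg_zero]
  | zero => simp
  | add x y _ _ hx hy => rw [add_mul, hx, hy, add_zero]
  | neg x _ hx => rw [neg_mul, hx, neg_zero]

theorem IsGrSimple.isGrPrime (h : R.IsGrSimple) : R.IsGrPrime := by
  refine ⟨h.1, fun I J hI hJ hI0 hJ0 => ?_⟩
  have := h.1
  obtain ⟨e, he⟩ := exists_one_ne_zero (R := R)
  rw [(h.2 I hI).resolve_left hI0, (h.2 J hJ).resolve_left hJ0]
  exact ⟨R.one e, trivial, R.one e, trivial, by rwa [one_mul_one]⟩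

theorem IsGrSimple.gen (h : R.IsGrSimple) {f : Γ} (hf : R.one f ≠ 0) : R.Gen {f} := by
  have := (h.2 _ (isGrIdeal_objIdeal {f})).resolve_left fun h' => hf ?_
  · intro e; rw [this]; trivial
  · rw [← AddSubgroup.mem_bot, ← h']
    exact mem_genIdeal ⟨f, rfl, rfl⟩ (R.one_mem f)

/-- A nonzero graded ideal contains a nonzero homogeneous `a`. By `H` it contains a nonzero
homogeneous `b a ∈ 1_f R`, which is right invertible, so it contains `1_f` for every `f ∈ Δ`. -/
theorem SimplyGen.isGrSimple_of [Nontrivial R] {Δ : Set Γ} (h : R.SimplyGen Δ)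
    (H : ∀ (γ : Mor Γ), ∀ a ∈ R.comp γ, a ≠ 0 → ∀ f ∈ Δ,
      ∃ δ : Mor Γ, δ.r = f ∧ ∃ b ∈ R.comp δ, b * a ≠ 0) : R.IsGrSimple := by
  refine ⟨inferInstance, fun I hI => ?_⟩
  by_cases hI0 : I = ⊥
  · exact .inl hI0
  right
  obtain ⟨γ, a, haI, ha, h0⟩ := exists_homogeneous_of_ne_bot R.isInternal hI.2 hI0
  rw [eq_top_iff, ← h.2.objIdeal_eq_top]
  refine genIdeal_le hI.1 ?_
  rintro _ ⟨f, hf, rfl⟩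
  obtain ⟨δ, hδ, b, hb, hba⟩ := H γ a ha h0 f hf
  obtain ⟨h', hmem⟩ := mul_mem_of_ne_zero hb ha hba
  obtain ⟨c, hc⟩ := (h.1 f hf).2 (δ.mul γ h') hδ _ hmem hba
  rw [← hc]
  exact (hI.1 _ _ (hI.1 _ _ haI).1).2

theorem SimplyGen.isGrSimple_of_singleton {f : Γ} (h : R.SimplyGen {f}) : R.IsGrSimple := by
  have : Nontrivial R := ⟨_, _, (h.1 f rfl).1⟩
  refine h.isGrSimple_of fun γ a ha h0 f hf => ?_
  obtain ⟨g, hg, H⟩ := h.2.exists_mul_ne_zero ha h0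
  rw [Set.mem_singleton_iff] at hf hg
  subst hf hg
  exact H

theorem SimplyGen.isGrSimple_of_isGrPrime {Δ : Set Γ} (h : R.SimplyGen Δ) (hR : R.IsGrPrime) :
    R.IsGrSimple := by
  have := hR.1
  refine h.isGrSimple_of fun γ a ha h0 f hf => ?_
  -- Primeness for the pair `1_f`, `a` links every `f ∈ Δ` to `a`, which is what
  -- `SimplyGen.isGrSimple_of` needs.
  obtain ⟨β, b, hb, hba⟩ := hR.exists_mul_mul_ne_zero (R.one_mem f) ha (h.1 f hf).1 h0
  have h1 : R.one f * b ≠ 0 := fun h => hba (by rw [h, zero_mul])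
  have h2 := r_eq_of_one_mul hb h1
  exact ⟨β, h2, b, hb, by rwa [one_mul_of_r h2 hb] at hba⟩

/-- For a faithful gr-simple `S` and nonzero graded ideals `I`, `J`, the graded submodule `S I` is
nonzero, hence equals `S`. If `I J = 0` then `S J = S I J = 0`, contradicting faithfulness. -/
theorem IsRightGrPrimitive.isGrPrime (h : R.IsRightGrPrimitive) : R.IsGrPrime := by
  obtain ⟨S, ⟨m, a, hma⟩, hS, hf⟩ := h
  refine ⟨⟨a, 0, fun h => hma (by simp [h])⟩, fun I J hI hJ hI0 hJ0 => ?_⟩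
  by_contra! H
  -- This is `S I`, with homogeneous generators so that it is visibly graded.
  let N : AddSubgroup S := AddSubgroup.closure
    {x | ∃ σ τ, ∃ m ∈ S.comp σ, ∃ a ∈ R.comp τ, a ∈ I ∧ x = S.act m a}
  have hN : S.IsGrSubmodule N := by
    refine ⟨fun n hn b => ?_, graded_closure S.isInternal ?_⟩
    · induction hn using AddSubgroup.closure_induction with
      | mem x hx =>
        obtain ⟨σ, τ, m, hm, a, ha, haI, rfl⟩ := hx
        rw [S.act_mul]
        induction b using homogeneous_induction R.isInternal with
        | hom ρ b hb =>
          obtain ⟨ρ', h'⟩ := homogeneous_mul ha hb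
          exact AddSubgroup.subset_closure ⟨σ, ρ', m, hm, _, h', (hI.1 _ _ haI).2, rfl⟩
        | zero => simp [zero_mem]
        | add x y hx hy => rw [mul_add, map_add]; exact add_mem hx hy
      | zero => simp [zero_mem]
      | add x y _ _ hx hy => rw [map_add]; exact add_mem hx hy
      | neg x _ hx => rw [map_neg]; exact neg_mem hx
    · rintro _ ⟨σ, τ, m, hm, a, ha, haI, rfl⟩
      by_cases h : σ.d = τ.r
      · exact ⟨_, S.act_mem_mul h hm ha⟩
      · exact ⟨σ, by rw [S.act_eq_zero h hm ha]; exact zero_mem _⟩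
  rcases hS N hN with h | h
  · obtain ⟨γ, a, haI, ha, h0⟩ := exists_homogeneous_of_ne_bot R.isInternal hI.2 hI0
    refine h0 (hf a fun m => ?_)
    induction m using homogeneous_induction S.isInternal with
    | hom σ m hm =>
      rw [← AddSubgroup.mem_bot, ← h]
      exact AddSubgroup.subset_closure ⟨σ, γ, m, hm, a, ha, haI, rfl⟩
    | zero => simp
    | add x y hx hy => simp [hx, hy]
  · apply hJ0
    rw [eq_bot_iff]
    intro b hb
    refine AddSubgroup.mem_bot.2 (hf b fun m => ?_)
    have hm : m ∈ N := by rw [h]; trivial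
    induction hm using AddSubgroup.closure_induction with
    | mem x hx =>
      obtain ⟨σ, τ, m, hm, a, ha, haI, rfl⟩ := hx
      rw [S.act_mul, H a haI b hb, map_zero]
    | zero => simp
    | add x y _ _ hx hy => simp [hx, hy]
    | neg x _ hx => simp [hx]

/-! ## Chain conditions -/

variable (R) in
/-- `N` is a graded right ideal. -/
abbrev IsGrRightIdeal (N : AddSubgroup R) : Prop := (GrMod.regular R).IsGrSubmodule N

variable (R) in
/-- The descending chain condition for the graded right ideals contained in `N`. -/
def HasDCC (N : AddSubgroup R) : Prop :=
  ∀ C : ℕ → AddSubgroup R, (∀ n, R.IsGrRightIdeal (C n) ∧ C n ≤ N) → Antitone C →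
    ∃ n, ∀ m ≥ n, C m = C n

variable (R) in
/-- The right ideal `1_f R`. -/
def rightPart (f : Γ) : AddSubgroup R where
  carrier := {x | R.one f * x = x}
  zero_mem' := by simp
  add_mem' {x y} hx hy := by
    simp only [Set.mem_ofPred_eq] at hx hy ⊢; rw [mul_add, hx, hy]
  neg_mem' {x} hx := by simp only [Set.mem_ofPred_eq] at hx ⊢; rw [mul_neg, hx]

theorem mem_rightPart {f : Γ} {x : R} : x ∈ R.rightPart f ↔ R.one f * x = x := Iff.rfl

theorem one_mem_rightPart (f : Γ) : R.one f ∈ R.rightPart f := one_mul_one f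

theorem isGrRightIdeal_rightPart (f : Γ) : R.IsGrRightIdeal (R.rightPart f) := by
  refine ⟨fun n hn a => ?_, (graded_iff R.isInternal).2 fun n hn γ => one_mul_pr hn⟩
  rw [mem_rightPart] at hn ⊢
  change R.one f * (n * a) = n * a
  rw [← mul_assoc, hn]

theorem HasDCC.mono {M N : AddSubgroup R} (h : R.HasDCC N) (hMN : M ≤ N) : R.HasDCC M :=
  fun C hC => h C fun n => ⟨(hC n).1, (hC n).2.trans hMN⟩

theorem hasDCC_bot : R.HasDCC ⊥ := fun C hC _ =>
  ⟨0, fun m _ => by rw [eq_bot_iff.2 (hC m).2, eq_bot_iff.2 (hC 0).2]⟩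

theorem isGrRightIdeal_bot : R.IsGrRightIdeal ⊥ := by
  refine ⟨fun n hn a => ?_, by simp⟩
  rw [AddSubgroup.mem_bot.1 hn]; simp [zero_mem]

theorem IsGrRightIdeal.inf {M N : AddSubgroup R} (hM : R.IsGrRightIdeal M)
    (hN : R.IsGrRightIdeal N) : R.IsGrRightIdeal (M ⊓ N) :=
  ⟨fun n hn a => ⟨hM.1 n hn.1 a, hN.1 n hn.2 a⟩, graded_inf R.isInternal hM.2 hN.2⟩

theorem IsGrRightIdeal.sup {M N : AddSubgroup R} (hM : R.IsGrRightIdeal M)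
    (hN : R.IsGrRightIdeal N) : R.IsGrRightIdeal (M ⊔ N) := by
  refine ⟨fun n hn a => ?_, graded_sup R.isInternal hM.2 hN.2⟩
  obtain ⟨x, hx, y, hy, rfl⟩ := AddSubgroup.mem_sup.1 hn
  rw [map_add]
  exact add_mem (AddSubgroup.mem_sup_left (hM.1 x hx a)) (AddSubgroup.mem_sup_right (hN.1 y hy a))

/-- A chain `C n` in `M ⊔ N` is controlled by `C n ⊓ M` and by `C n ⊔ M`. By modularity the latter
is determined by its intersection with `N`, so both stabilize. -/
theorem HasDCC.sup {M N : AddSubgroup R} (hM : R.HasDCC M) (hN : R.HasDCC N)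
    (hM' : R.IsGrRightIdeal M) (hN' : R.IsGrRightIdeal N) : R.HasDCC (M ⊔ N) := by
  intro C hC hanti
  obtain ⟨n₁, h₁⟩ := hM (fun n => C n ⊓ M) (fun n => ⟨(hC n).1.inf hM', inf_le_right⟩)
    fun a b hab => inf_le_inf_right _ (hanti hab)
  obtain ⟨n₂, h₂⟩ := hN (fun n => (C n ⊔ M) ⊓ N)
    (fun n => ⟨((hC n).1.sup hM').inf hN', inf_le_right⟩)
    fun a b hab => inf_le_inf_right _ (sup_le_sup_right (hanti hab) _)
  have key : ∀ n, C n ⊔ M = M ⊔ (C n ⊔ M) ⊓ N := fun n => by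
    rw [inf_comm, ← sup_inf_assoc_of_le N (le_sup_right : M ≤ C n ⊔ M), eq_comm,
      inf_eq_right]
    exact sup_le (hC n).2 le_sup_left
  refine ⟨max n₁ n₂, fun m hm => ?_⟩
  -- In a modular lattice, comparable elements with the same meet and the same join with `M`
  -- coincide.
  refine eq_of_le_of_inf_le_of_sup_le (hanti hm) (z := M) ?_ ?_
  · have := (h₁ _ (le_max_left n₁ n₂)).trans (h₁ m ((le_max_left _ _).trans hm)).symm
    exact this.le
  · rw [key m, key (max n₁ n₂), h₂ m ((le_max_right _ _).trans hm), h₂ _ (le_max_right n₁ n₂)]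

theorem isGrRightIdeal_map_mulLeft {N : AddSubgroup R} (hN : R.IsGrRightIdeal N) {γ : Mor Γ}
    {a : R} (ha : a ∈ R.comp γ) : R.IsGrRightIdeal (N.map (AddMonoidHom.mulLeft a)) := by
  refine ⟨?_, (graded_iff R.isInternal).2 ?_⟩
  · rintro _ ⟨n, hn, rfl⟩ b
    exact ⟨n * b, hN.1 n hn b, (mul_assoc a n b).symm⟩
  · rintro _ ⟨n, hn, rfl⟩ ρ
    change R.pr ρ (a * n) ∈ _
    by_cases h : γ.r = ρ.r
    · rw [← Mor.mul_inv_cancel_left γ ρ h, pr_mul (Eq.refl _) ha]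
      exact ⟨_, (graded_iff R.isInternal).1 hN.2 n hn _, rfl⟩
    · rw [pr_eq_zero_of_r_ne (e := γ.r) _ (Ne.symm h)]
      · exact zero_mem _
      · rw [← mul_assoc, R.one_mul ha]

theorem isGrRightIdeal_top : R.IsGrRightIdeal ⊤ :=
  ⟨fun _ _ _ => trivial, (graded_iff R.isInternal).2 fun _ _ _ => trivial⟩

variable (R) in
/-- The right ideal `a R`. -/
def mulRange (a : R) : AddSubgroup R := (⊤ : AddSubgroup R).map (AddMonoidHom.mulLeft a)

theorem mem_mulRange {a x : R} : x ∈ R.mulRange a ↔ ∃ b, a * b = x := by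
  simp [mulRange]

theorem isGrRightIdeal_mulRange {γ : Mor Γ} {a : R} (ha : a ∈ R.comp γ) :
    R.IsGrRightIdeal (R.mulRange a) := isGrRightIdeal_map_mulLeft isGrRightIdeal_top ha

/-- The module `a R` is an image of the gr-simple `1_{d(γ)} R`. A nonzero homogeneous `a x` may be
written with `x` homogeneous in `1_{d(γ)} R`, and a right inverse of `x` brings it back to `a`. -/
theorem RSimple.mem_of_le_mulRange {γ : Mor Γ} (h : R.RSimple γ.d) {a : R} (ha : a ∈ R.comp γ)
    {N : AddSubgroup R} (hN : R.IsGrRightIdeal N) (hle : N ≤ R.mulRange a) (h0 : N ≠ ⊥) :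
    a ∈ N := by
  obtain ⟨ρ, y, hyN, hy, hy0⟩ := exists_homogeneous_of_ne_bot R.isInternal hN.2 h0
  obtain ⟨x, rfl⟩ := mem_mulRange.1 (hle hyN)
  have hr : γ.r = ρ.r := by
    by_contra hne
    apply hy0
    rw [← R.one_mul ha, mul_assoc, one_mul_of_r_ne (Ne.symm hne) hy]
  have h1 : a * x = a * R.pr (γ.inv.mul ρ hr) x := by
    rw [← pr_mul (Eq.refl _) ha, Mor.mul_inv_cancel_left γ ρ hr, pr, proj_same _ hy]
  obtain ⟨z, hz⟩ := h.2 _ rfl _ (proj_mem R.isInternal (γ.inv.mul ρ hr) x)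
    fun h' => hy0 (by rw [h1, pr, h', mul_zero])
  have := hN.1 _ hyN z
  change a * x * z ∈ N at this
  rwa [h1, mul_assoc, hz, R.mul_one ha] at this

theorem RSimple.hasDCC_mulRange {γ : Mor Γ} (h : R.RSimple γ.d) {a : R} (ha : a ∈ R.comp γ) :
    R.HasDCC (R.mulRange a) := by
  intro C hC hanti
  by_cases H : ∃ n, C n = ⊥
  · obtain ⟨n, hn⟩ := H
    exact ⟨n, fun m hm => by rw [hn, eq_bot_iff, ← hn]; exact hanti hm⟩
  · push Not at H
    have : ∀ n, C n = R.mulRange a := fun n => le_antisymm (hC n).2 fun x hx => by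
      obtain ⟨b, rfl⟩ := mem_mulRange.1 hx
      exact (hC n).1.1 _ (h.mem_of_le_mulRange ha (hC n).1 (hC n).2 (H n)) b
    exact ⟨0, fun m _ => by rw [this, this]⟩

variable (R) in
/-- The descending chain condition for the right ideals `1_f R`. -/
def RArt : Prop := ∀ f, R.HasDCC (R.rightPart f)

/-- Each element of the generated ideal lies in a finite sum of right ideals `x R`, with `x`
homogeneous of domain in `Δ`. Each of these has the chain condition, hence so does their sum. For
`1_e` this sum contains `1_e R`. -/
theorem SimplyGen.rArt {Δ : Set Γ} (h : R.SimplyGen Δ) : R.RArt := by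
  intro e
  have key : ∀ t ∈ R.objIdeal Δ, ∃ N, R.IsGrRightIdeal N ∧ R.HasDCC N ∧ t ∈ N := by
    intro t ht
    induction ht using AddSubgroup.closure_induction with
    | mem t ht =>
      obtain ⟨_, ⟨f, hf, rfl⟩, x, y, rfl⟩ := ht
      induction x using homogeneous_induction R.isInternal with
      | hom γ x hx =>
        by_cases hγ : γ.d = f
        · subst hγ
          refine ⟨_, isGrRightIdeal_mulRange hx, (h.1 _ hf).hasDCC_mulRange hx, ?_⟩
          exact mem_mulRange.2 ⟨R.one γ.d * y, (mul_assoc _ _ _).symm⟩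
        · refine ⟨⊥, isGrRightIdeal_bot, hasDCC_bot, ?_⟩
          rw [mul_one_of_d_ne hγ hx, zero_mul]; exact zero_mem _
      | zero => exact ⟨⊥, isGrRightIdeal_bot, hasDCC_bot, by simp [zero_mem]⟩
      | add a b ha hb =>
        obtain ⟨M, hM, hM', ha⟩ := ha
        obtain ⟨N, hN, hN', hb⟩ := hb
        refine ⟨M ⊔ N, hM.sup hN, hM'.sup hN' hM hN, ?_⟩
        rw [add_mul, add_mul]
        exact add_mem (AddSubgroup.mem_sup_left ha) (AddSubgroup.mem_sup_right hb)
    | zero => exact ⟨⊥, isGrRightIdeal_bot, hasDCC_bot, zero_mem _⟩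
    | add a b _ _ ha hb =>
      obtain ⟨M, hM, hM', ha⟩ := ha
      obtain ⟨N, hN, hN', hb⟩ := hb
      exact ⟨M ⊔ N, hM.sup hN, hM'.sup hN' hM hN,
        add_mem (AddSubgroup.mem_sup_left ha) (AddSubgroup.mem_sup_right hb)⟩
    | neg a _ ha =>
      obtain ⟨M, hM, hM', ha⟩ := ha
      exact ⟨M, hM, hM', neg_mem ha⟩
  obtain ⟨N, hN, hN', he⟩ := key _ (h.2 e)
  refine hN'.mono fun x hx => ?_
  rw [mem_rightPart] at hx
  rw [← hx]
  exact hN.1 _ he x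

/-! ### Minimal right ideals in gr-prime rings -/

theorem HasDCC.exists_minimal {M : AddSubgroup R} (h : R.HasDCC M) {P : AddSubgroup R → Prop}
    (hP : ∃ N, R.IsGrRightIdeal N ∧ N ≤ M ∧ P N) : ∃ N, R.IsGrRightIdeal N ∧ N ≤ M ∧ P N ∧
      ∀ N', R.IsGrRightIdeal N' → N' ≤ N → P N' → N' = N := by
  let α := {N : AddSubgroup R // R.IsGrRightIdeal N ∧ N ≤ M}
  have hwf : WellFoundedLT α := by
    have : WellFoundedGT αᵒᵈ := by
      rw [wellFoundedGT_iff_monotone_chain_condition]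
      intro a
      obtain ⟨n, hn⟩ := h (fun n => (a n).1) (fun n => (a n).2) fun i j hij => a.monotone hij
      exact ⟨n, fun m hm => Subtype.ext (hn m hm).symm⟩
    exact ⟨this.wf⟩
  obtain ⟨N, hN, hNM, hPN⟩ := hP
  obtain ⟨K, hK, hmin⟩ := hwf.wf.has_min {K : α | P K.1} ⟨⟨N, hN, hNM⟩, hPN⟩
  refine ⟨K.1, K.2.1, K.2.2, hK, fun N' h1 h2 h3 => ?_⟩
  by_contra hne
  exact hmin ⟨N', h1, h2.trans K.2.2⟩ h3 (lt_of_le_of_ne h2 fun h => hne (congrArg Subtype.val h))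

/-- A graded version of Brauer's lemma. A minimal graded right ideal `N ⊆ 1_f R` is not nilpotent by
primeness, so it contains an element acting as a right identity on some nonzero homogeneous element
of `N`. The relevant component of it lies in the division ring `R_f`, whence `1_f ∈ N` and `1_f R =
N` is minimal. -/
theorem IsGrPrime.rSimple (hR : R.IsGrPrime) {f : Γ} (hf : R.IsDivisionRingAt f)
    (hA : R.HasDCC (R.rightPart f)) : R.RSimple f := by
  obtain ⟨N, hN, hNf, hN0, hmin⟩ := hA.exists_minimal (P := fun N => N ≠ ⊥)
    ⟨_, isGrRightIdeal_rightPart f, le_rfl,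
      fun h => hf.1 (AddSubgroup.mem_bot.1 (h ▸ one_mem_rightPart f))⟩
  obtain ⟨α, a, haN, ha, ha0⟩ := exists_homogeneous_of_ne_bot R.isInternal hN.2 hN0
  obtain ⟨β, b, hb, hab⟩ := hR.exists_mul_mul_ne_zero ha ha ha0 ha0
  have hn0 : a * b ≠ 0 := fun h => hab (by rw [h, zero_mul])
  obtain ⟨hαβ, hn⟩ := mul_mem_of_ne_zero ha hb hn0
  have hnN : a * b ∈ N := hN.1 a haN b
  -- The right ideal `a b N` is contained in `N` and contains `a b a ≠ 0`, so minimality applies.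
  have h1 : N.map (AddMonoidHom.mulLeft (a * b)) = N := by
    refine hmin _ (isGrRightIdeal_map_mulLeft hN hn) ?_ fun h => hab ?_
    · rintro _ ⟨x, hx, rfl⟩; exact hN.1 _ hnN x
    · rw [← AddSubgroup.mem_bot, ← h]; exact ⟨a, haN, rfl⟩
  obtain ⟨x, hx, hx'⟩ : ∃ x ∈ N, a * b * x = a * b := by
    have := hnN; rw [← h1] at this; exact this
  -- Comparing components in the degree of `a b` replaces `x` by its component at the identity of
  -- `d(β)`.
  have h2 := pr_mul (R := R) (σ := α.mul β hαβ) (τ := Mor.id β.d) rfl hn x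
  rw [hx', Mor.mul_id _ (Eq.refl _), pr, proj_same _ hn] at h2
  have hxN := (graded_iff R.isInternal).1 hN.2 x hx (Mor.id β.d)
  have hx0 : R.pr (Mor.id β.d) x ≠ 0 := fun h => hn0 (by rw [h2, h, mul_zero])
  -- This nonzero component lies in `N ⊆ 1_f R`, so the range `d(β)` of its degree must be `f`;
  -- hence it belongs to `R_f` and is invertible.
  have hβ : β.d = f := by
    refine r_eq_of_one_mul (proj_mem R.isInternal (Mor.id β.d) x) ?_
    rw [hNf hxN]; exact hx0
  rw [hβ] at hxN hx0
  obtain ⟨c, -, hc, -⟩ := hf.2 _ (proj_mem R.isInternal _ x) hx0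
  have h1N : R.one f ∈ N := by rw [← hc]; exact hN.1 _ hxN c
  refine ⟨hf.1, fun γ hγ a ha h0 => ?_⟩
  have haN : a ∈ N := by rw [← one_mul_of_r hγ ha]; exact hN.1 _ h1N a
  have := hmin (R.mulRange a) (isGrRightIdeal_mulRange ha)
    (fun y hy => by obtain ⟨z, rfl⟩ := mem_mulRange.1 hy; exact hN.1 _ haN z)
    (fun h => h0 (by
      rw [← AddSubgroup.mem_bot, ← h, mem_mulRange]; exact ⟨_, R.mul_one ha⟩))
  rw [← this, mem_mulRange] at h1N
  exact h1N

theorem isGrRightIdeal_ker_mulLeft {γ : Mor Γ} {b : R} (hb : b ∈ R.comp γ) :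
    R.IsGrRightIdeal (AddMonoidHom.mulLeft b).ker := by
  refine ⟨fun n hn r => ?_, (graded_iff R.isInternal).2 fun n hn ρ => ?_⟩
  · have : b * n = 0 := hn
    change b * (n * r) = 0
    rw [← mul_assoc, this, zero_mul]
  · have h : b * n = 0 := hn
    change b * R.pr ρ n = 0
    by_cases hγ : γ.d = ρ.r
    · rw [← pr_mul hγ hb, h, map_zero]
    · exact mul_eq_zero_of_ne hγ hb (proj_mem _ _ _)

/-- Let `T` be the ideal generated by `1_e`. Among the graded right ideals `N ⊆ 1_g R` with `1_g ∈ N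
+ T`, take a minimal one. If `N ≠ 0`, primeness and simplicity at `e` give `b` and `z ∈ N ∩ R 1_e`
with `b z = 1_e`. Then `v ↦ v - z b v` changes elements of `N` only by elements of `T` and maps `N`
into the smaller right ideal `N ∩ ker b`. So `N = 0` and `1_g ∈ T`. -/
theorem IsGrPrime.gen (hR : R.IsGrPrime) {e : Γ} (he : R.RSimple e) (hA : R.RArt) :
    R.Gen {e} := by
  intro g
  obtain ⟨N, hN, hNg, ⟨n, hn, t, ht, hnt⟩, hmin⟩ := (hA g).exists_minimal
    (P := fun N => ∃ n ∈ N, ∃ t ∈ R.objIdeal {e}, n + t = R.one g)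
    ⟨_, isGrRightIdeal_rightPart g, le_rfl, R.one g, one_mem_rightPart g, 0, zero_mem _,
      add_zero _⟩
  by_cases hN0 : N = ⊥
  · rw [hN0, AddSubgroup.mem_bot] at hn
    rwa [← hnt, hn, zero_add]
  exfalso
  obtain ⟨α, a, haN, ha, ha0⟩ := exists_homogeneous_of_ne_bot R.isInternal hN.2 hN0
  obtain ⟨β, b, hb, hba⟩ := hR.exists_mul_mul_ne_zero (R.one_mem e) ha he.1 ha0
  have h1 : R.one e * b ≠ 0 := fun h => hba (by rw [h, zero_mul])
  have hβ := r_eq_of_one_mul hb h1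
  rw [one_mul_of_r hβ hb] at hba
  obtain ⟨hβα, hmem⟩ := mul_mem_of_ne_zero hb ha hba
  obtain ⟨c, hc⟩ := he.2 (β.mul α hβα) hβ _ hmem hba
  have hx : b * (a * c * R.one e) = R.one e := by
    rw [← mul_assoc, ← mul_assoc, hc, one_mul_one]
  have hxN : a * c * R.one e ∈ N := hN.1 _ (hN.1 _ haN c) _
  have hN' : R.IsGrRightIdeal (N ⊓ (AddMonoidHom.mulLeft b).ker) :=
    hN.inf (isGrRightIdeal_ker_mulLeft hb)
  -- Here `z = a c 1_e`. The factor `1_e` on its right is what puts the correction term `z b n` into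
  -- the ideal generated by `1_e`.
  have h1N : n - a * c * R.one e * (b * n) ∈ N ⊓ (AddMonoidHom.mulLeft b).ker := by
    have hy : a * c * R.one e * (b * n) ∈ N := hN.1 _ hxN _
    refine AddSubgroup.mem_inf.2 ⟨sub_mem hn hy, ?_⟩
    change b * (n - a * c * R.one e * (b * n)) = 0
    rw [mul_sub, ← mul_assoc b, hx, ← mul_assoc, one_mul_of_r hβ hb, sub_self]
  have h1T : t + a * c * R.one e * (b * n) ∈ R.objIdeal {e} :=
    add_mem ht (mul_one_mul_mem_objIdeal (Set.mem_singleton e) _ _)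
  have hsum : n - a * c * R.one e * (b * n) + (t + a * c * R.one e * (b * n)) = R.one g := by
    rw [← hnt]; abel
  have hNN := hmin _ hN' inf_le_left ⟨_, h1N, _, h1T, hsum⟩
  have hxN' : a * c * R.one e ∈ N ⊓ (AddMonoidHom.mulLeft b).ker := by rw [hNN]; exact hxN
  have h : b * (a * c * R.one e) = 0 := (AddSubgroup.mem_inf.1 hxN').2
  exact he.1 (by rw [← hx, h])

end GrRing

end GroupoidGraded

end

noncomputable section

namespace GroupoidGraded

variable {Γ : Type v} [Groupoid.{w} Γ] {R : GrRing.{u} Γ}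

namespace GrMod

/-! ## Pseudo-free modules -/

theorem IsUnital.act_one {M : GrMod.{u, u'} R} (hM : M.IsUnital) {γ : Mor Γ} {x : M}
    (hx : x ∈ M.comp γ) : M.act x (R.one γ.d) = x := by
  -- Stated for all components of an arbitrary element, the claim is additive, so it can be checked
  -- on the generators `m a` supplied by `M R = M`.
  suffices ∀ m : M, ∀ γ, M.act (M.pr γ m) (R.one γ.d) = M.pr γ m by
    have h := this x γ
    rwa [pr, proj_same _ hx] at h
  intro m
  have hm : m ∈ AddSubgroup.closure {x | ∃ (m : M) (a : R), x = M.act m a} := by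
    rw [hM]; trivial
  induction hm using AddSubgroup.closure_induction with
  | mem x hx =>
    intro γ
    obtain ⟨m, a, rfl⟩ := hx
    induction m using homogeneous_induction M.isInternal with
    | hom σ m hm =>
      induction a using homogeneous_induction R.isInternal with
      | hom τ a ha =>
        by_cases h : σ.d = τ.r
        · rw [pr, proj_of_mem _ (M.act_mem_mul h hm ha)]
          split_ifs with h'
          · rw [M.act_mul, GrRing.mul_one_of_d (by rw [← h']) ha]
          · simp
        · rw [M.act_eq_zero h hm ha]; simp
      | zero => simp
      | add x y hx hy => simp only [map_add, hx, hy, AddMonoidHom.add_apply]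
    | zero => simp
    | add x y hx hy => simp only [map_add, hx, hy, AddMonoidHom.add_apply]
  | zero => simp
  | add x y _ _ hx hy => intro γ; simp only [map_add, hx, hy, AddMonoidHom.add_apply]
  | neg x _ hx => intro γ; simp only [map_neg, hx, AddMonoidHom.neg_apply]

theorem regular_isUnital : (regular R).IsUnital := by
  rw [IsUnital, eq_top_iff]
  rintro (x : R) -
  induction x using homogeneous_induction R.isInternal with
  | hom γ x hx => exact AddSubgroup.subset_closure ⟨x, R.one γ.d, (R.mul_one hx).symm⟩
  | zero => exact zero_mem _
  | add x y hx hy => exact add_mem hx hy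

/-- The submodule generated by a set. -/
def span (M : GrMod.{u, u'} R) (B : Set M) : AddSubgroup M :=
  AddSubgroup.closure {x | ∃ b ∈ B, ∃ a, x = M.act b a}

theorem act_mem_span (M : GrMod.{u, u'} R) {B : Set M} {b : M} (hb : b ∈ B) (a : R) :
    M.act b a ∈ M.span B := AddSubgroup.subset_closure ⟨b, hb, a, rfl⟩

theorem isGrSubmodule_span (M : GrMod.{u, u'} R) {B : Set M} (hB : ∀ b ∈ B, ∃ γ, b ∈ M.comp γ) :
    M.IsGrSubmodule (M.span B) := by
  refine ⟨fun n hn r => ?_, (graded_iff M.isInternal).2 fun n hn ρ => ?_⟩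
  · induction hn using AddSubgroup.closure_induction with
    | mem x hx =>
      obtain ⟨b, hb, a, rfl⟩ := hx
      rw [M.act_mul]; exact M.act_mem_span hb _
    | zero => simp [zero_mem]
    | add x y _ _ hx hy => rw [map_add]; exact add_mem hx hy
    | neg x _ hx => rw [map_neg]; exact neg_mem hx
  · induction hn using AddSubgroup.closure_induction with
    | mem x hx =>
      obtain ⟨b, hb, a, rfl⟩ := hx
      obtain ⟨γ, hγ⟩ := hB b hb
      induction a using homogeneous_induction R.isInternal with
      | hom τ a ha =>
        by_cases h : γ.d = τ.r
        · rw [proj_of_mem _ (M.act_mem_mul h hγ ha)]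
          split_ifs
          · exact M.act_mem_span hb _
          · exact zero_mem _
        · rw [M.act_eq_zero h hγ ha, map_zero]; exact zero_mem _
      | zero => simp [zero_mem]
      | add x y hx hy => rw [map_add, map_add]; exact add_mem hx hy
    | zero => simp [zero_mem]
    | add x y _ _ hx hy => rw [map_add]; exact add_mem hx hy
    | neg x _ hx => rw [map_neg]; exact neg_mem hx

/-- A set of elements `m` is pseudo-linearly independent, with respect to degrees `deg m`. -/
def PseudoIndep (M : GrMod.{u, u'} R) (deg : M → Mor Γ) (B : Set M) : Prop :=
  ∀ s : Finset M, ↑s ⊆ B → ∀ a : M → R, (∀ m ∈ s, R.one (deg m).d * a m = a m) →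
    ∑ m ∈ s, M.act m (a m) = 0 → ∀ m ∈ s, a m = 0

/-- The exchange step of linear algebra. A relation with nonzero coefficient `a` at `y` gives `y a ∈
span B`. As the span is graded, this holds for a nonzero component of `a`, which is right invertible
by simplicity, so `y` itself would lie in the span. -/
theorem PseudoIndep.insert {M : GrMod.{u, u'} R} {deg : M → Mor Γ} {B : Set M}
    (hB : M.PseudoIndep deg B) (hdeg : ∀ b ∈ B, b ∈ M.comp (deg b) ∧ M.act b (R.one (deg b).d) = b)
    {y : M} (hy : y ∈ M.comp (deg y)) (hy1 : M.act y (R.one (deg y).d) = y)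
    (hy' : R.RSimple (deg y).d) (hyB : y ∉ M.span B) :
    M.PseudoIndep deg (insert y B) := by
  classical
  have hN := M.isGrSubmodule_span fun b hb => ⟨_, (hdeg b hb).1⟩
  intro s hs a ha h0
  by_cases hys : y ∈ s
  · have hs' : ↑(s.erase y) ⊆ B := fun m hm => by
      rw [Finset.mem_coe, Finset.mem_erase] at hm
      exact (hs hm.2).resolve_left hm.1
    rw [← Finset.add_sum_erase s _ hys] at h0
    have h1 : M.act y (a y) ∈ M.span B := by
      rw [eq_neg_of_add_eq_zero_left h0]
      exact neg_mem (sum_mem fun m hm => M.act_mem_span (hs' hm) _)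
    have hay : a y = 0 := by
      by_contra hne
      obtain ⟨τ, hτ⟩ := exists_proj_ne_zero R.isInternal hne
      have hr : τ.r = (deg y).d := by
        by_contra h'
        exact hτ (GrRing.pr_eq_zero_of_r_ne (ha y hys) h')
      have h2 := (graded_iff M.isInternal).1 hN.2 _ h1 ((deg y).mul τ hr.symm)
      rw [show proj M.isInternal = M.pr from rfl, M.pr_act hr.symm hy] at h2
      obtain ⟨b, hb⟩ := hy'.2 τ hr _ (proj_mem _ _ _) hτ
      have h3 := hN.1 _ h2 b
      rw [M.act_mul, hb, hy1] at h3
      exact hyB h3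
    rw [hay, map_zero, zero_add] at h0
    intro m hm
    by_cases hmy : m = y
    · rw [hmy, hay]
    · exact hB _ hs' a (fun m hm => ha m (Finset.mem_of_mem_erase hm)) h0 m
        (Finset.mem_erase.2 ⟨hmy, hm⟩)
  · refine hB s (fun m hm => (hs hm).resolve_left ?_) a ha h0
    rintro rfl
    exact hys hm

/-- A maximal pseudo-independent subset of the set `H` of nonzero homogeneous elements with domain
in `Δ` spans `H`, by `PseudoIndep.insert`. Moreover `H` spans `M`, because every homogeneous `m`
equals `m 1_e` and `1_e` is a sum of products `x 1_f y` with `f ∈ Δ`. The information on domains and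
nonvanishing is kept for the construction of dual bases. -/
theorem exists_isPseudoBasis {Δ : Set Γ} (hΔ : R.SimplyGen Δ) (M : GrMod.{u, u'} R)
    (hM : M.IsUnital) : ∃ (I : Type u') (γ : I → Mor Γ) (x : I → M), M.IsPseudoBasis γ x ∧
      ∀ i, (γ i).d ∈ Δ ∧ x i ≠ 0 := by
  classical
  -- A total degree function on `M` needs a junk value outside `H`; without any morphism `M` is zero
  -- and the empty basis works.
  have hN : Nonempty (Mor Γ) ∨ IsEmpty (Mor Γ) := (isEmpty_or_nonempty _).symm
  rcases hN with hN | hN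
  swap
  · refine ⟨PEmpty, PEmpty.elim, PEmpty.elim, ⟨fun i => i.elim, fun N _ _ => ?_, fun a _ _ => ?_⟩,
      fun i => i.elim⟩
    · rw [eq_top_iff, ← M.iSup_comp]
      exact iSup_le fun γ => hN.elim γ
    · exact Subsingleton.elim _ _
  let H : Set M := {m | m ≠ 0 ∧ ∃ γ : Mor Γ, γ.d ∈ Δ ∧ m ∈ M.comp γ}
  have hdeg : ∀ m : M, ∃ γ : Mor Γ, m ∈ H → γ.d ∈ Δ ∧ m ∈ M.comp γ := fun m => by
    by_cases h : m ∈ H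
    · obtain ⟨γ, hγ⟩ := h.2; exact ⟨γ, fun _ => hγ⟩
    · exact ⟨hN.some, fun h' => absurd h' h⟩
  choose deg hdeg using hdeg
  obtain ⟨B, hB⟩ := zorn_subset {B | B ⊆ H ∧ M.PseudoIndep deg B} (by
    intro c hc hchain
    rcases c.eq_empty_or_nonempty with rfl | hne
    · refine ⟨∅, ⟨by simp, fun s hs a _ _ m hm => absurd (hs hm) (by simp)⟩, by simp⟩
    refine ⟨⋃₀ c, ⟨Set.sUnion_subset fun B hB => (hc hB).1, fun s hs => ?_⟩,
      fun B hB => Set.subset_sUnion_of_mem hB⟩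
    obtain ⟨B, hB, hsB⟩ := DirectedOn.exists_mem_subset_of_finset_subset_biUnion
      (f := fun B : Set M => B) hne hchain.directedOn (by rwa [Set.sUnion_eq_biUnion] at hs)
    exact (hc hB).2 s hsB)
  have hBH := hB.1.1
  have hBm : ∀ b ∈ B, b ∈ M.comp (deg b) ∧ M.act b (R.one (deg b).d) = b := fun b hb =>
    ⟨(hdeg b (hBH hb)).2, hM.act_one (hdeg b (hBH hb)).2⟩
  have hHspan : ∀ y ∈ H, y ∈ M.span B := by
    intro y hy
    by_contra hyB
    have h := hdeg y hy
    have h2 := hB.2 ⟨Set.insert_subset hy hBH,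
      hB.1.2.insert hBm h.2 (hM.act_one h.2) (hΔ.1 _ h.1) hyB⟩ (Set.subset_insert y B)
    have hyB' : y ∈ B := h2 (Set.mem_insert _ _)
    exact hyB (by rw [← (hBm y hyB').2]; exact M.act_mem_span hyB' _)
  have hsub := (M.isGrSubmodule_span fun b hb => ⟨_, (hBm b hb).1⟩).1
  have hspan : M.span B = ⊤ := by
    rw [eq_top_iff]
    have key : ∀ m : M, ∀ r ∈ R.objIdeal Δ, M.act m r ∈ M.span B := by
      intro m r hr
      induction hr using AddSubgroup.closure_induction with
      | mem x hx =>
        obtain ⟨_, ⟨f, hf, rfl⟩, x, y, rfl⟩ := hx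
        rw [← M.act_mul, ← M.act_mul]
        refine hsub _ ?_ y
        induction m using homogeneous_induction M.isInternal with
        | hom σ m hm =>
          induction x using homogeneous_induction R.isInternal with
          | hom τ a ha =>
            by_cases h0 : M.act (M.act m a) (R.one f) = 0
            · rw [h0]; exact zero_mem _
            have h1 : σ.d = τ.r := by
              by_contra h; rw [M.act_eq_zero h hm ha] at h0; simp at h0
            have h2 : τ.d = f := by
              by_contra h; rw [M.act_mul, GrRing.mul_one_of_d_ne h ha, map_zero] at h0; simp at h0
            rw [M.act_mul, GrRing.mul_one_of_d h2 ha] at h0 ⊢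
            exact hHspan _ ⟨h0, _, by rw [h2]; exact hf, M.act_mem_mul h1 hm ha⟩
          | zero => simp [zero_mem]
          | add x y hx hy => simp only [map_add, AddMonoidHom.add_apply]; exact add_mem hx hy
        | zero => simp [zero_mem]
        | add x y hx hy => simp only [map_add, AddMonoidHom.add_apply]; exact add_mem hx hy
      | zero => simp [zero_mem]
      | add x y _ _ hx hy => rw [map_add]; exact add_mem hx hy
      | neg x _ hx => rw [map_neg]; exact neg_mem hx
    rintro m -
    induction m using homogeneous_induction M.isInternal with
    | hom σ m hm => rw [← hM.act_one hm]; exact key _ _ (hΔ.2 _)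
    | zero => exact zero_mem _
    | add x y hx hy => exact add_mem hx hy
  refine ⟨B, fun b => deg b, Subtype.val, ⟨fun b => (hBm b b.2).1, fun N hN hBN => ?_,
    fun a ha h0 => ?_⟩, fun b => ⟨(hdeg b (hBH b.2)).1, (hBH b.2).1⟩⟩
  · rw [eq_top_iff, ← hspan]
    refine (AddSubgroup.closure_le _).2 ?_
    rintro _ ⟨b, hb, a, rfl⟩
    exact hN _ (hBN ⟨b, hb⟩) a
  · ext b
    by_cases hb : b ∈ a.support
    swap
    · simpa using hb
    -- Coefficients indexed by the subtype `B` are extended by zero, since `PseudoIndep` speaks of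
    -- functions on `M`.
    let a' : M → R := fun m => if h : m ∈ B then a ⟨m, h⟩ else 0
    have ha' : ∀ b : B, a' b = a b := fun b => by simp [a', b.2]
    have := hB.1.2 (a.support.map (Function.Embedding.subtype _)) (fun m hm => by
      obtain ⟨b, -, rfl⟩ := Finset.mem_map.1 (Finset.mem_coe.1 hm); exact b.2) a'
      (fun m hm => by
        obtain ⟨b, -, rfl⟩ := Finset.mem_map.1 hm
        obtain ⟨c, hc⟩ := ha b
        rw [Function.Embedding.subtype_apply, ha', hc, GrRing.one_mul_one_mul])
      (by
        rw [Finset.sum_map, ← h0, Finsupp.sum]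
        exact Finset.sum_congr rfl fun b _ => by rw [Function.Embedding.subtype_apply, ha'])
      b (Finset.mem_map_of_mem _ hb)
    rwa [ha'] at this

/-! ### Quotients of the regular module -/

/-- The module `R / N`. -/
def quotient (N : AddSubgroup R) (hN : R.IsGrRightIdeal N) : GrMod.{u, u} R where
  carrier := R ⧸ N
  act := QuotientAddGroup.lift N
    ((AddMonoidHom.compHom (QuotientAddGroup.mk' N)).comp AddMonoidHom.mul) fun n hn =>
      AddMonoidHom.ext fun a => (QuotientAddGroup.eq_zero_iff _).2 (hN.1 n hn a)
  act_mul m a b := by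
    obtain ⟨m, rfl⟩ := QuotientAddGroup.mk_surjective m
    exact congrArg (QuotientAddGroup.mk (s := N)) (mul_assoc m a b)
  comp γ := (R.comp γ).map (QuotientAddGroup.mk' N)
  isInternal := by
    rw [isInternal_iff]
    refine ⟨fun s x hx h0 i hi => ?_, ?_⟩
    · choose! y hy hyx using hx
      have h1 : ∑ i ∈ s, y i ∈ N := by
        rw [← QuotientAddGroup.eq_zero_iff, ← QuotientAddGroup.mk'_apply, map_sum, ← h0]
        exact Finset.sum_congr rfl hyx
      have h2 := (graded_iff R.isInternal).1 hN.2 _ h1 i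
      rw [map_sum, Finset.sum_eq_single i (fun j hj hne => proj_ne _ (hy j hj) hne)
        (fun h => absurd hi h), proj_same _ (hy i hi)] at h2
      rw [← hyx i hi]
      exact (QuotientAddGroup.eq_zero_iff _).2 h2
    · rw [← AddSubgroup.map_iSup, R.iSup_comp, ← AddMonoidHom.range_eq_map,
        AddMonoidHom.range_eq_top]
      exact QuotientAddGroup.mk_surjective
  act_mem {σ τ m a} hm ha := by
    obtain ⟨m, hm, rfl⟩ := hm
    by_cases h : σ.d = τ.r
    · rw [mem_compAt h]
      exact ⟨m * a, GrRing.mul_mem_mul h hm ha, rfl⟩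
    · rw [compAt_of_ne h, AddSubgroup.mem_bot]
      exact congrArg (QuotientAddGroup.mk (s := N)) (GrRing.mul_eq_zero_of_ne h hm ha)

/-- The projection `R → R / N`. -/
def toQuotient (N : AddSubgroup R) (hN : R.IsGrRightIdeal N) : R →+ quotient N hN :=
  QuotientAddGroup.mk' N

variable {N : AddSubgroup R} {hN : R.IsGrRightIdeal N}

theorem toQuotient_act (x a : R) :
    (quotient N hN).act (toQuotient N hN x) a = toQuotient N hN (x * a) := rfl

theorem toQuotient_eq_zero {x : R} : toQuotient N hN x = 0 ↔ x ∈ N :=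
  QuotientAddGroup.eq_zero_iff _

theorem toQuotient_surjective : Function.Surjective (toQuotient N hN) :=
  QuotientAddGroup.mk_surjective

theorem exists_of_mem_quotient_comp {γ : Mor Γ} {x : quotient N hN}
    (hx : x ∈ (quotient N hN).comp γ) : ∃ c ∈ R.comp γ, toQuotient N hN c = x := hx

theorem quotient_isUnital : (quotient N hN).IsUnital := by
  rw [IsUnital, eq_top_iff]
  rintro x -
  obtain ⟨x, rfl⟩ := toQuotient_surjective x
  induction x using homogeneous_induction R.isInternal with
  | hom γ x hx =>
    refine AddSubgroup.subset_closure ⟨toQuotient N hN x, R.one γ.d, ?_⟩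
    rw [toQuotient_act, R.mul_one hx]
  | zero => rw [map_zero]; exact zero_mem _
  | add x y hx hy => rw [map_add]; exact add_mem hx hy

theorem IsPseudoBasis.eq_zero {M : GrMod.{u, u'} R} {I : Type*} {γ : I → Mor Γ} {x : I → M}
    (h : M.IsPseudoBasis γ x) {i : I} {a : R} (ha : R.one (γ i).d * a = a)
    (h0 : M.act (x i) a = 0) : a = 0 := by
  classical
  have := h.2.2 (Finsupp.single i a) (fun j => ?_) (by
    rw [Finsupp.sum_single_index]; exacts [h0, map_zero _])
  · simpa using this
  · by_cases hj : j = i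
    · subst hj; exact ⟨a, by simp [ha]⟩
    · exact ⟨0, by simp [Ne.symm hj]⟩

end GrMod

/-! ### Pfm rings and ideals generated by simple objects -/

namespace GrRing

theorem SimplyGen.isPfm {Δ : Set Γ} (h : R.SimplyGen Δ) : R.IsPfm := fun M hM => by
  obtain ⟨I, γ, x, hx, -⟩ := M.exists_isPseudoBasis h hM
  exact ⟨I, γ, x, hx⟩

/-- Pseudo-freeness is applied to a single module, `R / N`, where `N` is maximal among the graded
right ideals that contain the ideal of all simple objects but miss `1_e`. A basis element of it
turns out to have a simple object as domain, which forces it to vanish. -/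
theorem IsPfm.simplyGen (h : R.IsPfm) : R.SimplyGen {f | R.RSimple f} := by
  refine ⟨fun f hf => hf, fun e => ?_⟩
  by_contra he
  set T := R.objIdeal {f | R.RSimple f} with hT
  obtain ⟨N, hTN, hN⟩ := zorn_le_nonempty₀ {N | R.IsGrRightIdeal N ∧ R.one e ∉ N} (by
    intro c hc hchain y hy
    have hdir := hchain.directedOn
    refine ⟨sSup c, ⟨⟨fun n hn a => ?_, (graded_iff R.isInternal).2 fun n hn γ => ?_⟩, ?_⟩,
      fun z hz => le_sSup hz⟩
    · obtain ⟨K, hK, hnK⟩ := (AddSubgroup.mem_sSup_of_directedOn ⟨y, hy⟩ hdir).1 hn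
      exact (le_sSup hK) ((hc hK).1.1 n hnK a)
    · obtain ⟨K, hK, hnK⟩ := (AddSubgroup.mem_sSup_of_directedOn ⟨y, hy⟩ hdir).1 hn
      exact (le_sSup hK) ((graded_iff R.isInternal).1 (hc hK).1.2 n hnK γ)
    · rw [AddSubgroup.mem_sSup_of_directedOn ⟨y, hy⟩ hdir]
      rintro ⟨K, hK, h'⟩
      exact (hc hK).2 h') T
    ⟨⟨fun n hn a => ((isGrIdeal_objIdeal _).1 a n hn).2, (isGrIdeal_objIdeal _).2⟩, he⟩
  have hNi := hN.1.1
  have heN := hN.1.2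
  obtain ⟨I, γ, x, hx⟩ := h (GrMod.quotient N hNi) GrMod.quotient_isUnital
  -- If no basis element lived over `e`, all lifts would satisfy `1_e c ∈ N`; that condition defines
  -- a submodule of `R / N`, which would contain the class of `1_e`.
  obtain ⟨i, hi, hxi⟩ : ∃ i, (γ i).r = e ∧ x i ≠ 0 := by
    by_contra! H
    have hL := hx.2.1 ((N.comap (AddMonoidHom.mulLeft (R.one e))).map (GrMod.toQuotient N hNi))
      (by
        rintro _ ⟨n, hn, rfl⟩ a
        refine ⟨n * a, ?_, rfl⟩
        change R.one e * (n * a) ∈ N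
        rw [← mul_assoc]
        exact hNi.1 _ hn a)
      (fun i => by
        obtain ⟨c, hc, hcx⟩ := GrMod.exists_of_mem_quotient_comp (hx.1 i)
        refine ⟨c, ?_, hcx⟩
        change R.one e * c ∈ N
        by_cases hr : (γ i).r = e
        · rw [one_mul_of_r hr hc, ← GrMod.toQuotient_eq_zero (hN := hNi), hcx, H i hr]
        · rw [one_mul_of_r_ne hr hc]; exact zero_mem _)
    have h1 : GrMod.toQuotient N hNi (R.one e) ∈ (⊤ : AddSubgroup (GrMod.quotient N hNi)) := trivial
    rw [← hL] at h1
    obtain ⟨n, hn, hne⟩ := h1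
    have h2 : n - R.one e ∈ N := by
      rw [← GrMod.toQuotient_eq_zero (hN := hNi), map_sub, hne, sub_self]
    have h3 : R.one e * n ∈ N := hn
    have h4 : R.one e ∈ N := by
      -- Although `N` is only a right ideal, it is stable under `1_e` from the left: this
      -- multiplication keeps the components of range `e` and kills the others.
      have h5 : R.one e * (n - R.one e) ∈ N := by
        refine mem_of_proj_mem R.isInternal _ fun ρ => ?_
        by_cases hρ : ρ.r = e
        · have h6 := pr_mul (σ := Mor.id e) (τ := ρ) hρ.symm (R.one_mem e) (n - R.one e)
          rw [Mor.id_mul] at h6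
          rw [show proj R.isInternal ρ = R.pr ρ from rfl, h6,
            one_mul_of_r hρ (proj_mem _ _ _)]
          exact (graded_iff R.isInternal).1 hNi.2 _ h2 ρ
        · rw [show proj R.isInternal ρ = R.pr ρ from rfl,
            pr_eq_zero_of_r_ne (one_mul_one_mul e _) hρ]
          exact zero_mem _
      rw [mul_sub, one_mul_one] at h5
      simpa using sub_mem h3 h5
    exact heN h4
  obtain ⟨c, hc, hcx⟩ := GrMod.exists_of_mem_quotient_comp (hx.1 i)
  have hcN : c ∉ N := fun h' => hxi (by rw [← hcx, GrMod.toQuotient_eq_zero]; exact h')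
  have key : ∀ a, R.one (γ i).d * a = a → c * a ∈ N → a = 0 := fun a ha h' =>
    hx.eq_zero ha (by rw [← hcx, GrMod.toQuotient_act, GrMod.toQuotient_eq_zero]; exact h')
  have hf : R.RSimple (γ i).d := by
    refine ⟨(one_ne_zero_of_mem hc fun h' => hcN (by rw [h']; exact zero_mem _)).2,
      fun δ hδ a ha h0 => ?_⟩
    have h1 : c * a ∉ N := fun h' => h0 (key a (one_mul_of_r hδ ha) h')
    -- The right ideal `N + c a R` is strictly larger than `N`, so maximality of `N` puts `1_e` into
    -- it.
    have h2 : R.one e ∈ N ⊔ R.mulRange (c * a) := by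
      by_contra h3
      have h4 := hN.2 (y := N ⊔ R.mulRange (c * a))
        ⟨hNi.sup (isGrRightIdeal_mulRange (mul_mem_mul hδ.symm hc ha)), h3⟩ le_sup_left
      refine h1 (h4 (AddSubgroup.mem_sup_right (mem_mulRange.2 ⟨R.one δ.d, ?_⟩)))
      rw [mul_assoc, R.mul_one ha]
    obtain ⟨n, hn, y, hy, hny⟩ := AddSubgroup.mem_sup.1 h2
    obtain ⟨s, rfl⟩ := mem_mulRange.1 hy
    refine ⟨s * c, ?_⟩
    -- With `1_e = n + c a s`, multiplication by `c` on the right gives `c (1 - a s c) = n c ∈ N`,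
    -- where `1` is the identity at the domain of `c`. Independence then forces `a s c = 1`, a right
    -- inverse of `a`.
    have h5 := key (R.one (γ i).d - a * (s * c)) (by
      rw [mul_sub, one_mul_one, ← mul_assoc, one_mul_of_r hδ ha]) (by
      rw [mul_sub, R.mul_one hc]
      have h6 : c - c * (a * (s * c)) = n * c := by
        nth_rewrite 1 [← one_mul_of_r hi hc]
        rw [← hny]
        simp only [add_mul, mul_assoc, add_sub_cancel_right]
      rw [h6]
      exact hNi.1 n hn c)
    exact (sub_eq_zero.1 h5).symm
  refine hcN (hTN ?_)
  have := mul_one_mul_mem_objIdeal (R := R) (Δ := {f | R.RSimple f}) hf c (R.one (γ i).d)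
  rwa [R.mul_one hc, R.mul_one hc] at this

theorem isPfm_iff : R.IsPfm ↔ ∃ Δ, R.SimplyGen Δ := ⟨fun h => ⟨_, h.simplyGen⟩, fun ⟨_, h⟩ => h.isPfm⟩

end GrRing

end GroupoidGraded

end

noncomputable section

namespace GroupoidGraded

variable {Γ : Type v} [Groupoid.{w} Γ] {R : GrRing.{u} Γ}

namespace GrMod

/-! ## Modules isomorphic to `1_f R` -/

/-- The map `ψ` identifies the graded module `M` with the right ideal `1_f R`. -/
structure IsModel (M : GrMod.{u, u'} R) (f : Γ) (ψ : M →+ R) : Prop where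
  inj : Function.Injective ψ
  act : ∀ m a, ψ (M.act m a) = ψ m * a
  deg : ∀ γ, ∀ m ∈ M.comp γ, ψ m ∈ R.comp γ
  surj : ∀ γ : Mor Γ, γ.r = f → ∀ a ∈ R.comp γ, ∃ m ∈ M.comp γ, ψ m = a
  eq_zero : ∀ γ : Mor Γ, γ.r ≠ f → ∀ m ∈ M.comp γ, m = 0

namespace IsModel

variable {M : GrMod.{u, u'} R} {f : Γ} {ψ : M →+ R}

theorem one_mul (h : M.IsModel f ψ) (m : M) : R.one f * ψ m = ψ m := by
  induction m using homogeneous_induction M.isInternal with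
  | hom γ m hm =>
    by_cases hγ : γ.r = f
    · exact GrRing.one_mul_of_r hγ (h.deg γ m hm)
    · rw [h.eq_zero γ hγ m hm]; simp
  | zero => simp
  | add x y hx hy => rw [map_add, mul_add, hx, hy]

theorem exists_one (h : M.IsModel f ψ) : ∃ m, ψ m = R.one f := by
  obtain ⟨m, -, hm⟩ := h.surj (Mor.id f) rfl _ (R.one_mem f)
  exact ⟨m, hm⟩

theorem exists_of_one_mul (h : M.IsModel f ψ) {a : R} (ha : R.one f * a = a) : ∃ m, ψ m = a := by
  obtain ⟨m, hm⟩ := h.exists_one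
  exact ⟨M.act m a, by rw [h.act, hm, ha]⟩

theorem nontrivial_iff (h : M.IsModel f ψ) : Nontrivial M ↔ R.one f ≠ 0 := by
  refine ⟨fun _ h0 => ?_, fun h0 => ?_⟩
  · obtain ⟨m, hm⟩ := exists_ne (0 : M)
    apply hm
    apply h.inj
    rw [← h.one_mul, h0, zero_mul, map_zero]
  · obtain ⟨m, hm⟩ := h.exists_one
    exact ⟨m, 0, fun h' => h0 (by rw [← hm, h', map_zero])⟩

theorem pr (h : M.IsModel f ψ) (γ : Mor Γ) (m : M) : ψ (M.pr γ m) = R.pr γ (ψ m) := by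
  induction m using homogeneous_induction M.isInternal with
  | hom ρ m hm =>
    rw [GrMod.pr, GrRing.pr, proj_of_mem _ hm, proj_of_mem _ (h.deg ρ m hm)]
    split_ifs <;> simp
  | zero => simp
  | add x y hx hy => simp only [map_add, hx, hy]

theorem isGrRightIdeal_map (h : M.IsModel f ψ) {N : AddSubgroup M} (hN : M.IsGrSubmodule N) :
    R.IsGrRightIdeal (N.map ψ) := by
  refine ⟨?_, (graded_iff R.isInternal).2 ?_⟩
  · rintro _ ⟨n, hn, rfl⟩ a
    exact ⟨M.act n a, hN.1 n hn a, h.act n a⟩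
  · rintro _ ⟨n, hn, rfl⟩ γ
    exact ⟨_, (graded_iff M.isInternal).1 hN.2 n hn γ, h.pr γ n⟩

theorem isGrSubmodule_comap (h : M.IsModel f ψ) {C : AddSubgroup R} (hC : R.IsGrRightIdeal C) :
    M.IsGrSubmodule (C.comap ψ) := by
  refine ⟨fun n hn a => ?_, (graded_iff M.isInternal).2 fun n hn γ => ?_⟩
  · rw [AddSubgroup.mem_comap, h.act]; exact hC.1 _ hn a
  · have := (graded_iff R.isInternal).1 hC.2 _ hn γ
    rw [AddSubgroup.mem_comap, show proj M.isInternal = M.pr from rfl, h.pr]; exact this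

/-- For a nonzero homogeneous `a ∈ 1_f R`, simplicity forces `a R` to contain `1_f`. Conversely,
right invertibility of one homogeneous element of a submodule recovers `1_f` and with it the whole
module. -/
theorem isGrSimple_iff (h : M.IsModel f ψ) : M.IsGrSimple ↔ R.RSimple f := by
  refine ⟨fun hM => ⟨h.nontrivial_iff.1 hM.1, fun γ hγ a ha h0 => ?_⟩,
    fun hf => ⟨h.nontrivial_iff.2 hf.1, fun N hN => ?_⟩⟩
  · have h1 := (hM.2 _ (h.isGrSubmodule_comap (GrRing.isGrRightIdeal_mulRange ha))).resolve_left
      fun h' => h0 (by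
        obtain ⟨m, -, rfl⟩ := h.surj γ hγ a ha
        have : m ∈ (R.mulRange (ψ m)).comap ψ := GrRing.mem_mulRange.2 ⟨_, R.mul_one ha⟩
        rw [h', AddSubgroup.mem_bot] at this
        rw [this, map_zero])
    obtain ⟨m, hm⟩ := h.exists_one
    have h2 : m ∈ (R.mulRange a).comap ψ := by rw [h1]; trivial
    rw [AddSubgroup.mem_comap, hm, GrRing.mem_mulRange] at h2
    exact h2
  · by_cases hN0 : N = ⊥
    · exact .inl hN0
    right
    obtain ⟨γ, x, hxN, hx, hx0⟩ := exists_homogeneous_of_ne_bot M.isInternal hN.2 hN0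
    have hγ : γ.r = f := by
      by_contra h'; exact hx0 (h.eq_zero γ h' x hx)
    obtain ⟨b, hb⟩ := hf.2 γ hγ _ (h.deg γ x hx) fun h' => hx0 (h.inj (by rw [h', map_zero]))
    rw [eq_top_iff]
    rintro m -
    have : m = M.act (M.act x b) (ψ m) := h.inj (by rw [h.act, h.act, hb, h.one_mul])
    rw [this]
    exact hN.1 _ (hN.1 _ hxN b) _

theorem isGrArtinian_iff (h : M.IsModel f ψ) : M.IsGrArtinian ↔ R.HasDCC (R.rightPart f) := by
  refine ⟨fun hM C hC hanti => ?_, fun hR N hN hanti => ?_⟩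
  · obtain ⟨n, hn⟩ := hM (fun n => (C n).comap ψ) (fun n => h.isGrSubmodule_comap (hC n).1)
      fun i j hij => AddSubgroup.comap_mono (hanti hij)
    have key : ∀ n, C n = ((C n).comap ψ).map ψ := fun n => by
      rw [AddSubgroup.map_comap_eq, eq_comm, inf_eq_right]
      exact fun x hx => h.exists_of_one_mul ((hC n).2 hx)
    refine ⟨n, fun m hm => ?_⟩
    rw [key m, key n]
    exact congrArg (AddSubgroup.map ψ) (hn m hm)
  · obtain ⟨n, hn⟩ := hR (fun n => (N n).map ψ) (fun n => ⟨h.isGrRightIdeal_map (hN n), by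
      rintro _ ⟨m, -, rfl⟩; exact h.one_mul m⟩) fun i j hij => AddSubgroup.map_mono (hanti hij)
    exact ⟨n, fun m hm => AddSubgroup.map_injective h.inj (hn m hm)⟩

end IsModel

/-! ### Shifts -/

/-- The inclusion `M(σ) → M`. -/
def shiftIncl (M : GrMod.{u, u'} R) (σ : Mor Γ) : M.shift σ →+ M :=
  (⨆ γ, compAt M.comp σ γ : AddSubgroup M).subtype

theorem shiftIncl_injective (M : GrMod.{u, u'} R) (σ : Mor Γ) :
    Function.Injective (M.shiftIncl σ) := Subtype.val_injective

theorem shiftIncl_act (M : GrMod.{u, u'} R) (σ : Mor Γ) (m : M.shift σ) (a : R) :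
    M.shiftIncl σ ((M.shift σ).act m a) = M.act (M.shiftIncl σ m) a := rfl

theorem mem_shift_comp {M : GrMod.{u, u'} R} {σ γ : Mor Γ} {m : M.shift σ} :
    m ∈ (M.shift σ).comp γ ↔ M.shiftIncl σ m ∈ compAt M.comp σ γ := Iff.rfl

theorem exists_shiftIncl_eq {M : GrMod.{u, u'} R} {σ γ : Mor Γ} {x : M}
    (hx : x ∈ compAt M.comp σ γ) : ∃ m ∈ (M.shift σ).comp γ, M.shiftIncl σ m = x :=
  ⟨⟨x, AddSubgroup.mem_iSup_of_mem γ hx⟩, hx, rfl⟩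

theorem mem_part_comp {M : GrMod.{u, u'} R} {e : Γ} {γ : Mor Γ} {m : M.part e} (h : γ.r = e) :
    m ∈ (M.part e).comp γ ↔ M.shiftIncl (Mor.id e) m ∈ M.comp γ := by
  rw [mem_shift_comp, mem_compAt h.symm, Mor.id_mul]

theorem eq_zero_of_mem_shift_comp {M : GrMod.{u, u'} R} {σ γ : Mor Γ} {m : M.shift σ}
    (h : γ.r ≠ σ.d) (hm : m ∈ (M.shift σ).comp γ) : m = 0 := by
  rw [mem_shift_comp, compAt_of_ne (Ne.symm h), AddSubgroup.mem_bot] at hm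
  exact M.shiftIncl_injective σ (by rw [hm, map_zero])

theorem isModel_part (f : Γ) :
    ((regular R).part f).IsModel f ((regular R).shiftIncl (Mor.id f)) where
  inj := shiftIncl_injective _ _
  act m a := shiftIncl_act _ _ m a
  deg γ m hm := by
    by_cases h : γ.r = f
    · exact (mem_part_comp h).1 hm
    · rw [eq_zero_of_mem_shift_comp h hm, map_zero]; exact zero_mem _
  surj γ hγ a ha := exists_shiftIncl_eq (M := regular R) (by
    rw [mem_compAt hγ.symm, Mor.id_mul]; exact ha)
  eq_zero γ hγ m hm := eq_zero_of_mem_shift_comp hγ hm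

theorem isGrSimple_part_iff {f : Γ} : ((regular R).part f).IsGrSimple ↔ R.RSimple f :=
  (isModel_part f).isGrSimple_iff

theorem nontrivial_part_iff {f : Γ} : Nontrivial ((regular R).part f) ↔ R.one f ≠ 0 :=
  (isModel_part f).nontrivial_iff

theorem _root_.GroupoidGraded.GrRing.isRightGammaArtinian_iff :
    R.IsRightGammaArtinian ↔ R.RArt :=
  forall_congr' fun f => (isModel_part f).isGrArtinian_iff

/-- The faithful gr-simple module is `1_f R`. If `a` has a nonzero component, generation by `1_f`
provides a homogeneous `b ∈ 1_f R` that does not annihilate it. -/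
theorem _root_.GroupoidGraded.GrRing.SimplyGen.isRightGrPrimitive {f : Γ}
    (h : R.SimplyGen {f}) : R.IsRightGrPrimitive := by
  have hM := isModel_part (R := R) f
  have hs := hM.isGrSimple_iff.2 (h.1 f rfl)
  refine ⟨(regular R).part f, ?_, hs.2, fun a ha => ?_⟩
  · obtain ⟨m, hm⟩ := hM.exists_one
    refine ⟨m, R.one f, fun h0 => (h.1 f rfl).1 ?_⟩
    rw [← GrRing.one_mul_one, ← hm]
    nth_rewrite 2 [hm]
    rw [← hM.act, h0, map_zero]
  · by_contra h0
    obtain ⟨γ, hγ⟩ := exists_proj_ne_zero R.isInternal h0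
    obtain ⟨g, hg, δ, hδ, b, hb, hba⟩ := h.2.exists_mul_ne_zero (proj_mem R.isInternal γ a) hγ
    rw [Set.mem_singleton_iff] at hg
    subst hg
    obtain ⟨hδγ, -⟩ := GrRing.mul_mem_of_ne_zero hb (proj_mem R.isInternal γ a) hba
    obtain ⟨m, hm⟩ := hM.exists_of_one_mul (GrRing.one_mul_of_r hδ hb)
    apply hba
    rw [← GrRing.pr_mul hδγ hb, ← hm, ← hM.act, ha m, map_zero, map_zero]

/-! ### Direct sums -/

section DirectSum

variable {I : Type*} (M : I → GrMod.{u, u'} R)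

/-- The coordinates of an element of a direct sum. -/
def coord (i : I) : directSum M →+ M i :=
  DFinsupp.evalAddMonoidHom (β := fun i => (M i).carrier) i

open Classical in
/-- The inclusion of a summand in a direct sum. -/
def incl (i : I) : M i →+ directSum M := DirectSum.of (fun i => (M i).carrier) i

open Classical in
/-- The homomorphism on a direct sum given by homomorphisms on the summands. -/
def lift {A : Type*} [AddCommGroup A] (φ : ∀ i, M i →+ A) : directSum M →+ A :=
  DirectSum.toAddMonoid (β := fun i => (M i).carrier) φ

variable {M}

theorem coord_ext {x y : directSum M} (h : ∀ i, coord M i x = coord M i y) : x = y :=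
  DFinsupp.ext h

theorem mem_directSum_comp {γ : Mor Γ} {x : directSum M} :
    x ∈ (directSum M).comp γ ↔ ∀ i, coord M i x ∈ (M i).comp γ := Iff.rfl

theorem coord_act (x : directSum M) (a : R) (i : I) :
    coord M i ((directSum M).act x a) = (M i).act (coord M i x) a := rfl

theorem coord_incl_same (i : I) (m : M i) : coord M i (incl M i m) = m := by
  classical
  exact DirectSum.of_eq_same (β := fun i => (M i).carrier) i m

theorem coord_incl_ne {i j : I} (h : i ≠ j) (m : M i) : coord M j (incl M i m) = 0 := by
  classical
  exact DirectSum.of_eq_of_ne (β := fun i => (M i).carrier) i j m h.symm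

theorem incl_act (i : I) (m : M i) (a : R) :
    incl M i ((M i).act m a) = (directSum M).act (incl M i m) a := by
  refine coord_ext fun j => ?_
  rw [coord_act]
  by_cases h : i = j
  · subst h; rw [coord_incl_same, coord_incl_same]
  · rw [coord_incl_ne h, coord_incl_ne h]; simp

theorem incl_mem {γ : Mor Γ} {i : I} {m : M i} (hm : m ∈ (M i).comp γ) :
    incl M i m ∈ (directSum M).comp γ := mem_directSum_comp.2 fun j => by
  by_cases h : i = j
  · subst h; rwa [coord_incl_same]
  · rw [coord_incl_ne h]; exact zero_mem _

theorem finite_coord (x : directSum M) : {i | coord M i x ≠ 0}.Finite := by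
  classical
  exact (DFinsupp.support (β := fun i => (M i).carrier) x).finite_toSet.subset fun i hi =>
    (DFinsupp.mem_support_iff (β := fun i => (M i).carrier)).2 hi

theorem eq_sum_incl (x : directSum M) :
    x = ∑ i ∈ (finite_coord x).toFinset, incl M i (coord M i x) := by
  classical
  refine coord_ext fun i => ?_
  rw [map_sum]
  by_cases h : coord M i x = 0
  · rw [h, eq_comm]
    refine Finset.sum_eq_zero fun j _ => ?_
    by_cases hji : j = i
    · subst hji; rw [coord_incl_same, h]
    · exact coord_incl_ne hji _
  · rw [Finset.sum_eq_single i (fun j _ hj => coord_incl_ne hj _)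
      (fun h' => absurd ((finite_coord x).mem_toFinset.2 h) h'), coord_incl_same]

theorem lift_incl {A : Type*} [AddCommGroup A] (φ : ∀ i, M i →+ A) (i : I) (m : M i) :
    lift M φ (incl M i m) = φ i m := by
  classical
  exact DirectSum.toAddMonoid_of (β := fun i => (M i).carrier) φ i m

theorem lift_eq_sum {A : Type*} [AddCommGroup A] (φ : ∀ i, M i →+ A) (x : directSum M) :
    lift M φ x = ∑ i ∈ (finite_coord x).toFinset, φ i (coord M i x) := by
  nth_rewrite 1 [eq_sum_incl x]
  rw [map_sum]
  exact Finset.sum_congr rfl fun i _ => lift_incl φ i _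

end DirectSum

/-! ### The module `R(Δ₀)` -/

/-- The coordinate maps of `R(Δ₀)`. -/
def ofObjectsEval (R : GrRing.{u} Γ) (Δ : Set Γ) (e : Δ) : ofObjects R Δ →+ R :=
  ((regular R).shiftIncl (Mor.id e.1)).comp (coord (fun e : Δ => (regular R).part e.1) e)

theorem ofObjectsEval_apply {Δ : Set Γ} (e : Δ) (x : ofObjects R Δ) : ofObjectsEval R Δ e x =
    (regular R).shiftIncl (Mor.id e.1) (coord (fun e : Δ => (regular R).part e.1) e x) := rfl

theorem ofObjectsEval_ext {Δ : Set Γ} {x y : ofObjects R Δ}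
    (h : ∀ e, ofObjectsEval R Δ e x = ofObjectsEval R Δ e y) : x = y :=
  coord_ext fun e => (regular R).shiftIncl_injective _ (h e)

theorem ofObjectsEval_act {Δ : Set Γ} (x : ofObjects R Δ) (a : R) (e : Δ) :
    ofObjectsEval R Δ e ((ofObjects R Δ).act x a) = ofObjectsEval R Δ e x * a := rfl

theorem ofObjectsEval_mem {Δ : Set Γ} {γ : Mor Γ} {x : ofObjects R Δ}
    (hx : x ∈ (ofObjects R Δ).comp γ) (e : Δ) : ofObjectsEval R Δ e x ∈ R.comp γ :=
  (isModel_part e.1).deg γ _ (mem_directSum_comp.1 hx e)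

theorem ofObjectsEval_eq_zero {Δ : Set Γ} {γ : Mor Γ} {x : ofObjects R Δ}
    (hx : x ∈ (ofObjects R Δ).comp γ) {e : Δ} (h : γ.r ≠ e.1) : ofObjectsEval R Δ e x = 0 := by
  rw [ofObjectsEval_apply, (isModel_part e.1).eq_zero γ h _ (mem_directSum_comp.1 hx e), map_zero]

theorem ofObjectsEval_part {Δ : Set Γ} {f : Γ} (m : (ofObjects R Δ).part f) {e : Δ}
    (h : f ≠ e.1) : ofObjectsEval R Δ e ((ofObjects R Δ).shiftIncl _ m) = 0 := by
  induction m using homogeneous_induction ((ofObjects R Δ).part f).isInternal with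
  | hom γ m hm =>
    by_cases hγ : γ.r = f
    · exact ofObjectsEval_eq_zero ((mem_part_comp hγ).1 hm) (hγ ▸ h)
    · rw [eq_zero_of_mem_shift_comp hγ hm]; simp
  | zero => simp
  | add x y hx hy => rw [map_add, map_add, hx, hy, add_zero]

/-- The coordinate at `e` contains only degrees of range `e`, so passing to the part at `f` leaves
just the coordinate `f`. -/
theorem isModel_ofObjects {Δ : Set Γ} (f : Δ) : ((ofObjects R Δ).part f.1).IsModel f.1
    ((ofObjectsEval R Δ f).comp ((ofObjects R Δ).shiftIncl _)) where
  inj m n h := by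
    apply shiftIncl_injective
    refine ofObjectsEval_ext fun e => ?_
    by_cases he : f = e
    · subst he; exact h
    · have he' : f.1 ≠ e.1 := fun h => he (Subtype.ext h)
      rw [ofObjectsEval_part m he', ofObjectsEval_part n he']
  act m a := by
    rw [AddMonoidHom.comp_apply, shiftIncl_act, ofObjectsEval_act]; rfl
  deg γ m hm := by
    by_cases h : γ.r = f.1
    · exact ofObjectsEval_mem ((mem_part_comp h).1 hm) f
    · rw [eq_zero_of_mem_shift_comp h hm, map_zero]; exact zero_mem _
  surj γ hγ a ha := by
    obtain ⟨m, hm, hma⟩ := (isModel_part f.1).surj γ hγ a ha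
    obtain ⟨y, hy, hyx⟩ := exists_shiftIncl_eq (M := ofObjects R Δ) (σ := Mor.id f.1) (γ := γ)
      (x := incl (fun e : Δ => (regular R).part e.1) f m)
      ((mem_compAt hγ.symm).2 (by rw [Mor.id_mul]; exact incl_mem hm))
    refine ⟨y, hy, ?_⟩
    rw [AddMonoidHom.comp_apply, hyx, ← hma]
    exact congrArg ((regular R).shiftIncl _) 
      (coord_incl_same (M := fun e : Δ => (regular R).part e.1) f m)
  eq_zero γ hγ m hm := eq_zero_of_mem_shift_comp hγ hm

theorem isGammaSimple_ofObjects_iff {Δ : Set Γ} (hΔ : Δ ⊆ (regular R).objSupport) :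
    (ofObjects R Δ).IsGammaSimple ↔ ∀ f ∈ Δ, R.RSimple f := by
  refine ⟨fun h f hf => ?_, fun h f hf => ?_⟩
  · exact (isModel_ofObjects ⟨f, hf⟩).isGrSimple_iff.1
      (h f ((isModel_ofObjects ⟨f, hf⟩).nontrivial_iff.2 (nontrivial_part_iff.1 (hΔ hf))))
  · by_cases hfΔ : f ∈ Δ
    · exact (isModel_ofObjects ⟨f, hfΔ⟩).isGrSimple_iff.2 (h f hfΔ)
    · exfalso
      have : Nontrivial ((ofObjects R Δ).part f) := hf
      obtain ⟨m, hm⟩ := exists_ne (0 : (ofObjects R Δ).part f)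
      apply hm
      apply shiftIncl_injective
      refine ofObjectsEval_ext fun e => ?_
      rw [ofObjectsEval_part m fun h => hfΔ (h ▸ e.2), map_zero, map_zero]

/-! ### Direct sums of shifts of modules `R(e)` -/

/-- A degree preserving map commutes with the projections to components, so the inverse of a
bijective one preserves degrees too. -/
theorem iso_of_bijective {M : GrMod.{u, u'} R} {N : GrMod.{u, u''} R} (φ : M →+ N)
    (hφ : Function.Bijective φ) (hact : ∀ m a, φ (M.act m a) = N.act (φ m) a)
    (hdeg : ∀ γ, ∀ m ∈ M.comp γ, φ m ∈ N.comp γ) : N.Iso M := by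
  let φ' := AddEquiv.ofBijective φ hφ
  refine ⟨φ'.symm, fun m a => ?_, fun γ n hn => ?_⟩
  · rw [AddEquiv.symm_apply_eq]
    change _ = φ _
    rw [hact]
    congr 1
    exact congrArg _ (φ'.apply_symm_apply m).symm
  · obtain ⟨m, rfl⟩ := φ'.surjective n
    rw [AddEquiv.symm_apply_apply]
    have : φ (M.pr γ m) = φ m := by
      have key : φ (M.pr γ m) = N.pr γ (φ m) := by
        clear hn
        induction m using homogeneous_induction M.isInternal with
        | hom ρ m hm =>
          rw [GrMod.pr, GrMod.pr, proj_of_mem _ hm, proj_of_mem _ (hdeg ρ m hm)]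
          split_ifs <;> simp
        | zero => simp
        | add x y hx hy => simp only [map_add, hx, hy]
      rw [key]
      exact proj_same _ hn
    rw [← hφ.1 this]
    exact proj_mem _ _ _

/-- The inclusion `R(e)(σ) → R`. -/
def partShiftIncl (R : GrRing.{u} Γ) (e : Γ) (σ : Mor Γ) : ((regular R).part e).shift σ →+ R :=
  ((regular R).shiftIncl (Mor.id e)).comp (((regular R).part e).shiftIncl σ)

theorem partShiftIncl_injective (e : Γ) (σ : Mor Γ) :
    Function.Injective (partShiftIncl R e σ) :=
  (shiftIncl_injective _ _).comp (shiftIncl_injective _ _)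

theorem partShiftIncl_act {e : Γ} {σ : Mor Γ} (m : ((regular R).part e).shift σ) (a : R) :
    partShiftIncl R e σ ((((regular R).part e).shift σ).act m a) = partShiftIncl R e σ m * a := rfl

theorem one_mul_partShiftIncl {e : Γ} {σ : Mor Γ} (m : ((regular R).part e).shift σ) :
    R.one e * partShiftIncl R e σ m = partShiftIncl R e σ m :=
  (isModel_part e).one_mul _

theorem partShiftIncl_mem {e : Γ} {σ γ : Mor Γ} (h : σ.d = γ.r)
    {m : ((regular R).part e).shift σ} (hm : m ∈ (((regular R).part e).shift σ).comp γ) :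
    partShiftIncl R e σ m ∈ R.comp (σ.mul γ h) := by
  rw [mem_shift_comp, mem_compAt h] at hm
  exact (isModel_part e).deg _ _ hm

theorem exists_partShiftIncl_eq_one {e : Γ} {σ : Mor Γ} (h : σ.r = e) :
    ∃ m, partShiftIncl R e σ m = R.one e := by
  obtain ⟨m, hm, hm1⟩ := (isModel_part (R := R) e).surj (Mor.id e) rfl _ (R.one_mem e)
  obtain ⟨n, -, hn⟩ := exists_shiftIncl_eq (M := (regular R).part e) (σ := σ) (γ := σ.inv) (x := m)
    (by rw [mem_compAt (Eq.refl _), Mor.mul_inv_self, h]; exact hm)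
  exact ⟨n, by rw [partShiftIncl, AddMonoidHom.comp_apply, hn, hm1]⟩

theorem eq_zero_of_partShift {e : Γ} {σ : Mor Γ} (h : σ.r ≠ e)
    (m : ((regular R).part e).shift σ) : m = 0 := by
  induction m using homogeneous_induction (((regular R).part e).shift σ).isInternal with
  | hom γ m hm =>
    by_cases hγ : γ.r = σ.d
    · rw [mem_shift_comp, mem_compAt hγ.symm] at hm
      apply shiftIncl_injective
      rw [map_zero]
      exact (isModel_part e).eq_zero (σ.mul γ hγ.symm) h _ hm
    · exact eq_zero_of_mem_shift_comp hγ hm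
  | zero => rfl
  | add x y hx hy => rw [hx, hy, add_zero]

/-- If `r(σ) = e`, the element corresponding to `1_e` is a generator; otherwise the shift is zero.
The redundant factor `1_e` in the coefficient is kept because it places preimages in the ideal
generated by `1_e`. -/
theorem exists_generator_partShift (e : Γ) (σ : Mor Γ) : ∃ v : ((regular R).part e).shift σ,
    ∀ m, m = (((regular R).part e).shift σ).act v (R.one e * partShiftIncl R e σ m) := by
  by_cases h : σ.r = e
  · obtain ⟨v, hv⟩ := exists_partShiftIncl_eq_one (R := R) h
    refine ⟨v, fun m => partShiftIncl_injective e σ ?_⟩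
    rw [partShiftIncl_act, hv, GrRing.one_mul_one_mul, one_mul_partShiftIncl]
  · exact ⟨0, fun m => by rw [eq_zero_of_partShift h m]; simp⟩

/-- Every element of a summand has the form `v 1_{e_i} r` for a generator `v`. Its preimage in `R`
is then a product with `1_{e_i}` in the middle. -/
theorem _root_.GroupoidGraded.GrRing.gen_of_iso_directSum {Δ : Set Γ} {I : Type u'} (e : I → Γ)
    (he : ∀ i, e i ∈ Δ) (σ : I → Mor Γ) (h : (regular R).Iso
      (directSum fun i => ((regular R).part (e i)).shift (σ i))) : R.Gen Δ := by
  obtain ⟨φ, hφ, -⟩ := h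
  intro g
  let M : I → GrMod.{u, u} R := fun i => ((regular R).part (e i)).shift (σ i)
  suffices ∀ x : directSum M, φ.symm x ∈ R.objIdeal Δ by
    have h := this (φ (R.one g)); rwa [AddEquiv.symm_apply_apply] at h
  intro x
  rw [eq_sum_incl x, map_sum]
  refine sum_mem fun i _ => ?_
  obtain ⟨v, hv⟩ := exists_generator_partShift (R := R) (e i) (σ i)
  have h1 := hφ (φ.symm (incl M i v))
    (R.one (e i) * partShiftIncl R (e i) (σ i) (coord M i x))
  rw [AddEquiv.apply_symm_apply, ← incl_act, ← hv] at h1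
  have h2 := φ.symm_apply_eq.2 h1.symm
  refine h2 ▸ ?_
  change _ * (R.one (e i) * _) ∈ _
  rw [← mul_assoc]
  exact GrRing.mul_one_mul_mem_objIdeal (he i) _ _

theorem _root_.GroupoidGraded.GrRing.SimplyGen.exists_iso_directSum {Δ : Set Γ}
    (h : R.SimplyGen Δ) : ∃ (I : Type u) (e : I → Δ) (σ : I → Mor Γ), (regular R).Iso
      (directSum fun i => ((regular R).part (e i)).shift (σ i)) := by
  obtain ⟨I, γ, x, hx, hγ⟩ := (regular R).exists_isPseudoBasis h regular_isUnital
  -- Left multiplication by `x_i` raises degrees by `γ_i`; shifting the summand by `γ_i⁻¹` makes it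
  -- degree preserving. Independence of the pseudo-basis gives injectivity and generation gives
  -- surjectivity.
  refine ⟨I, fun i => ⟨(γ i).d, (hγ i).1⟩, fun i => (γ i).inv, ?_⟩
  let M : I → GrMod.{u, u} R := fun i => ((regular R).part (γ i).d).shift (γ i).inv
  let ψ : ∀ i, M i →+ R := fun i => partShiftIncl R (γ i).d (γ i).inv
  let φ : directSum M →+ regular R := lift M fun i => (AddMonoidHom.mulLeft (x i)).comp (ψ i)
  have hφ : ∀ i m, φ (incl M i m) = (x i * ψ i m : R) := fun i m => lift_incl _ _ _
  have hφ' : ∀ z, φ z = (∑ i ∈ (finite_coord z).toFinset, x i * ψ i (coord M i z) : R) :=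
    fun z => lift_eq_sum _ z
  have hact : ∀ (z : directSum M) (a : R), φ ((directSum M).act z a) = (regular R).act (φ z) a :=
      fun z a => by
    have h1 : φ.comp ((directSum M).act.flip a) z = ((regular R).act.flip a).comp φ z := by
      rw [eq_sum_incl z, map_sum, map_sum]
      refine Finset.sum_congr rfl fun i _ => ?_
      rw [AddMonoidHom.comp_apply, AddMonoidHom.comp_apply, AddMonoidHom.flip_apply,
        AddMonoidHom.flip_apply, ← incl_act, hφ, hφ]
      exact (mul_assoc _ _ _).symm
    exact h1
  refine iso_of_bijective φ ⟨?_, ?_⟩ hact ?_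
  · refine (injective_iff_map_eq_zero _).2 fun z hz => ?_
    let a : I →₀ R := Finsupp.onFinset (finite_coord z).toFinset (fun i => ψ i (coord M i z))
      fun i hi => by
        rw [Set.Finite.mem_toFinset]
        intro h0
        exact hi (by rw [h0, map_zero])
    have ha := hx.2.2 a (fun i => ⟨ψ i (coord M i z), (one_mul_partShiftIncl _).symm⟩) (by
      rw [Finsupp.onFinset_sum _ (fun i => map_zero _)]
      exact (hφ' z).symm.trans hz)
    refine coord_ext fun i => partShiftIncl_injective _ _ ?_
    rw [map_zero, map_zero]
    exact DFunLike.congr_fun ha i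
  · rw [← AddMonoidHom.range_eq_top]
    refine hx.2.1 _ ?_ fun i => ?_
    · rintro _ ⟨z, rfl⟩ a
      exact ⟨(directSum M).act z a, hact z a⟩
    · obtain ⟨m, hm⟩ := exists_partShiftIncl_eq_one (R := R) (e := (γ i).d) (σ := (γ i).inv) rfl
      refine ⟨incl M i m, ?_⟩
      rw [hφ, hm]
      exact R.mul_one (hx.1 i)
  · intro ρ z hz
    rw [hφ']
    refine sum_mem fun i _ => ?_
    have hzi := mem_directSum_comp.1 hz i
    by_cases hr : (γ i).r = ρ.r
    · have h1 := partShiftIncl_mem (σ := (γ i).inv) hr hzi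
      have h2 := GrRing.mul_mem_mul rfl (hx.1 i) h1
      rwa [Mor.mul_inv_cancel_left _ _ hr] at h2
    · rw [eq_zero_of_mem_shift_comp (Ne.symm hr) hzi, map_zero, mul_zero]
      exact zero_mem _

end GrMod

end GroupoidGraded

end

noncomputable section

namespace GroupoidGraded

namespace GrRing

variable {Γ : Type v} [Groupoid.{w} Γ] {R : GrRing.{u} Γ} {S : GrRing.{u'} Γ}

/-! ## Isomorphisms -/

theorem iso_of_hom (φ : R →ₙ+* S) (hdeg : ∀ γ, ∀ a ∈ R.comp γ, φ a ∈ S.comp γ)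
    (hinj : ∀ γ, ∀ a ∈ R.comp γ, φ a = 0 → a = 0)
    (hsurj : ∀ γ, ∀ b ∈ S.comp γ, ∃ a ∈ R.comp γ, φ a = b) : R.Iso S := by
  have hpr : ∀ γ a, φ (R.pr γ a) = S.pr γ (φ a) := fun γ a => by
    induction a using homogeneous_induction R.isInternal with
    | hom ρ a ha =>
      rw [pr, pr, proj_of_mem _ ha, proj_of_mem _ (hdeg ρ a ha)]
      split_ifs <;> simp
    | zero => simp
    | add x y hx hy => simp only [map_add, hx, hy]
  have hbij : Function.Bijective φ := by
    refine ⟨(injective_iff_map_eq_zero φ).2 fun a ha => ?_, fun b => ?_⟩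
    · exact eq_zero_of_proj R.isInternal fun γ => hinj γ _ (proj_mem _ _ _) (by
        rw [show proj R.isInternal γ = R.pr γ from rfl, hpr, ha, map_zero])
    · induction b using homogeneous_induction S.isInternal with
      | hom γ b hb => obtain ⟨a, -, ha⟩ := hsurj γ b hb; exact ⟨a, ha⟩
      | zero => exact ⟨0, map_zero φ⟩
      | add x y hx hy =>
        obtain ⟨a, rfl⟩ := hx; obtain ⟨b, rfl⟩ := hy; exact ⟨a + b, map_add φ a b⟩
  refine ⟨RingEquiv.ofBijective φ hbij, hdeg, fun e => ?_⟩
  refine one_unique (hdeg _ _ (R.one_mem e)) fun γ b hb hγ => ?_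
  obtain ⟨a, ha, rfl⟩ := hsurj γ b hb
  change φ _ * φ a = φ a
  rw [← map_mul, one_mul_of_r hγ ha]

/-- Commutation with the projections shows that a degree preserving bijection also reflects degrees,
so isomorphisms can be inverted. -/
theorem Iso.exists_equiv (h : R.Iso S) : ∃ φ : R ≃+* S,
    (∀ γ a, φ a ∈ S.comp γ ↔ a ∈ R.comp γ) ∧ ∀ e, φ (R.one e) = S.one e := by
  obtain ⟨φ, hdeg, hone⟩ := h
  refine ⟨φ, fun γ a => ⟨fun hb => ?_, hdeg γ a⟩, hone⟩
  have hpr : φ (R.pr γ a) = S.pr γ (φ a) := by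
    clear hb
    induction a using homogeneous_induction R.isInternal with
    | hom ρ a ha =>
      rw [pr, pr, proj_of_mem _ ha, proj_of_mem _ (hdeg ρ a ha)]
      split_ifs <;> simp
    | zero => simp
    | add x y hx hy => simp only [map_add, hx, hy]
  rw [show S.pr γ (φ a) = φ a from proj_same _ hb] at hpr
  rw [← φ.injective hpr]
  exact proj_mem _ _ _

theorem Iso.symm (h : R.Iso S) : S.Iso R := by
  obtain ⟨φ, hdeg, hone⟩ := h.exists_equiv
  refine ⟨φ.symm, fun γ b hb => ?_, fun e => by rw [← hone, RingEquiv.symm_apply_apply]⟩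
  rw [← hdeg, RingEquiv.apply_symm_apply]
  exact hb

theorem Iso.trans {T : GrRing.{u''} Γ} (h : R.Iso S) (h' : S.Iso T) : R.Iso T := by
  obtain ⟨φ, hdeg, hone⟩ := h
  obtain ⟨ψ, hdeg', hone'⟩ := h'
  exact ⟨φ.trans ψ, fun γ a ha => hdeg' γ _ (hdeg γ a ha), fun e => by
    rw [RingEquiv.trans_apply, hone, hone']⟩

theorem Iso.rSimple (h : R.Iso S) {f : Γ} (hf : R.RSimple f) : S.RSimple f := by
  obtain ⟨φ, hdeg, hone⟩ := h.exists_equiv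
  rw [RSimple, ← hone]
  refine ⟨(map_ne_zero_iff φ φ.injective).2 hf.1, fun γ hγ a ha h0 => ?_⟩
  obtain ⟨a, rfl⟩ := φ.surjective a
  obtain ⟨b, hb⟩ := hf.2 γ hγ a ((hdeg γ a).1 ha) fun h => h0 (by rw [h, map_zero])
  exact ⟨φ b, by rw [← map_mul, hb]⟩

theorem Iso.gen (h : R.Iso S) {Δ : Set Γ} (hΔ : R.Gen Δ) : S.Gen Δ := by
  obtain ⟨φ, -, hone⟩ := h.exists_equiv
  have key : R.objIdeal Δ ≤ (S.objIdeal Δ).comap φ.toAddEquiv.toAddMonoidHom := by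
    refine (AddSubgroup.closure_le _).2 ?_
    rintro _ ⟨_, ⟨f, hf, rfl⟩, x, y, rfl⟩
    change φ _ ∈ S.objIdeal Δ
    rw [map_mul, map_mul, hone]
    exact mul_one_mul_mem_objIdeal (R := S) hf (φ x) (φ y)
  intro e
  rw [← hone]
  exact key (hΔ e)

theorem Iso.simplyGen (h : R.Iso S) {Δ : Set Γ} (hΔ : R.SimplyGen Δ) : S.SimplyGen Δ :=
  ⟨fun f hf => h.rSimple (hΔ.1 f hf), h.gen hΔ.2⟩

theorem Iso.isDivisionRingAt (h : R.Iso S) {f : Γ} (hf : R.IsDivisionRingAt f) :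
    S.IsDivisionRingAt f := by
  obtain ⟨φ, hdeg, hone⟩ := h.exists_equiv
  rw [IsDivisionRingAt, ← hone]
  refine ⟨(map_ne_zero_iff φ φ.injective).2 hf.1, fun a ha h0 => ?_⟩
  obtain ⟨a, rfl⟩ := φ.surjective a
  obtain ⟨b, hb, h1, h2⟩ := hf.2 a ((hdeg _ a).1 ha) fun h => h0 (by rw [h, map_zero])
  exact ⟨φ b, (hdeg _ b).2 hb, by rw [← map_mul, h1], by rw [← map_mul, h2]⟩

/-! ### Graded products -/

section Prod

variable {J : Type u} (F : J → GrRing.{u} Γ)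

/-- The coordinates of an element of a graded product. -/
def prodEval (j : J) : prod F →ₙ+* F j :=
  (Pi.evalNonUnitalRingHom (fun j => (F j).carrier) j).comp
    { toFun := Subtype.val
      map_mul' := fun _ _ => rfl
      map_zero' := rfl
      map_add' := fun _ _ => rfl }

variable {F}

theorem prod_ext {a b : prod F} (h : ∀ j, prodEval F j a = prodEval F j b) : a = b :=
  Subtype.val_injective (funext h)

theorem mem_prod_comp {γ : Mor Γ} {a : prod F} :
    a ∈ (prod F).comp γ ↔ ∀ j, prodEval F j a ∈ (F j).comp γ :=
  mem_prodComp F (x := a.1)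

theorem exists_prodEval_eq {γ : Mor Γ} {x : ∀ j, F j} (hx : ∀ j, x j ∈ (F j).comp γ) :
    ∃ a ∈ (prod F).comp γ, ∀ j, prodEval F j a = x j :=
  ⟨⟨x, AddSubgroup.mem_iSup_of_mem γ ((mem_prodComp F).2 hx)⟩, (mem_prodComp F).2 hx, fun _ => rfl⟩

theorem prodEval_one (j : J) (e : Γ) : prodEval F j ((prod F).one e) = (F j).one e := by
  obtain ⟨u, hu, h⟩ := exists_prodEval_eq (F := F) (γ := Mor.id e) fun j => (F j).one_mem e
  rw [← one_unique hu fun γ a ha hγ => prod_ext fun j => ?_, h]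
  rw [map_mul, h, one_mul_of_r hγ (mem_prod_comp.1 ha j)]

theorem exists_prod_single {γ : Mor Γ} {j : J} {a : F j} (ha : a ∈ (F j).comp γ) :
    ∃ b ∈ (prod F).comp γ, prodEval F j b = a ∧ ∀ j', j' ≠ j → prodEval F j' b = 0 := by
  classical
  obtain ⟨b, hb, h⟩ := exists_prodEval_eq (F := F) (γ := γ)
    (x := Pi.single (M := fun j => (F j).carrier) j a) fun j' => by
      by_cases hj : j' = j
      · subst hj; rw [Pi.single_eq_same]; exact ha
      · rw [Pi.single_eq_of_ne hj]; exact zero_mem _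
  exact ⟨b, hb, by rw [h, Pi.single_eq_same], fun j' hj => by rw [h, Pi.single_eq_of_ne hj]⟩

/-- Elements with range `f` vanish in all factors but the `j`-th, where the right inverse is found.
-/
theorem RSimple.prod {j : J} {f : Γ} (h : (F j).RSimple f)
    (h0 : ∀ j', j' ≠ j → (F j').one f = 0) : (GrRing.prod F).RSimple f := by
  refine ⟨fun h' => h.1 ?_, fun γ hγ a ha ha0 => ?_⟩
  · rw [← prodEval_one, h', map_zero]
  · have h1 : ∀ j', j' ≠ j → prodEval F j' a = 0 := fun j' hj => by
      rw [← one_mul_of_r hγ (mem_prod_comp.1 ha j'), h0 j' hj, zero_mul]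
    have h2 := mem_prod_comp.1 ha j
    obtain ⟨b, hb⟩ := h.2 γ hγ _ h2 fun h3 => ha0 (prod_ext fun j' => by
      rw [map_zero]
      by_cases hj : j' = j
      · subst hj; exact h3
      · exact h1 j' hj)
    obtain ⟨b, hbm, hb⟩ := exists_homogeneous_inv hγ h2 hb
    obtain ⟨c, -, hc, -⟩ := exists_prod_single hbm
    refine ⟨c, prod_ext fun j' => ?_⟩
    rw [map_mul, prodEval_one]
    by_cases hj : j' = j
    · subst hj; rw [hc, hb]
    · rw [h1 j' hj, h0 j' hj, zero_mul]

theorem isDivisionRingAt_of_prod {j : J} {f : Γ} (h : (prod F).IsDivisionRingAt f)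
    (h0 : ∀ j', j' ≠ j → (F j').comp (Mor.id f) = ⊥) : (F j).IsDivisionRingAt f := by
  have h1 : ∀ a ∈ (prod F).comp (Mor.id f), ∀ j', j' ≠ j → prodEval F j' a = 0 :=
    fun a ha j' hj => by
      have := mem_prod_comp.1 ha j'
      rwa [h0 j' hj, AddSubgroup.mem_bot] at this
  refine ⟨fun h' => h.1 (prod_ext fun j' => ?_), fun a ha ha0 => ?_⟩
  · rw [map_zero]
    by_cases hj : j' = j
    · subst hj; rw [prodEval_one, h']
    · exact h1 _ ((prod F).one_mem f) j' hj
  · obtain ⟨c, hc, hca, -⟩ := exists_prod_single ha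
    obtain ⟨b, hb, hcb, hbc⟩ := h.2 c hc fun h' => ha0 (by rw [← hca, h', map_zero])
    refine ⟨prodEval F j b, mem_prod_comp.1 hb j, ?_, ?_⟩
    · rw [← hca, ← map_mul, hcb, prodEval_one]
    · rw [← hca, ← map_mul, hbc, prodEval_one]

open Classical in
variable (F) in
/-- The inclusion of a factor in a graded product. -/
def prodSingle (j : J) : F j →+ prod F where
  toFun a := ⟨Pi.single (M := fun j => (F j).carrier) j a, by
    induction a using homogeneous_induction (F j).isInternal with
    | hom γ a ha =>
      refine AddSubgroup.mem_iSup_of_mem γ ((mem_prodComp F).2 fun j' => ?_)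
      by_cases hj : j' = j
      · subst hj; rw [Pi.single_eq_same]; exact ha
      · rw [Pi.single_eq_of_ne hj]; exact zero_mem _
    | zero => rw [Pi.single_zero]; exact zero_mem _
    | add x y hx hy => rw [Pi.single_add]; exact add_mem hx hy⟩
  map_zero' := Subtype.ext (Pi.single_zero _)
  map_add' a b := Subtype.ext (Pi.single_add (f := fun j => (F j).carrier) j a b)

theorem prodEval_single_same (j : J) (a : F j) : prodEval F j (prodSingle F j a) = a := by
  classical
  exact Pi.single_eq_same (M := fun j => (F j).carrier) j a

theorem prodEval_single_ne {j j' : J} (h : j' ≠ j) (a : F j) :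
    prodEval F j' (prodSingle F j a) = 0 := by
  classical
  exact Pi.single_eq_of_ne (M := fun j => (F j).carrier) h a

/-- The identity of the product at `e` has all the `1_e` as coordinates, which gives necessity. For
sufficiency, a family homogeneous of degree `γ` can be nonzero only where `1_{r(γ)} ≠ 0`. -/
theorem summable_iff : Summable F ↔ ∀ e, {j | (F j).one e ≠ 0}.Finite := by
  classical
  refine ⟨fun h e => ?_, fun h => Set.Subset.antisymm (fun x hx => ?_) fun x hx => ?_⟩
  · have h1 : (fun j => (F j).one e) ∈ ((⨆ γ, prodComp F γ : AddSubgroup (∀ j, F j)) :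
        Set (∀ j, F j)) :=
      AddSubgroup.mem_iSup_of_mem (Mor.id e) ((mem_prodComp F).2 fun j => (F j).one_mem e)
    rw [h] at h1
    exact h1
  · induction hx using AddSubgroup.iSup_induction' with
    | hp γ x hx =>
      refine (h γ.r).subset fun j hj h0 => hj ?_
      rw [← (F j).one_mul ((mem_prodComp F).1 hx j), h0, zero_mul]
    | h1 => simp
    | hadd x y _ _ hx hy =>
      refine (hx.union hy).subset fun j hj => ?_
      by_contra h'
      simp only [Set.mem_union, Set.mem_ofPred_eq, not_or, not_not] at h'
      exact hj (by simp [h'])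
  · have hx' : {j | x j ≠ 0}.Finite := hx
    have : x = ∑ j ∈ hx'.toFinset, (prodSingle F j (x j)).1 := by
      funext j
      rw [Finset.sum_apply]
      change x j = ∑ i ∈ hx'.toFinset, prodEval F j (prodSingle F i (x i))
      by_cases hj : x j = 0
      · rw [hj, eq_comm]
        refine Finset.sum_eq_zero fun i _ => ?_
        by_cases hij : j = i
        · subst hij; rw [hj, map_zero, map_zero]
        · exact prodEval_single_ne hij _
      · rw [Finset.sum_eq_single j (fun i _ hi => prodEval_single_ne (Ne.symm hi) _)
          (fun h' => absurd (hx'.mem_toFinset.2 hj) h'), prodEval_single_same]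
    rw [this]
    refine sum_mem fun j _ => ?_
    exact (prodSingle F j (x j)).2

/-- Summability makes `1_e` a finite sum of elements of single factors, each of which is handled
inside its factor. -/
theorem Gen.prod (hF : Summable F) {f : J → Γ} (h : ∀ j, (F j).Gen {f j}) :
    (GrRing.prod F).Gen (Set.range f) := by
  intro e
  have hfin := summable_iff.1 hF e
  have h1 : (GrRing.prod F).one e = ∑ j ∈ hfin.toFinset, prodSingle F j ((F j).one e) := by
    refine prod_ext fun j => ?_
    rw [map_sum, prodEval_one]
    by_cases hj : (F j).one e = 0
    · rw [hj, eq_comm]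
      refine Finset.sum_eq_zero fun i _ => ?_
      by_cases hij : j = i
      · subst hij; rw [hj, map_zero, map_zero]
      · exact prodEval_single_ne hij _
    · rw [Finset.sum_eq_single j (fun i _ hi => prodEval_single_ne (Ne.symm hi) _)
        (fun h' => absurd (hfin.mem_toFinset.2 hj) h'), prodEval_single_same]
  rw [h1]
  refine sum_mem fun j _ => ?_
  have key : (F j).objIdeal {f j} ≤
      ((GrRing.prod F).objIdeal (Set.range f)).comap (prodSingle F j) := by
    refine (AddSubgroup.closure_le _).2 ?_
    rintro _ ⟨_, ⟨g, hg, rfl⟩, x, y, rfl⟩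
    rw [Set.mem_singleton_iff] at hg
    subst hg
    have h2 : prodSingle F j (x * (F j).one (f j) * y) =
        prodSingle F j x * (GrRing.prod F).one (f j) * prodSingle F j y := by
      refine prod_ext fun j' => ?_
      rw [map_mul (prodEval F j'), map_mul (prodEval F j'), prodEval_one]
      by_cases hj : j' = j
      · subst hj; simp only [prodEval_single_same]
      · simp only [prodEval_single_ne hj, mul_zero]
    rw [SetLike.mem_coe, AddSubgroup.mem_comap, h2]
    exact mul_one_mul_mem_objIdeal (Set.mem_range_self j) _ _
  exact key (h j e)

theorem prod_iso_of_unique [Unique J] : (prod F).Iso (F default) := by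
  refine iso_of_hom (prodEval F default) (fun γ a ha => mem_prod_comp.1 ha _)
    (fun γ a _ h => prod_ext fun j => ?_) (fun γ b hb => ?_)
  · rw [Unique.eq_default j, h, map_zero]
  · obtain ⟨a, ha, h, -⟩ := exists_prod_single hb
    exact ⟨a, ha, h⟩

end Prod

end GrRing

end GroupoidGraded

end

noncomputable section

namespace GroupoidGraded

theorem mem_compAt₃ {Γ : Type v} [Groupoid.{w} Γ] {G : Type u} [AddCommGroup G]
    {X : Mor Γ → AddSubgroup G} {σ γ τ : Mor Γ} (h : σ.d = γ.r) (h' : γ.d = τ.d) {x : G} :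
    x ∈ compAt₃ X σ γ τ ↔ x ∈ X ((σ.mul γ h).mul τ.inv h') := by
  rw [compAt₃, dif_pos ⟨h, h'⟩]

theorem eq_of_mem_compAt₃ {Γ : Type v} [Groupoid.{w} Γ] {G : Type u} [AddCommGroup G]
    {X : Mor Γ → AddSubgroup G} {σ γ τ : Mor Γ} {x : G} (hx : x ∈ compAt₃ X σ γ τ) (h0 : x ≠ 0) :
    σ.d = γ.r ∧ γ.d = τ.d := by
  by_contra h
  rw [compAt₃, dif_neg h, AddSubgroup.mem_bot] at hx
  exact h0 hx

namespace Mor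

variable {Γ : Type v} [Groupoid.{w} Γ]

theorem inv_mul_mul_inv {σ γ τ : Mor Γ} (h : σ.d = γ.r) (h' : γ.d = τ.d) :
    ((σ.mul γ h).mul τ.inv h').inv = (τ.mul γ.inv h'.symm).mul σ.inv h.symm := by
  obtain ⟨a, b, g⟩ := σ
  obtain ⟨c, b', g'⟩ := γ
  obtain ⟨c', b'', g''⟩ := τ
  simp only at h h'
  subst h h'
  simp [mul, inv]

theorem mul_inv_mul_mul_inv {σ τ : Mor Γ} (h : σ.r = τ.r) :
    (σ.mul (σ.inv.mul τ h) rfl).mul τ.inv rfl = id σ.r := by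
  obtain ⟨a, b, g⟩ := σ
  obtain ⟨c, b', g'⟩ := τ
  simp only at h
  subst h
  simp [mul, inv, id]

end Mor

namespace GrRing

variable {Γ : Type v} [Groupoid.{w} Γ]

/-! ## Graded matrix rings -/

namespace FinMatrix

variable {K : Type u} {D : Type u} [NonUnitalRing D]

open Classical in
/-- The matrix with only entry `d`, at the position `(k, l)`. -/
def single (k l : K) (d : D) : FinMatrix K D :=
  ⟨fun i j => if i = k ∧ j = l then d else 0, by
    refine (Set.finite_singleton (k, l)).subset fun p hp => ?_
    simp only [ne_eq, ite_eq_right_iff, Classical.not_imp, Set.mem_ofPred_eq] at hp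
    exact Prod.ext hp.1.1 hp.1.2⟩

theorem single_apply_same (k l : K) (d : D) : (single k l d).1 k l = d := by
  classical
  exact if_pos ⟨rfl, rfl⟩

theorem single_apply_ne {k l i j : K} (h : ¬ (i = k ∧ j = l)) (d : D) :
    (single k l d).1 i j = 0 := by
  classical
  exact if_neg h

theorem mul_single_apply_same (A : FinMatrix K D) (k l i : K) (d : D) :
    (A * single k l d).1 i l = A.1 i k * d := by
  rw [mul_apply, finsum_eq_single _ k fun m hm => by rw [single_apply_ne fun h => hm h.1, mul_zero],
    single_apply_same]

theorem mul_single_apply_ne (A : FinMatrix K D) (k : K) {l j : K} (h : j ≠ l) (i : K) (d : D) :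
    (A * single k l d).1 i j = 0 := by
  rw [mul_apply]
  refine finsum_eq_zero_of_forall_eq_zero fun m => ?_
  rw [single_apply_ne fun h' => h h'.2, mul_zero]

theorem single_mul_single (k l m : K) (a b : D) :
    single k l a * single l m b = single k m (a * b) := by
  ext i j
  by_cases hj : j = m
  · subst hj
    rw [mul_single_apply_same]
    by_cases hi : i = k
    · subst hi; rw [single_apply_same, single_apply_same]
    · rw [single_apply_ne fun h => hi h.1, single_apply_ne fun h => hi h.1, zero_mul]
  · rw [mul_single_apply_ne _ _ hj, single_apply_ne fun h => hj h.2]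

end FinMatrix

section Matrix

variable {K : Type u} {D : GrRing.{u} Γ} {σ : K → Mor Γ} {hσ : DFinite σ}

variable (D σ hσ) in
/-- The underlying matrix of an element of a graded matrix ring. -/
def matrixIncl : D.matrix σ hσ →ₙ+* FinMatrix K D where
  toFun := Subtype.val
  map_mul' _ _ := rfl
  map_zero' := rfl
  map_add' _ _ := rfl

theorem matrixIncl_injective : Function.Injective (matrixIncl D σ hσ) := Subtype.val_injective

theorem mem_matrix_comp {γ : Mor Γ} {A : D.matrix σ hσ} :
    A ∈ (D.matrix σ hσ).comp γ ↔
      ∀ i j, (matrixIncl D σ hσ A).1 i j ∈ compAt₃ D.comp (σ i) γ (σ j) := Iff.rfl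

theorem exists_matrixIncl_eq {γ : Mor Γ} {A : FinMatrix K D}
    (hA : ∀ i j, A.1 i j ∈ compAt₃ D.comp (σ i) γ (σ j)) :
    ∃ B ∈ (D.matrix σ hσ).comp γ, matrixIncl D σ hσ B = A :=
  ⟨⟨A, AddSubgroup.mem_iSup_of_mem γ hA⟩, hA, rfl⟩

theorem matrixIncl_one (e : Γ) :
    matrixIncl D σ hσ ((D.matrix σ hσ).one e) = matrixOne D σ hσ e := by
  obtain ⟨u, hu, h⟩ := exists_matrixIncl_eq (hσ := hσ) (matrixOne_mem D σ hσ e)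
  rw [← one_unique hu fun γ a ha hγ => matrixIncl_injective ?_, h]
  subst hγ
  rw [map_mul, h]
  exact matrixOne_mul D σ hσ (mem_matrix_comp.1 ha)

theorem exists_matrixIncl_eq_single {k l : K} {γ : Mor Γ} {d : D}
    (hd : d ∈ compAt₃ D.comp (σ k) γ (σ l)) :
    ∃ B ∈ (D.matrix σ hσ).comp γ, matrixIncl D σ hσ B = FinMatrix.single k l d := by
  refine exists_matrixIncl_eq fun i j => ?_
  by_cases h : i = k ∧ j = l
  · obtain ⟨rfl, rfl⟩ := h
    rwa [FinMatrix.single_apply_same]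
  · rw [FinMatrix.single_apply_ne h]; exact zero_mem _

theorem one_ne_zero_of_supportedAt [Nontrivial D] {e₀ : Γ} (h : D.SupportedAt e₀) :
    D.one e₀ ≠ 0 := by
  obtain ⟨e, he⟩ := exists_one_ne_zero (R := D)
  rwa [← (h (Mor.id e) fun h' => he (by rw [← AddSubgroup.mem_bot, ← h']; exact D.one_mem e)).1]

theorem matrixOne_apply_same {e : Γ} {i : K} (h : (σ i).d = e) :
    (matrixOne D σ hσ e).1 i i = D.one (σ i).r := if_pos ⟨rfl, h⟩

theorem matrixOne_apply_ne {e : Γ} {i j : K} (h : ¬ (i = j ∧ (σ i).d = e)) :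
    (matrixOne D σ hσ e).1 i j = 0 := if_neg h

theorem matrix_one_ne_zero {e₀ : Γ} (hD : D.IsGrDivisionRing) (hs : D.SupportedAt e₀)
    (hr : ∀ i, (σ i).r = e₀) (i : K) : (D.matrix σ hσ).one (σ i).d ≠ 0 := by
  have := hD.1
  intro h
  have h1 := matrixOne_apply_same (D := D) (hσ := hσ) (i := i) rfl
  rw [← matrixIncl_one, h, map_zero, hr] at h1
  exact one_ne_zero_of_supportedAt hs h1.symm

theorem matrix_one_eq_zero {e : Γ} (h : ∀ i, (σ i).d ≠ e) : (D.matrix σ hσ).one e = 0 := by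
  apply matrixIncl_injective
  rw [matrixIncl_one, map_zero]
  ext i j
  exact matrixOne_apply_ne fun h' => h i h'.2

/-- Uniqueness of the index means that matrices with range `e` have only one nonzero row. Inverting
one nonzero entry of that row in `D` and placing the inverse in the transposed position gives a
right inverse. -/
theorem matrix_rSimple {e₀ : Γ} (hD : D.IsGrDivisionRing) (hs : D.SupportedAt e₀)
    (hr : ∀ i, (σ i).r = e₀) {e : Γ} (he : ∃! i, (σ i).d = e) : (D.matrix σ hσ).RSimple e := by
  obtain ⟨i₀, rfl, hi₀⟩ := he
  refine ⟨matrix_one_ne_zero hD hs hr i₀, fun γ hγ a ha h0 => ?_⟩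
  obtain ⟨k, l, hkl⟩ : ∃ k l, (matrixIncl D σ hσ a).1 k l ≠ 0 := by
    by_contra! h
    exact h0 (matrixIncl_injective (by rw [map_zero]; ext k l; exact h k l))
  have hm := mem_matrix_comp.1 ha k l
  obtain ⟨h1, h2⟩ := eq_of_mem_compAt₃ hm hkl
  obtain rfl : k = i₀ := hi₀ k (h1.trans hγ)
  rw [mem_compAt₃ h1 h2] at hm
  obtain ⟨b, hb, hab, -⟩ := hD.2 _ _ hm hkl
  obtain ⟨B, -, hB⟩ := exists_matrixIncl_eq_single (hσ := hσ) (k := l) (l := k) (γ := γ.inv)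
    (d := b) (by
      rw [mem_compAt₃ h2.symm h1.symm, ← Mor.inv_mul_mul_inv h1 h2]; exact hb)
  refine ⟨B, matrixIncl_injective ?_⟩
  rw [map_mul, hB, matrixIncl_one]
  ext i j
  by_cases hj : j = k
  · subst hj
    rw [FinMatrix.mul_single_apply_same]
    by_cases hi : i = j
    · subst hi
      rw [matrixOne_apply_same rfl, hab]
    · rw [matrixOne_apply_ne fun h => hi h.1]
      have : (matrixIncl D σ hσ a).1 i l = 0 := by
        by_contra h
        exact hi (hi₀ i ((eq_of_mem_compAt₃ (mem_matrix_comp.1 ha i l) h).1.trans hγ))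
      rw [this, zero_mul]
  · rw [FinMatrix.mul_single_apply_ne _ _ hj]
    by_cases hi : i = j
    · subst hi
      rw [matrixOne_apply_ne fun h => hj (hi₀ i h.2)]
    · rw [matrixOne_apply_ne fun h => hi h.1]

theorem one_mem_compAt₃ {e₀ : Γ} (hr : ∀ i, (σ i).r = e₀) (i j : K) :
    D.one e₀ ∈ compAt₃ D.comp (σ i) ((σ i).inv.mul (σ j) ((hr i).trans (hr j).symm)) (σ j) := by
  refine (mem_compAt₃ (X := D.comp) (σ := σ i) (γ := (σ i).inv.mul (σ j) _) (τ := σ j)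
    (Eq.refl _) (Eq.refl _)).2 ?_
  rw [Mor.mul_inv_mul_mul_inv, hr]
  exact D.one_mem e₀

/-- The matrix units `E i j` are homogeneous because all `σ_i` share the range `e₀`. By
`d`-finiteness `1_g` is a finite sum of diagonal units, and each factors as `E k i₀ * E i₀ k`
through the identity at `d(σ_{i₀})`. -/
theorem matrix_gen {e₀ : Γ} (hr : ∀ i, (σ i).r = e₀) (i₀ : K) :
    (D.matrix σ hσ).Gen {(σ i₀).d} := by
  intro g
  have hE : ∀ i j, ∃ B ∈ (D.matrix σ hσ).comp ((σ i).inv.mul (σ j) ((hr i).trans (hr j).symm)),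
      matrixIncl D σ hσ B = FinMatrix.single i j (D.one e₀) := fun i j =>
    exists_matrixIncl_eq_single (one_mem_compAt₃ hr i j)
  choose E hEm hE using hE
  have hEE : ∀ i j k, E i j * E j k = E i k := fun i j k => matrixIncl_injective (by
    rw [map_mul, hE, hE, hE, FinMatrix.single_mul_single, one_mul_one])
  have h1 : (D.matrix σ hσ).one g = ∑ k ∈ (hσ g).toFinset, E k k := by
    apply matrixIncl_injective
    rw [matrixIncl_one, map_sum]
    ext i j
    change _ = FinMatrix.entry i j (∑ k ∈ _, _)
    rw [map_sum]
    change _ = ∑ k ∈ (hσ g).toFinset, (matrixIncl D σ hσ (E k k)).1 i j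
    by_cases h : i = j ∧ (σ i).d = g
    · obtain ⟨rfl, hg⟩ := h
      rw [matrixOne_apply_same hg, Finset.sum_eq_single i
        (fun k _ hk => by rw [hE, FinMatrix.single_apply_ne fun h => hk h.1.symm])
        (fun h => absurd ((hσ g).mem_toFinset.2 hg) h), hE, FinMatrix.single_apply_same, hr]
    · rw [matrixOne_apply_ne h, eq_comm]
      refine Finset.sum_eq_zero fun k hk => ?_
      rw [hE, FinMatrix.single_apply_ne]
      rintro ⟨rfl, rfl⟩
      exact h ⟨rfl, (hσ g).mem_toFinset.1 hk⟩
  rw [h1]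
  refine sum_mem fun k _ => ?_
  rw [← hEE k i₀ k, ← mul_one_of_d (γ := (σ k).inv.mul (σ i₀) _) (e := (σ i₀).d) rfl (hEm k i₀)]
  exact mul_one_mul_mem_objIdeal (Set.mem_singleton _) _ _

theorem matrix_simplyGen {e₀ : Γ} (hD : D.IsGrDivisionRing) (hs : D.SupportedAt e₀)
    (hr : ∀ i, (σ i).r = e₀) {e : Γ} (he : ∃! i, (σ i).d = e) :
    (D.matrix σ hσ).SimplyGen {e} := by
  refine ⟨fun f hf => ?_, ?_⟩
  · rw [Set.mem_singleton_iff] at hf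
    exact hf ▸ matrix_rSimple hD hs hr he
  · obtain ⟨i, rfl, -⟩ := he
    exact matrix_gen hr i

end Matrix

end GrRing

end GroupoidGraded

end

noncomputable section

namespace GroupoidGraded

namespace GrRing

variable {Γ : Type v} [Groupoid.{w} Γ] {R : GrRing.{u} Γ}

/-! ## Corner rings -/

section Corner

open Classical in
variable (R) in
/-- The components of `1_f R 1_f`. -/
def cornerComp (f : Γ) (γ : Mor Γ) : AddSubgroup R :=
  if γ.d = f ∧ γ.r = f then R.comp γ else ⊥

theorem mem_cornerComp {f : Γ} {γ : Mor Γ} (h : γ.d = f ∧ γ.r = f) {x : R} :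
    x ∈ R.cornerComp f γ ↔ x ∈ R.comp γ := by rw [cornerComp, if_pos h]

theorem cornerComp_of_not {f : Γ} {γ : Mor Γ} (h : ¬ (γ.d = f ∧ γ.r = f)) :
    R.cornerComp f γ = ⊥ := by rw [cornerComp, if_neg h]

theorem cornerComp_le (f : Γ) (γ : Mor Γ) : R.cornerComp f γ ≤ R.comp γ := by
  by_cases h : γ.d = f ∧ γ.r = f
  · exact fun x hx => (mem_cornerComp h).1 hx
  · rw [cornerComp_of_not h]; exact bot_le

variable (R) in
/-- The graded ring `1_f R 1_f`. -/
def corner (f : Γ) : GrRing.{u} Γ :=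
  ofFinIndep (R.cornerComp f)
    (R.finIndep.reindex _ (fun _ => True) (fun γ => γ) (fun _ _ _ _ h => h)
      (fun γ _ => cornerComp_le f γ) (fun _ h => absurd trivial h))
    (fun {γ δ a b} ha hb => by
      by_cases h1 : γ.d = f ∧ γ.r = f
      swap
      · rw [cornerComp_of_not h1, AddSubgroup.mem_bot] at ha
        rw [ha, zero_mul]; exact zero_mem _
      by_cases h2 : δ.d = f ∧ δ.r = f
      swap
      · rw [cornerComp_of_not h2, AddSubgroup.mem_bot] at hb
        rw [hb, mul_zero]; exact zero_mem _
      rw [mem_compAt (h1.1.trans h2.2.symm),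
        mem_cornerComp (γ := γ.mul δ (h1.1.trans h2.2.symm)) ⟨h2.1, h1.2⟩]
      exact mul_mem_mul _ ((mem_cornerComp h1).1 ha) ((mem_cornerComp h2).1 hb))
    (fun e => by
      by_cases he : e = f
      · subst he
        exact ⟨R.one e, (mem_cornerComp ⟨rfl, rfl⟩).2 (R.one_mem e), fun γ a ha =>
          ⟨fun h => one_mul_of_r h (cornerComp_le e γ ha),
            fun h => mul_one_of_d h (cornerComp_le e γ ha)⟩⟩
      -- Away from `f` the components are zero, so `0` serves as their identity.
      · refine ⟨0, zero_mem _, fun γ a ha => ?_⟩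
        have h0 : ¬ (γ.d = f ∧ γ.r = f) → a = 0 := fun h => by
          rwa [cornerComp_of_not h, AddSubgroup.mem_bot] at ha
        exact ⟨fun h => by rw [zero_mul, h0 fun h' => he (h.symm.trans h'.2)],
          fun h => by rw [mul_zero, h0 fun h' => he (h.symm.trans h'.1)]⟩)

variable (R) in
/-- The inclusion of `1_f R 1_f` in `R`. -/
def cornerIncl (f : Γ) : R.corner f →ₙ+* R where
  toFun := Subtype.val
  map_mul' _ _ := rfl
  map_zero' := rfl
  map_add' _ _ := rfl

theorem cornerIncl_injective {f : Γ} : Function.Injective (R.cornerIncl f) :=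
  Subtype.val_injective

theorem mem_corner_comp {f : Γ} {γ : Mor Γ} {a : R.corner f} :
    a ∈ (R.corner f).comp γ ↔ R.cornerIncl f a ∈ R.cornerComp f γ := Iff.rfl

theorem exists_cornerIncl_eq {f : Γ} {γ : Mor Γ} {x : R} (hx : x ∈ R.cornerComp f γ) :
    ∃ a ∈ (R.corner f).comp γ, R.cornerIncl f a = x :=
  ⟨⟨x, AddSubgroup.mem_iSup_of_mem γ hx⟩, hx, rfl⟩

theorem cornerIncl_one (f : Γ) : R.cornerIncl f ((R.corner f).one f) = R.one f := by
  obtain ⟨u, hu, h⟩ := exists_cornerIncl_eq (R := R) (f := f) (γ := Mor.id f) (x := R.one f)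
    ((mem_cornerComp ⟨rfl, rfl⟩).2 (R.one_mem f))
  rw [← one_unique hu fun γ a ha hγ => cornerIncl_injective ?_, h]
  rw [map_mul, h]
  exact one_mul_of_r hγ (cornerComp_le f γ ha)

theorem corner_supportedAt (f : Γ) : (R.corner f).SupportedAt f := by
  intro γ hγ
  by_contra h
  apply hγ
  rw [eq_bot_iff]
  intro a ha
  rw [mem_corner_comp, cornerComp_of_not h, AddSubgroup.mem_bot] at ha
  exact AddSubgroup.mem_bot.2 (cornerIncl_injective (by rw [ha, map_zero]))

theorem RSimple.corner_isGrDivisionRing {f : Γ} (h : R.RSimple f) :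
    (R.corner f).IsGrDivisionRing := by
  refine ⟨⟨(R.corner f).one f, 0, fun h0 => h.1 (by rw [← cornerIncl_one, h0, map_zero])⟩, fun γ a ha h0 => ?_⟩
  have hγ := corner_supportedAt f γ fun h' => h0 (by rwa [h', AddSubgroup.mem_bot] at ha)
  rw [mem_corner_comp, mem_cornerComp hγ] at ha
  have h1 : R.cornerIncl f a ≠ 0 := fun h' => h0 (cornerIncl_injective (by rw [h', map_zero]))
  obtain ⟨b, hb⟩ := h.2 γ hγ.2 _ ha h1
  obtain ⟨b, hbm, hb⟩ := exists_homogeneous_inv hγ.2 ha hb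
  obtain ⟨c, hc⟩ := h.2 γ.inv hγ.1 b hbm fun h' => h.1 (by rw [← hb, h', mul_zero])
  obtain ⟨c, hcm, hc⟩ := exists_homogeneous_inv (γ := γ.inv) hγ.1 hbm hc
  -- A right inverse `b` of `a` has a right inverse `c` in turn; then `a = a b c = c`, so `b` is
  -- two-sided.
  have hac : R.cornerIncl f a = c := by
    rw [← mul_one_of_d hγ.1 ha, ← hc, ← mul_assoc, hb,
      one_mul_of_r (γ := γ.inv.inv) hγ.2 hcm]
  obtain ⟨b', hb', rfl⟩ := exists_cornerIncl_eq ((mem_cornerComp (γ := γ.inv)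
    ⟨hγ.2, hγ.1⟩).2 hbm)
  refine ⟨b', hb', ?_, ?_⟩ <;> apply cornerIncl_injective
  · rw [map_mul, hb, hγ.2, cornerIncl_one]
  · rw [map_mul, hac, hc, hγ.1, cornerIncl_one]

theorem one_mul_mul_one_mem (f : Γ) (a : R) :
    R.one f * a * R.one f ∈ ⨆ γ, R.cornerComp f γ := by
  induction a using homogeneous_induction R.isInternal with
  | hom γ a ha =>
    by_cases h : γ.d = f ∧ γ.r = f
    · refine AddSubgroup.mem_iSup_of_mem γ ((mem_cornerComp h).2 ?_)
      rwa [one_mul_of_r h.2 ha, mul_one_of_d h.1 ha]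
    · suffices R.one f * a * R.one f = 0 by rw [this]; exact zero_mem _
      by_cases h1 : γ.r = f
      · rw [one_mul_of_r h1 ha, mul_one_of_d_ne (fun h2 => h ⟨h2, h1⟩) ha]
      · rw [one_mul_of_r_ne h1 ha, zero_mul]
  | zero => rw [mul_zero, zero_mul]; exact zero_mem _
  | add x y hx hy => rw [mul_add, add_mul]; exact add_mem hx hy

variable (R) in
/-- The projection `a ↦ 1_f a 1_f`. -/
def toCorner (f : Γ) : R →+ R.corner f :=
  AddMonoidHom.mk' (fun a => ⟨R.one f * a * R.one f, one_mul_mul_one_mem f a⟩) fun a b =>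
    cornerIncl_injective (show R.one f * (a + b) * R.one f =
      R.one f * a * R.one f + R.one f * b * R.one f by rw [mul_add, add_mul])

theorem cornerIncl_toCorner' (f : Γ) (a : R) :
    R.cornerIncl f (R.toCorner f a) = R.one f * a * R.one f := rfl

theorem cornerIncl_toCorner {f : Γ} {a : R} (h1 : R.one f * a = a) (h2 : a * R.one f = a) :
    R.cornerIncl f (R.toCorner f a) = a := by
  rw [cornerIncl_toCorner', h1, h2]

end Corner

/-! ## Dual bases -/

/-- Homogeneous elements `x_i ∈ R_{γ_i}` and `y_i` of degree `γ_i⁻¹` such that `y_i x_j` is the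
identity element for `i = j` and zero otherwise, and such that `1_e` is the (finite) sum of
the `x_i y_i` with `r(γ_i) = e`. -/
structure IsDualBasis (R : GrRing.{u} Γ) {I : Type u} (γ : I → Mor Γ) (x y : I → R) : Prop where
  x_mem : ∀ i, x i ∈ R.comp (γ i)
  y_mem : ∀ i, y i ∈ R.comp (γ i).inv
  one_ne_zero : ∀ i, R.one (γ i).d ≠ 0
  y_mul_x : ∀ i, y i * x i = R.one (γ i).d
  y_mul_x_ne : ∀ i j, i ≠ j → y i * x j = 0
  finite : ∀ e, {i | (γ i).r = e}.Finite
  sum_eq : ∀ e, ∑ i ∈ (finite e).toFinset, x i * y i = R.one e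

/-- Expanding `1_e` in a pseudo-basis of `R_R` gives coefficients, whose components of degree
`γ_i⁻¹` are the `y_i`. Inserting `x_l = ∑ x_i (y_i x_l)` into independence yields the duality
relations. Since `x_l` must occur in the finite expansion of the identity at its range, only
finitely many basis elements have a given range. -/
theorem SimplyGen.exists_isDualBasis {Δ : Set Γ} (h : R.SimplyGen Δ) :
    ∃ (I : Type u) (γ : I → Mor Γ) (x y : I → R), (∀ i, (γ i).d ∈ Δ) ∧ R.IsDualBasis γ x y := by
  classical
  obtain ⟨I, γ, x, hx, hγ⟩ := (GrMod.regular R).exists_isPseudoBasis h GrMod.regular_isUnital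
  have hxm : ∀ i, x i ∈ R.comp (γ i) := hx.1
  -- every element is a linear combination of the basis elements
  have hspan : ∀ r : R, ∃ a : I →₀ R, (a.sum fun i b => x i * b) = r := by
    let N : AddSubgroup R :=
      { carrier := {r | ∃ a : I →₀ R, (a.sum fun i b => x i * b) = r}
        zero_mem' := ⟨0, Finsupp.sum_zero_index⟩
        add_mem' := by
          rintro _ _ ⟨a, rfl⟩ ⟨b, rfl⟩
          exact ⟨a + b, Finsupp.sum_add_index' (fun _ => mul_zero _) fun _ _ _ => mul_add _ _ _⟩
        neg_mem' := by
          rintro _ ⟨a, rfl⟩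
          refine ⟨-a, ?_⟩
          rw [Finsupp.sum_neg_index fun _ => mul_zero _, Finsupp.sum, Finsupp.sum,
            ← Finset.sum_neg_distrib]
          exact Finset.sum_congr rfl fun i _ => mul_neg _ _ }
    have hN : N = ⊤ := hx.2.1 N (by
      rintro _ ⟨a, rfl⟩ b
      refine ⟨a.mapRange (· * b) (zero_mul b), ?_⟩
      rw [Finsupp.sum_mapRange_index fun _ => mul_zero _]
      change _ = (a.sum fun i b => x i * b) * b
      rw [Finsupp.sum, Finsupp.sum, Finset.sum_mul]
      exact Finset.sum_congr rfl fun i _ => (mul_assoc _ _ _).symm)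
      (fun i => ⟨Finsupp.single i (R.one (γ i).d), by
        rw [Finsupp.sum_single_index (mul_zero _), R.mul_one (hxm i)]⟩)
    intro r
    have : r ∈ N := by rw [hN]; trivial
    exact this
  choose a ha using fun e => hspan (R.one e)
  -- Only the expansion of `1_{r(γ_i)}` matters for `x_i`; degree `γ_i⁻¹` is the one for which `x_i
  -- y_i` has the degree of that identity.
  let y : I → R := fun i => R.pr (γ i).inv (a (γ i).r i)
  have hy : ∀ i, y i ∈ R.comp (γ i).inv := fun i => proj_mem _ _ _
  have hy1 : ∀ i, R.one (γ i).d * y i = y i := fun i => one_mul_of_r (γ := (γ i).inv) rfl (hy i)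
  have hsum : ∀ e, ∑ i ∈ (a e).support.filter (fun i => (γ i).r = e), x i * y i = R.one e := by
    intro e
    have h1 := congrArg (R.pr (Mor.id e)) (ha e)
    rw [pr, proj_same _ (R.one_mem e), Finsupp.sum, map_sum] at h1
    rw [← h1, Finset.sum_filter]
    refine Finset.sum_congr rfl fun i _ => ?_
    split_ifs with hi
    · subst hi
      have := pr_mul (τ := (γ i).inv) rfl (hxm i) (a (γ i).r i)
      rw [Mor.mul_inv_self] at this
      exact this.symm
    · refine (pr_eq_zero_of_r_ne (e := (γ i).r) ?_ (Ne.symm hi)).symm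
      rw [← mul_assoc, R.one_mul (hxm i)]
  have key : ∀ l, l ∈ (a (γ l).r).support.filter (fun i => (γ i).r = (γ l).r) ∧
      ∀ i ∈ (a (γ l).r).support.filter (fun i => (γ i).r = (γ l).r),
        y i * x l = if i = l then R.one (γ l).d else 0 := by
    intro l
    set s := (a (γ l).r).support.filter (fun i => (γ i).r = (γ l).r) with hs
    -- The difference of the two expansions `∑ x_i (y_i x_l)` and `x_l 1_{d(γ_l)}` of `x_l`;
    -- independence makes it zero.
    let b : I →₀ R := Finsupp.onFinset (insert l s)
      (fun i => (if i ∈ s then y i * x l else 0) - if i = l then R.one (γ l).d else 0) fun i hi => by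
        by_contra hmem
        rw [Finset.mem_insert, not_or] at hmem
        exact hi (by rw [if_neg hmem.2, if_neg hmem.1, sub_zero])
    have hb := hx.2.2 b (fun i => ⟨b i, by
      change (if i ∈ s then y i * x l else 0) - (if i = l then R.one (γ l).d else 0) =
        R.one (γ i).d * ((if i ∈ s then y i * x l else 0) - if i = l then R.one (γ l).d else 0)
      rw [mul_sub]
      congr 1
      · split_ifs
        · rw [← mul_assoc, hy1]
        · rw [mul_zero]
      · split_ifs with hil
        · rw [hil, one_mul_one]
        · rw [mul_zero]⟩) (by
      rw [Finsupp.onFinset_sum _ fun i => map_zero _]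
      change ∑ i ∈ insert l s, x i * ((if i ∈ s then y i * x l else 0) -
        if i = l then R.one (γ l).d else 0) = 0
      simp only [mul_sub, Finset.sum_sub_distrib, mul_ite, mul_zero]
      rw [Finset.sum_ite_eq' (insert l s) l (fun i => x i * R.one (γ l).d),
        if_pos (Finset.mem_insert_self _ _),
        ← Finset.sum_filter, Finset.filter_mem_eq_inter,
        Finset.inter_eq_right.2 (Finset.subset_insert l s)]
      simp only [← mul_assoc]
      rw [← Finset.sum_mul, hs, hsum, R.one_mul (hxm l), R.mul_one (hxm l), sub_self])
    have hb' : ∀ i, (if i ∈ s then y i * x l else 0) = if i = l then R.one (γ l).d else 0 :=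
      fun i => sub_eq_zero.1 (DFunLike.congr_fun hb i)
    -- Were `l` outside `s`, its coefficient would give `1_{d(γ_l)} = 0`, which is impossible as
    -- `x_l ≠ 0`.
    have hls : l ∈ s := by
      by_contra hl
      have := hb' l
      rw [if_neg hl, if_pos rfl] at this
      exact (one_ne_zero_of_mem (hxm l) (hγ l).2).2 this.symm
    exact ⟨hls, fun i hi => by rw [← hb' i, if_pos hi]⟩
  have hmem : ∀ e i, i ∈ (a e).support.filter (fun i => (γ i).r = e) ↔ (γ i).r = e := fun e i =>
    ⟨fun h => (Finset.mem_filter.1 h).2, fun h => by subst h; exact (key i).1⟩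
  have hfin : ∀ e, {i | (γ i).r = e}.Finite := fun e =>
    ((a e).support.filter (fun i => (γ i).r = e)).finite_toSet.subset fun i hi => (hmem e i).2 hi
  refine ⟨I, γ, x, y, fun i => (hγ i).1, hxm, hy, fun i => (h.1 _ (hγ i).1).1, fun i => ?_,
    fun i j hij => ?_, hfin, fun e => ?_⟩
  · rw [(key i).2 i (key i).1, if_pos rfl]
  · by_cases hr : (γ i).r = (γ j).r
    · rw [(key j).2 i ((hmem _ i).2 hr), if_neg hij]
    · exact mul_eq_zero_of_ne (γ := (γ i).inv) hr (hy i) (hxm j)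
  · rw [← hsum e]
    exact Finset.sum_congr (Finset.ext fun i => by
      rw [hmem, Set.Finite.mem_toFinset]; rfl) fun _ _ => rfl

end GrRing

end GroupoidGraded

end

noncomputable section

namespace GroupoidGraded

theorem Mor.mul_conj {Γ : Type v} [Groupoid.{w} Γ] {σ γ τ : Mor Γ} (h : γ.r = σ.r)
    (h' : γ.d = τ.r) :
    (σ.mul ((σ.inv.mul γ h.symm).mul τ h') rfl).mul τ.inv rfl = γ := by
  obtain ⟨a, b, g⟩ := σ
  obtain ⟨c, b', g'⟩ := γ
  obtain ⟨c', b'', g''⟩ := τ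
  simp only at h h'
  subst h h'
  simp [mul, inv]

namespace GrRing

variable {Γ : Type v} [Groupoid.{w} Γ] {R : GrRing.{u} Γ}

theorem map_mem_iSup {X : Type*} [AddCommGroup X] (φ : R →+ X) {A : Mor Γ → AddSubgroup X}
    (h : ∀ γ, ∀ a ∈ R.comp γ, φ a ∈ A γ) (a : R) : φ a ∈ ⨆ γ, A γ := by
  induction a using homogeneous_induction R.isInternal with
  | hom γ a ha => exact AddSubgroup.mem_iSup_of_mem γ (h γ a ha)
  | zero => rw [map_zero]; exact zero_mem _
  | add x y hx hy => rw [map_add]; exact add_mem hx hy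

theorem mem_compAt₃_corner {f : Γ} {σ δ τ : Mor Γ} (hσ : σ.d = f) (hτ : τ.d = f)
    {b : R.corner f} (h1 : σ.r = δ.r) (h2 : δ.d = τ.r) :
    b ∈ compAt₃ (R.corner f).comp σ.inv δ τ.inv ↔
      R.cornerIncl f b ∈ R.comp ((σ.inv.mul δ h1).mul τ h2) := by
  rw [mem_compAt₃ (σ := σ.inv) (τ := τ.inv) h1 h2, mem_corner_comp,
    mem_cornerComp (γ := Mor.mul (Mor.mul σ.inv δ h1) τ.inv.inv h2) ⟨hτ, hσ⟩]
  simp only [Mor.inv_inv]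

/-! ### Matrix coordinates with respect to a dual basis -/

namespace IsDualBasis

variable {I : Type u} {γ : I → Mor Γ} {x y : I → R} (h : R.IsDualBasis γ x y)

include h

theorem one_mul_y (i : I) : R.one (γ i).d * y i = y i :=
  one_mul_of_r (γ := (γ i).inv) rfl (h.y_mem i)

theorem x_mul_one (i : I) : x i * R.one (γ i).d = x i := R.mul_one (h.x_mem i)

theorem y_mul_eq_zero {δ : Mor Γ} {a : R} (ha : a ∈ R.comp δ) {k : I} (hk : (γ k).r ≠ δ.r) :
    y k * a = 0 := mul_eq_zero_of_ne (γ := (γ k).inv) hk (h.y_mem k) ha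

theorem mul_x_eq_zero {δ : Mor Γ} {a : R} (ha : a ∈ R.comp δ) {l : I} (hl : (γ l).r ≠ δ.d) :
    a * x l = 0 := mul_eq_zero_of_ne hl.symm ha (h.x_mem l)

theorem eq_of_ne_zero {δ : Mor Γ} {a : R} (ha : a ∈ R.comp δ) {k l : I}
    (h0 : y k * a * x l ≠ 0) : (γ k).r = δ.r ∧ δ.d = (γ l).r := by
  refine ⟨?_, ?_⟩ <;> by_contra hne <;> apply h0
  · rw [h.y_mul_eq_zero ha hne, zero_mul]
  · rw [mul_assoc, h.mul_x_eq_zero ha (Ne.symm hne), mul_zero]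

theorem finite_entries (a : R) : {p : I × I | y p.1 * a * x p.2 ≠ 0}.Finite := by
  induction a using homogeneous_induction R.isInternal with
  | hom δ a ha =>
    refine ((h.finite δ.r).prod (h.finite δ.d)).subset fun p hp => ?_
    obtain ⟨h1, h2⟩ := h.eq_of_ne_zero ha hp
    exact ⟨h1, h2.symm⟩
  | zero => simp
  | add a b ha hb =>
    refine (ha.union hb).subset fun p hp => ?_
    by_contra hp'
    simp only [Set.mem_union, Set.mem_ofPred_eq, not_or, not_not] at hp'
    exact hp (by rw [mul_add, add_mul, hp'.1, hp'.2, add_zero])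

theorem dFinite {J : Type u} (c : I → J) (j : J) :
    DFinite fun k : {i // c i = j} => (γ k).inv :=
  fun e => (h.finite e).preimage Subtype.val_injective.injOn

/-- Both local identities of `a` are replaced by their expansions `∑ x_k y_k`, so `a` is recovered
from its matrix entries. -/
theorem sum_sum_eq {δ : Mor Γ} {a : R} (ha : a ∈ R.comp δ) :
    ∑ k ∈ (h.finite δ.r).toFinset, ∑ l ∈ (h.finite δ.d).toFinset,
      x k * (y k * a * x l) * y l = a := by
  conv_rhs => rw [← R.mul_one ha, ← R.one_mul ha, ← h.sum_eq δ.r, ← h.sum_eq δ.d,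
    Finset.sum_mul, Finset.sum_mul]
  refine Finset.sum_congr rfl fun k _ => ?_
  rw [Finset.mul_sum]
  exact Finset.sum_congr rfl fun l _ => by simp only [mul_assoc]

theorem summable_matrix {J : Type u} (f : J → Γ) (c : I → J) :
    Summable fun j => (R.corner (f j)).matrix (fun k : {i // c i = j} => (γ k).inv)
      (h.dFinite c j) := by
  rw [summable_iff]
  intro e
  refine ((h.finite e).image c).subset fun j hj => ?_
  by_contra hj'
  exact hj (matrix_one_eq_zero fun k hk => hj' ⟨k, hk, k.2⟩)

variable {J : Type u} {f : J → Γ} {c : I → J} (hd : ∀ i, (γ i).d = f (c i))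

include hd

theorem one_mul_y' {j : J} (k : {i // c i = j}) : R.one (f j) * y k = y k := by
  rw [show f j = (γ k).d from (congrArg f k.2.symm).trans (hd k).symm, h.one_mul_y]

theorem x_mul_one' {j : J} (k : {i // c i = j}) : x k * R.one (f j) = x k := by
  rw [show f j = (γ k).d from (congrArg f k.2.symm).trans (hd k).symm, h.x_mul_one]

/-- The matrix with entries `y_k a x_l`. -/
def entries (h : R.IsDualBasis γ x y) (_ : ∀ i, (γ i).d = f (c i)) (j : J) :
    R →+ FinMatrix {i // c i = j} (R.corner (f j)) :=
  AddMonoidHom.mk' (fun a => ⟨fun k l => R.toCorner (f j) (y k * a * x l),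
    ((h.finite_entries a).preimage (f := Prod.map Subtype.val Subtype.val)
      (Subtype.val_injective.prodMap Subtype.val_injective).injOn).subset fun p hp h0 =>
        hp (by
          change y p.1 * a * x p.2 = 0 at h0
          change R.toCorner (f j) (y p.1 * a * x p.2) = 0
          rw [h0, map_zero])⟩) fun a b => by
    ext k l
    change R.toCorner (f j) (y k * (a + b) * x l) =
      R.toCorner (f j) (y k * a * x l) + R.toCorner (f j) (y k * b * x l)
    rw [← map_add, mul_add, add_mul]

theorem cornerIncl_entries (j : J) (a : R) (k l : {i // c i = j}) :
    R.cornerIncl (f j) ((h.entries hd j a).1 k l) = y k * a * x l :=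
  cornerIncl_toCorner (by rw [← mul_assoc, ← mul_assoc, h.one_mul_y' hd])
    (by rw [mul_assoc, h.x_mul_one' hd])

theorem entries_mem (j : J) {δ : Mor Γ} {a : R} (ha : a ∈ R.comp δ) (k l : {i // c i = j}) :
    (h.entries hd j a).1 k l ∈ compAt₃ (R.corner (f j)).comp (γ k).inv δ (γ l).inv := by
  by_cases h0 : y k * a * x l = 0
  · rw [← h.cornerIncl_entries hd, ← map_zero (R.cornerIncl (f j))] at h0
    rw [cornerIncl_injective h0]
    exact zero_mem _
  obtain ⟨h1, h2⟩ := h.eq_of_ne_zero ha h0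
  rw [mem_compAt₃_corner ((hd _).trans (congrArg f k.2)) ((hd _).trans (congrArg f l.2)) h1 h2,
    h.cornerIncl_entries hd]
  exact mul_mem_mul _ (mul_mem_mul _ (h.y_mem k) ha) (h.x_mem l)

variable (hf : ∀ j j', j ≠ j' → ∀ a, R.one (f j) * a * R.one (f j') = 0)

include hf

theorem y_mul_mul_x_eq_zero {k l : I} (hkl : c k ≠ c l) (a : R) : y k * a * x l = 0 := by
  rw [← h.one_mul_y' hd ⟨k, rfl⟩, ← h.x_mul_one' hd ⟨l, rfl⟩]
  have := hf _ _ hkl (y k * a * x l)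
  simpa only [mul_assoc] using this

/-- Inserting `1 = ∑ x_m y_m` between `a` and `b` gives the matrix product. The terms with `m`
outside the block `j` vanish because distinct representatives `f j` are not linked. -/
theorem entries_mul (j : J) (a b : R) :
    h.entries hd j (a * b) = h.entries hd j a * h.entries hd j b := by
  classical
  induction a using homogeneous_induction R.isInternal with
  | zero => rw [zero_mul, map_zero, zero_mul]
  | add x y hx hy => rw [add_mul, map_add, map_add, add_mul, hx, hy]
  | hom δ a ha =>
    ext k l
    apply cornerIncl_injective
    rw [h.cornerIncl_entries hd, FinMatrix.mul_apply_sum _ _ k l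
      ((h.finite δ.d).toFinset.subtype fun i => c i = j), map_sum]
    · simp only [map_mul, h.cornerIncl_entries hd]
      rw [Finset.sum_subtype_eq_sum_filter (f := fun m => y k * a * x m * (y m * b * x l)),
        Finset.sum_filter_of_ne]
      · conv_lhs => rw [← R.mul_one ha, ← h.sum_eq]
        simp only [Finset.mul_sum, Finset.sum_mul, mul_assoc]
      · intro m _ hm
        by_contra hmj
        apply hm
        rw [h.y_mul_mul_x_eq_zero hd hf (fun h' => hmj (h'.symm.trans k.2)), zero_mul]
    · intro m hm
      rw [Finset.mem_subtype, Set.Finite.mem_toFinset]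
      refine (h.eq_of_ne_zero (k := k) (l := m) ha fun h0 => hm (cornerIncl_injective ?_)).2.symm
      rw [h.cornerIncl_entries hd, h0, map_zero]

/-- The homomorphism from `R` to a matrix ring over a corner ring, with entries `y_k a x_l`. -/
def toMatrix (h : R.IsDualBasis γ x y) (hd : ∀ i, (γ i).d = f (c i))
    (hf : ∀ j j', j ≠ j' → ∀ a, R.one (f j) * a * R.one (f j') = 0) (j : J) :
    R →ₙ+* (R.corner (f j)).matrix (fun k : {i // c i = j} => (γ k).inv) (h.dFinite c j) where
  toFun a := ⟨h.entries hd j a, map_mem_iSup (A := matrixComp _ _) _ (fun _ _ ha => h.entries_mem hd j ha) a⟩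
  map_mul' a b := matrixIncl_injective (h.entries_mul hd hf j a b)
  map_zero' := matrixIncl_injective (h.entries hd j).map_zero
  map_add' a b := matrixIncl_injective ((h.entries hd j).map_add a b)

theorem matrixIncl_toMatrix (j : J) (a : R) :
    matrixIncl _ _ _ (h.toMatrix hd hf j a) = h.entries hd j a := rfl

theorem toMatrix_mem (j : J) {δ : Mor Γ} {a : R} (ha : a ∈ R.comp δ) :
    h.toMatrix hd hf j a ∈ ((R.corner (f j)).matrix (fun k : {i // c i = j} => (γ k).inv)
      (h.dFinite c j)).comp δ :=
  mem_matrix_comp.2 (h.entries_mem hd j ha)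

/-- The homomorphism from `R` to a product of matrix rings over corner rings. -/
def toProd (h : R.IsDualBasis γ x y) (hd : ∀ i, (γ i).d = f (c i))
    (hf : ∀ j j', j ≠ j' → ∀ a, R.one (f j) * a * R.one (f j') = 0) :
    R →ₙ+* prod fun j => (R.corner (f j)).matrix (fun k : {i // c i = j} => (γ k).inv)
      (h.dFinite c j) where
  toFun a := ⟨fun j => h.toMatrix hd hf j a, map_mem_iSup (AddMonoidHom.mk'
    (fun a j => h.toMatrix hd hf j a) fun a b => funext fun _ => map_add _ a b)
    (fun _ _ ha => (mem_prodComp _).2 fun j => h.toMatrix_mem hd hf j ha) a⟩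
  map_mul' a b := prod_ext fun j => map_mul (h.toMatrix hd hf j) a b
  map_zero' := prod_ext fun j => map_zero (h.toMatrix hd hf j)
  map_add' a b := prod_ext fun j => map_add (h.toMatrix hd hf j) a b

theorem prodEval_toProd (j : J) (a : R) :
    prodEval _ j (h.toProd hd hf a) = h.toMatrix hd hf j a := rfl

/-- Injectivity is the reconstruction `sum_sum_eq`, where entries between different blocks vanish by
`hf`. A block matrix with entries `b k l` comes from `∑ x_k b_{kl} y_l`, by duality. -/
theorem iso_prod_matrix :
    R.Iso (prod fun j => (R.corner (f j)).matrix (fun k : {i // c i = j} => (γ k).inv)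
      (h.dFinite c j)) := by
  classical
  refine iso_of_hom (h.toProd hd hf)
    (fun δ a ha => mem_prod_comp.2 fun j => h.toMatrix_mem hd hf j ha)
    (fun δ a ha h0 => ?_) (fun δ B hB => ?_)
  · rw [← h.sum_sum_eq ha]
    refine Finset.sum_eq_zero fun k _ => Finset.sum_eq_zero fun l _ => ?_
    suffices y k * a * x l = 0 by rw [this, mul_zero, zero_mul]
    by_cases hkl : c k = c l
    · rw [← h.cornerIncl_entries hd (c k) a ⟨k, rfl⟩ ⟨l, hkl.symm⟩,
        ← h.matrixIncl_toMatrix hd hf, ← h.prodEval_toProd hd hf, h0, map_zero, map_zero]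
      exact map_zero _
    · exact h.y_mul_mul_x_eq_zero hd hf hkl a
  · have hB' := fun j => mem_matrix_comp.1 (mem_prod_comp.1 hB j)
    -- The blocks of `B` are assembled into one matrix indexed by `I`, with zero entries between
    -- different blocks.
    let b : I → I → R := fun k l => if hc : c l = c k then
      R.cornerIncl _ ((matrixIncl _ _ _ (prodEval _ (c k) B)).1 ⟨k, rfl⟩ ⟨l, hc⟩) else 0
    have hb : ∀ k l, b k l ≠ 0 → ∃ (h1 : (γ k).r = δ.r) (h2 : δ.d = (γ l).r),
        b k l ∈ R.comp (((γ k).inv.mul δ h1).mul (γ l) h2) := by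
      intro k l h0
      by_cases hc : c l = c k
      swap
      · exact absurd (dif_neg hc) h0
      have hbe : b k l = R.cornerIncl _
        ((matrixIncl _ _ _ (prodEval _ (c k) B)).1 ⟨k, rfl⟩ ⟨l, hc⟩) := dif_pos hc
      have hm := hB' (c k) ⟨k, rfl⟩ ⟨l, hc⟩
      obtain ⟨h1, h2⟩ := eq_of_mem_compAt₃ hm fun h' => h0 (by rw [hbe, h', map_zero])
      refine ⟨h1, h2, ?_⟩
      rw [hbe, ← mem_compAt₃_corner (hd k) ((hd l).trans (congrArg f hc)) h1 h2]
      exact hm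
    refine ⟨∑ k ∈ (h.finite δ.r).toFinset, ∑ l ∈ (h.finite δ.d).toFinset, x k * b k l * y l,
      sum_mem fun k _ => sum_mem fun l _ => ?_, prod_ext fun j => matrixIncl_injective ?_⟩
    · by_cases h0 : b k l = 0
      · rw [h0, mul_zero, zero_mul]; exact zero_mem _
      obtain ⟨h1, h2, h3⟩ := hb k l h0
      have h4 : x k * b k l ∈ R.comp ((γ k).mul (((γ k).inv.mul δ h1).mul (γ l) h2) rfl) :=
        mul_mem_mul _ (h.x_mem k) h3
      have := mul_mem_mul (γ := (γ k).mul (((γ k).inv.mul δ h1).mul (γ l) h2) rfl)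
        (δ := (γ l).inv) rfl h4 (h.y_mem l)
      rwa [Mor.mul_conj h1.symm h2] at this
    · rw [h.prodEval_toProd hd hf, h.matrixIncl_toMatrix hd hf]
      ext ⟨k, hk⟩ ⟨l, hl⟩
      apply cornerIncl_injective
      rw [h.cornerIncl_entries hd]
      subst hk
      have hbe : b k l = R.cornerIncl _
        ((matrixIncl _ _ _ (prodEval _ (c k) B)).1 ⟨k, rfl⟩ ⟨l, hl⟩) := dif_pos hl
      rw [← hbe]
      -- Duality leaves only the term with `k' = k` and `l' = l`.
      have hterm : ∀ k' l', y k * (x k' * b k' l' * y l') * x l =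
          if k = k' then (if l' = l then b k l else 0) else 0 := by
        intro k' l'
        have : y k * (x k' * b k' l' * y l') * x l = (y k * x k') * b k' l' * (y l' * x l) := by
          simp only [mul_assoc]
        rw [this]
        split_ifs with hk hl
        · subst hk hl
          by_cases h0 : b k l' = 0
          · rw [h0, mul_zero, zero_mul]
          obtain ⟨h1, h2, h3⟩ := hb k l' h0
          rw [h.y_mul_x, h.y_mul_x, one_mul_of_r rfl h3, mul_one_of_d rfl h3]
        · rw [h.y_mul_x_ne _ _ hl, mul_zero]
        · rw [h.y_mul_x_ne _ _ hk, zero_mul, zero_mul]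
      simp only [Finset.mul_sum, Finset.sum_mul, hterm]
      by_cases h0 : b k l = 0
      · simp [h0]
      obtain ⟨h1, h2, h3⟩ := hb k l h0
      rw [Finset.sum_eq_single k, Finset.sum_eq_single l]
      · simp
      · intro m _ hm; simp [hm]
      · intro hm; exact absurd ((h.finite δ.d).mem_toFinset.2 h2.symm) hm
      · intro m _ hm
        exact Finset.sum_eq_zero fun _ _ => if_neg hm.symm
      · intro hm; exact absurd ((h.finite δ.r).mem_toFinset.2 h1) hm

end IsDualBasis

end GrRing

end GroupoidGraded

end

noncomputable section

namespace GroupoidGraded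

variable {Γ : Type v} [Groupoid.{w} Γ]

theorem isInternal_comp_inv {G : Type u} [AddCommGroup G] {A : Mor Γ → AddSubgroup G}
    (hA : DirectSum.IsInternal A) : DirectSum.IsInternal fun γ : Mor Γ => A γ.inv := by
  rw [isInternal_iff] at hA ⊢
  refine ⟨hA.1.reindex _ (fun _ => True) Mor.inv (fun _ _ _ _ h => Mor.inv_injective h)
    (fun _ _ => le_rfl) (fun _ h => absurd trivial h), eq_top_iff.2 ?_⟩
  rw [← hA.2]
  refine iSup_le fun γ => ?_
  have := le_iSup (fun γ : Mor Γ => A γ.inv) γ.inv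
  rwa [Mor.inv_inv] at this

theorem compAt_inv {G : Type u} [AddCommGroup G] (A : Mor Γ → AddSubgroup G) (σ τ : Mor Γ) :
    compAt (fun γ => A γ.inv) σ τ = compAt A τ.inv σ.inv := by
  by_cases h : σ.d = τ.r
  · ext x
    rw [mem_compAt h, mem_compAt (σ := τ.inv) (τ := σ.inv) h.symm, Mor.mul_inv_rev]
  · rw [compAt_of_ne h, compAt_of_ne (σ := τ.inv) (τ := σ.inv) (Ne.symm h)]

namespace GrRing

variable {R : GrRing.{u} Γ}

/-! ## Left modules as right modules over the opposite ring -/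

/-- A correspondence between a left `R`-module and a right module over the opposite ring. -/
structure IsOpModule (L : GrLeftMod.{u, u} R) (M : GrMod.{u, u} R.op) (φ : L ≃+ M) : Prop where
  act : ∀ a m, φ (L.act a m) = M.act (φ m) (R.toOp a)
  deg : ∀ γ m, φ m ∈ M.comp γ ↔ m ∈ L.comp γ.inv

namespace IsOpModule

variable {L : GrLeftMod.{u, u} R} {M : GrMod.{u, u} R.op} {φ : L ≃+ M} (h : IsOpModule L M φ)

include h

theorem symm_act (m : M) (a : R.op) :
    φ.symm (M.act m a) = L.act (R.toOp.symm a) (φ.symm m) := by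
  rw [AddEquiv.symm_apply_eq, h.act, AddEquiv.apply_symm_apply, AddEquiv.apply_symm_apply]

theorem isUnital_iff : L.IsUnital ↔ M.IsUnital := by
  have hS : {x | ∃ m a, x = M.act m a} = φ.toAddMonoidHom '' {x | ∃ a m, x = L.act a m} := by
    ext x
    constructor
    · rintro ⟨m, a, rfl⟩
      refine ⟨_, ⟨R.toOp.symm a, φ.symm m, rfl⟩, ?_⟩
      rw [← h.symm_act]
      exact φ.apply_symm_apply _
    · rintro ⟨_, ⟨a, m, rfl⟩, rfl⟩
      exact ⟨φ m, R.toOp a, h.act a m⟩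
  have htop : (⊤ : AddSubgroup L).map φ.toAddMonoidHom = ⊤ :=
    AddSubgroup.map_top_of_surjective φ.toAddMonoidHom φ.surjective
  rw [GrLeftMod.IsUnital, GrMod.IsUnital, hS, ← AddMonoidHom.map_closure, ← htop]
  exact (AddSubgroup.map_injective (f := φ.toAddMonoidHom) φ.injective).eq_iff.symm

/-- The coefficient conditions correspond because `r(γ_i⁻¹) = d(γ_i)` and passing to the opposite
ring moves the identity to the other side. -/
theorem isPseudoBasis_iff {I : Type u} {γ : I → Mor Γ} {x : I → L} :
    L.IsPseudoBasis (fun i => (γ i).inv) x ↔ M.IsPseudoBasis γ fun i => φ (x i) := by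
  refine and_congr (forall_congr' fun i => (h.deg _ _).symm) (and_congr ⟨fun H N hN hx => ?_,
    fun H N hN hx => ?_⟩ ⟨fun H a ha h0 => ?_, fun H a ha h0 => ?_⟩)
  · have := H (N.comap φ.toAddMonoidHom) (fun a n hn => by
      change φ _ ∈ N
      rw [h.act]
      exact hN _ hn _) hx
    rw [eq_top_iff]
    rintro m -
    have hm : φ.symm m ∈ N.comap φ.toAddMonoidHom := by rw [this]; trivial
    have hm' : φ (φ.symm m) ∈ N := hm
    rwa [AddEquiv.apply_symm_apply] at hm'
  · have := H (N.comap φ.symm.toAddMonoidHom) (fun n hn a => by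
      change φ.symm _ ∈ N
      rw [h.symm_act]
      exact hN _ _ hn) (fun i => by
        change φ.symm (φ (x i)) ∈ N
        rw [AddEquiv.symm_apply_apply]
        exact hx i)
    rw [eq_top_iff]
    rintro m -
    have hm : φ m ∈ N.comap φ.symm.toAddMonoidHom := by rw [this]; trivial
    have hm' : φ.symm (φ m) ∈ N := hm
    rwa [AddEquiv.symm_apply_apply] at hm'
  · have := H (a.mapRange R.toOp.symm (map_zero _)) (fun i => by
      obtain ⟨b, hb⟩ := ha i
      refine ⟨R.toOp.symm b, R.toOp.injective ?_⟩
      rw [Finsupp.mapRange_apply, AddEquiv.apply_symm_apply, hb, toOp_mul,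
        AddEquiv.apply_symm_apply, op_one]) (by
        apply φ.injective
        rw [Finsupp.sum_mapRange_index (fun i => by rw [map_zero]; rfl), Finsupp.sum, map_sum,
          map_zero, ← h0]
        exact Finset.sum_congr rfl fun i _ => by rw [h.act, AddEquiv.apply_symm_apply])
    ext i
    have hi := DFunLike.congr_fun this i
    rw [Finsupp.mapRange_apply, Finsupp.zero_apply, ← map_zero R.toOp.symm] at hi
    exact R.toOp.symm.injective hi
  · have := H (a.mapRange R.toOp (map_zero _)) (fun i => by
      obtain ⟨b, hb⟩ := ha i
      refine ⟨R.toOp b, ?_⟩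
      rw [Finsupp.mapRange_apply, hb, toOp_mul, op_one]) (by
        rw [Finsupp.sum_mapRange_index (fun i => by rw [map_zero]), ← map_zero φ, ← h0,
          Finsupp.sum, Finsupp.sum, map_sum]
        exact Finset.sum_congr rfl fun i _ => (h.act _ _).symm)
    ext i
    have hi := DFunLike.congr_fun this i
    rw [Finsupp.mapRange_apply, Finsupp.zero_apply, ← map_zero R.toOp] at hi
    exact R.toOp.injective hi

theorem isPseudoFree_iff : L.IsPseudoFree ↔ M.IsPseudoFree := by
  constructor
  · rintro ⟨I, γ, x, hx⟩
    refine ⟨I, fun i => (γ i).inv, fun i => φ (x i), h.isPseudoBasis_iff.1 ?_⟩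
    simpa only [Mor.inv_inv] using hx
  · rintro ⟨I, γ, x, hx⟩
    refine ⟨I, fun i => (γ i).inv, fun i => φ.symm (x i), h.isPseudoBasis_iff.2 ?_⟩
    simpa only [AddEquiv.apply_symm_apply] using hx

end IsOpModule

theorem exists_isOpModule_of_left (L : GrLeftMod.{u, u} R) :
    ∃ (M : GrMod.{u, u} R.op) (φ : L ≃+ M), IsOpModule L M φ :=
  ⟨{ carrier := L
     act := (L.act.comp R.toOp.symm.toAddMonoidHom).flip
     act_mul := fun m a b => (L.mul_act (R.toOp.symm b) (R.toOp.symm a) m).symm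
     comp := fun γ => L.comp γ.inv
     isInternal := isInternal_comp_inv L.isInternal
     act_mem := fun {σ τ m a} hm ha => by
      rw [compAt_inv]
      exact L.act_mem (σ := τ.inv) (τ := σ.inv) ha hm },
    AddEquiv.refl L, fun _ _ => rfl, fun _ _ => Iff.rfl⟩

theorem exists_isOpModule_of_right (M : GrMod.{u, u} R.op) :
    ∃ (L : GrLeftMod.{u, u} R) (φ : L ≃+ M), IsOpModule L M φ :=
  ⟨{ carrier := M
     act := M.act.flip.comp R.toOp.toAddMonoidHom
     mul_act := fun a b m => (M.act_mul m (R.toOp b) (R.toOp a)).symm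
     comp := fun γ => M.comp γ.inv
     isInternal := isInternal_comp_inv M.isInternal
     act_mem := fun {σ τ a m} ha hm => by
      rw [compAt_inv]
      exact M.act_mem (σ := τ.inv) (τ := σ.inv) hm (toOp_mem_inv.2 ha) },
    AddEquiv.refl M, fun _ _ => rfl, fun γ m => by
      change m ∈ M.comp γ ↔ m ∈ M.comp γ.inv.inv
      rw [Mor.inv_inv]⟩

theorem isLeftPfm_iff_op : R.IsLeftPfm ↔ R.op.IsPfm := by
  refine ⟨fun H M hM => ?_, fun H L hL => ?_⟩
  · obtain ⟨L, φ, h⟩ := exists_isOpModule_of_right M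
    exact h.isPseudoFree_iff.1 (H L (h.isUnital_iff.2 hM))
  · obtain ⟨M, φ, h⟩ := exists_isOpModule_of_left L
    exact h.isPseudoFree_iff.2 (H M (h.isUnital_iff.1 hL))

/-- Both sides say that some `Δ` is simply generating, a condition shared by `R` and its opposite.
-/
theorem isPfm_iff_isLeftPfm : R.IsPfm ↔ R.IsLeftPfm := by
  rw [isLeftPfm_iff_op, isPfm_iff, isPfm_iff]
  exact exists_congr fun _ => simplyGen_op.symm

/-! ## Left ideals as right ideals of the opposite ring -/

theorem op_pr (γ : Mor Γ) (a : R) : R.op.pr γ (R.toOp a) = R.toOp (R.pr γ.inv a) := by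
  induction a using homogeneous_induction R.isInternal with
  | hom δ a ha =>
    by_cases h : γ.inv = δ
    · subst h
      rw [pr, pr, proj_same _ ha, proj_same _ (toOp_mem.2 ha)]
    · rw [pr, pr, proj_ne R.isInternal ha (Ne.symm h), map_zero,
        proj_ne R.op.isInternal (toOp_mem_inv.2 ha) fun h' => h (by rw [← h', Mor.inv_inv])]
  | zero => simp only [map_zero]
  | add x y hx hy => rw [map_add, map_add, map_add, map_add, hx, hy]

theorem graded_op_iff {N : AddSubgroup R.op} :
    (N = ⨆ γ, N ⊓ R.op.comp γ) ↔ N.comap R.toOp.toAddMonoidHom =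
      ⨆ γ, N.comap R.toOp.toAddMonoidHom ⊓ R.comp γ := by
  rw [graded_iff R.isInternal, graded_iff R.op.isInternal]
  constructor
  · intro h n hn γ
    have := h _ hn γ.inv
    change R.op.pr γ.inv (R.toOp n) ∈ N at this
    rwa [op_pr, Mor.inv_inv] at this
  · intro h n hn γ
    obtain ⟨n, rfl⟩ := R.toOp.surjective n
    change R.op.pr γ (R.toOp n) ∈ N
    rw [op_pr]
    exact h n hn γ.inv

theorem isGrRightIdeal_op_iff {N : AddSubgroup R.op} :
    R.op.IsGrRightIdeal N ↔ R.IsGrLeftIdeal (N.comap R.toOp.toAddMonoidHom) :=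
  and_congr ⟨fun h a _ hx => h _ hx (R.toOp a), fun h _ hn a => h (R.toOp.symm a) _ hn⟩
    graded_op_iff

theorem isGrIdeal_op_iff {N : AddSubgroup R.op} :
    R.op.IsGrIdeal N ↔ R.IsGrIdeal (N.comap R.toOp.toAddMonoidHom) :=
  and_congr ⟨fun h a _ hx => (h (R.toOp a) _ hx).symm,
    fun h a _ hn => (h (R.toOp.symm a) _ hn).symm⟩ graded_op_iff

theorem comap_toOp_injective : Function.Injective
    (AddSubgroup.comap R.toOp.toAddMonoidHom : AddSubgroup R.op → AddSubgroup R) :=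
  AddSubgroup.comap_injective (f := R.toOp.toAddMonoidHom) R.toOp.surjective

theorem IsGrSimple.op (h : R.IsGrSimple) : R.op.IsGrSimple := by
  obtain ⟨h1, h2⟩ := h
  refine ⟨R.toOp.symm.toEquiv.nontrivial, fun I hI => ?_⟩
  refine (h2 _ (isGrIdeal_op_iff.1 hI)).imp (fun h => ?_) fun h => ?_
  · refine comap_toOp_injective (h.trans ?_)
    exact ((AddMonoidHom.ker_eq_bot_iff (f := R.toOp.toAddMonoidHom)).2 R.toOp.injective).symm
  · exact comap_toOp_injective (h.trans (AddSubgroup.comap_top _).symm)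

theorem IsDivisionRingAt.op {f : Γ} (h : R.IsDivisionRingAt f) : R.op.IsDivisionRingAt f := by
  have hid : (Mor.id f).inv = Mor.id f := by simp [Mor.inv, Mor.id]
  have hm : ∀ a, R.toOp a ∈ R.op.comp (Mor.id f) ↔ a ∈ R.comp (Mor.id f) := fun a => by
    rw [toOp_mem, hid]
  rw [IsDivisionRingAt, op_one]
  refine ⟨fun h0 => h.1 (R.toOp.map_eq_zero_iff.1 h0), fun a ha h0 => ?_⟩
  obtain ⟨a, rfl⟩ := R.toOp.surjective a
  obtain ⟨b, hb, hab, hba⟩ := h.2 a ((hm a).1 ha) fun h' => h0 (by rw [h', map_zero])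
  exact ⟨R.toOp b, (hm b).2 hb, by rw [← toOp_mul, hba], by rw [← toOp_mul, hab]⟩

theorem mem_iSup_compAt_id {e : Γ} {x : R} :
    x ∈ ⨆ γ, compAt R.comp γ (Mor.id e) ↔ x * R.one e = x := by
  constructor
  · intro hx
    induction hx using AddSubgroup.iSup_induction' with
    | hp γ x hx =>
      by_cases h : γ.d = e
      · rw [mem_compAt h, Mor.mul_id] at hx
        exact mul_one_of_d h hx
      · rw [compAt_of_ne h, AddSubgroup.mem_bot] at hx
        rw [hx, zero_mul]
    | h1 => rw [zero_mul]
    | hadd x y _ _ hx hy => rw [add_mul, hx, hy]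
  · intro hx
    rw [← hx]
    clear hx
    induction x using homogeneous_induction R.isInternal with
    | hom γ x hx => exact AddSubgroup.mem_iSup_of_mem γ (R.mul_mem hx (R.one_mem e))
    | zero => rw [zero_mul]; exact zero_mem _
    | add x y hx hy => rw [add_mul]; exact add_mem hx hy

theorem isLeftGammaArtinian_iff : R.IsLeftGammaArtinian ↔ R.op.RArt := by
  refine forall_congr' fun e => ?_
  have key : ∀ N : AddSubgroup R.op, (R.op.IsGrRightIdeal N ∧ N ≤ R.op.rightPart e) ↔
      R.IsGrLeftIdeal (N.comap R.toOp.toAddMonoidHom) ∧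
        N.comap R.toOp.toAddMonoidHom ≤ ⨆ γ, compAt R.comp γ (Mor.id e) := by
    refine fun N => and_congr isGrRightIdeal_op_iff ?_
    have hmem : ∀ x, R.toOp x ∈ R.op.rightPart e ↔ x ∈ ⨆ γ, compAt R.comp γ (Mor.id e) := by
      intro x
      rw [mem_rightPart, mem_iSup_compAt_id, op_one, ← toOp_mul, R.toOp.injective.eq_iff]
    exact ⟨fun h x hx => (hmem x).1 (h hx), fun h x hx => by
      obtain ⟨x, rfl⟩ := R.toOp.surjective x
      exact (hmem x).2 (h hx)⟩
  constructor
  · intro H C hC hanti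
    obtain ⟨n, hn⟩ := H (fun n => (C n).comap R.toOp.toAddMonoidHom) (fun n => (key _).1 (hC n))
      fun a b hab => AddSubgroup.comap_mono (hanti hab)
    exact ⟨n, fun m hm => comap_toOp_injective (hn m hm)⟩
  · intro H C hC hanti
    have hcomap : ∀ N : AddSubgroup R, (N.comap R.toOp.symm.toAddMonoidHom).comap
        R.toOp.toAddMonoidHom = N := fun N => rfl
    obtain ⟨n, hn⟩ := H (fun n => (C n).comap R.toOp.symm.toAddMonoidHom)
      (fun n => (key _).2 (by rw [hcomap]; exact hC n))
      fun a b hab => AddSubgroup.comap_mono (hanti hab)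
    exact ⟨n, fun m hm => by rw [← hcomap (C m), hn m hm, hcomap]⟩

end GrRing

end GroupoidGraded

end

noncomputable section

namespace GroupoidGraded

namespace GrRing

variable {Γ : Type v} [Groupoid.{w} Γ] {R : GrRing.{u} Γ}

/-! ## Matrix decompositions -/

section DualBasis

variable {I : Type u} {γ : I → Mor Γ} {x y : I → R}

theorem IsDualBasis.x_ne_zero (h : R.IsDualBasis γ x y) (i : I) : x i ≠ 0 := fun h0 =>
  h.one_ne_zero i (by rw [← h.y_mul_x, h0, mul_zero])

/-- Some index has range `g`, as `1_g = ∑ x_i y_i` is nonzero. If `i ≠ i'` both had it, then `x_i b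
= 1_g` and `y_{i'} = y_{i'} x_i b = 0`, contradicting `y_{i'} x_{i'} ≠ 0`. -/
theorem IsDualBasis.existsUnique (h : R.IsDualBasis γ x y) {g : Γ} (hg : R.RSimple g) :
    ∃! i, (γ i).r = g := by
  refine existsUnique_of_exists_of_unique ?_ fun i i' hi hi' => ?_
  · by_contra! H
    refine hg.1 ((h.sum_eq g).symm.trans (Finset.sum_eq_zero fun i hi => ?_))
    exact absurd ((h.finite g).mem_toFinset.1 hi) (H i)
  · by_contra hne
    obtain ⟨b, hb⟩ := hg.2 _ hi _ (h.x_mem i) (h.x_ne_zero i)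
    have h0 : y i' = 0 := by
      rw [← mul_one_of_d (γ := (γ i').inv) hi' (h.y_mem i'), ← hb, ← mul_assoc,
        h.y_mul_x_ne _ _ (Ne.symm hne), zero_mul]
    exact h.one_ne_zero i' (by rw [← h.y_mul_x, h0, zero_mul])

theorem IsDualBasis.eq_of_r_eq (h : R.IsDualBasis γ x y) {J : Type u} {f : J → Γ} {c : I → J}
    (hd : ∀ i, (γ i).d = f (c i))
    (hf : ∀ j j', j ≠ j' → ∀ a, R.one (f j) * a * R.one (f j') = 0) {i : I} {j : J}
    (hi : (γ i).r = f j) : c i = j := by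
  by_contra hne
  apply h.x_ne_zero i
  rw [← mul_one_of_d (hd i) (h.x_mem i), ← one_mul_of_r hi (h.x_mem i),
    hf _ _ (Ne.symm hne)]

end DualBasis

/-- If `1_f R 1_g ≠ 0`, simplicity puts `1_f` into the ideal generated by `1_g`. This makes linkage
symmetric and transitive, and allows an object to be replaced by its representative. -/
theorem RSimple.exists_mul_one_mul {f g : Γ} (hf : R.RSimple f) {a : R}
    (h : R.one f * a * R.one g ≠ 0) : ∃ b c, R.one f * b * R.one g * c = R.one f := by
  by_contra! H
  apply h
  clear h
  induction a using homogeneous_induction R.isInternal with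
  | hom γ a ha =>
    by_contra h0
    have hr : γ.r = f := by
      by_contra hne
      exact h0 (by rw [one_mul_of_r_ne hne ha, zero_mul])
    have hd : γ.d = g := by
      by_contra hne
      exact h0 (by rw [mul_assoc, mul_one_of_d_ne hne ha, mul_zero])
    have ha' : R.one f * a * R.one g = a := by rw [one_mul_of_r hr ha, mul_one_of_d hd ha]
    obtain ⟨c, hc⟩ := hf.2 γ hr a ha fun h => h0 (by rw [ha', h])
    exact H a c (by rw [ha', hc])
  | zero => rw [mul_zero, zero_mul]
  | add x y hx hy => rw [mul_add, add_mul, hx, hy, add_zero]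

variable (R) in
/-- The objects `f ∈ Δ` and `g ∈ Δ` are related if `1_f R 1_g ≠ 0`. -/
def linkedSetoid {Δ : Set Γ} (hΔ : ∀ f ∈ Δ, R.RSimple f) : Setoid Δ where
  r f g := ∃ a, R.one f.1 * a * R.one g.1 ≠ 0
  iseqv :=
    { refl := fun f => ⟨R.one f, by
        rw [one_mul_one, one_mul_one]; exact (hΔ _ f.2).1⟩
      symm := fun {f g} ⟨a, ha⟩ => by
        obtain ⟨b, c, h⟩ := (hΔ _ f.2).exists_mul_one_mul ha
        refine ⟨c, fun h0 => (hΔ _ f.2).1 ?_⟩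
        have h1 := congrArg (· * R.one f.1) h
        simp only [one_mul_one] at h1
        rw [← h1]
        simp only [mul_assoc] at h0 ⊢
        rw [h0, mul_zero, mul_zero]
      trans := fun {f g k} ⟨a, ha⟩ ⟨a', ha'⟩ => by
        obtain ⟨b, c, h⟩ := (hΔ _ f.2).exists_mul_one_mul ha
        obtain ⟨b', c', h'⟩ := (hΔ _ g.2).exists_mul_one_mul ha'
        refine ⟨b * R.one g * b', fun h0 => (hΔ _ f.2).1 ?_⟩
        rw [← h, ← h']
        have : R.one f.1 * b * (R.one g.1 * b' * R.one k.1 * c') * c =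
          R.one f.1 * (b * R.one g.1 * b') * R.one k.1 * (c' * c) := by simp only [mul_assoc]
        rw [this, h0, zero_mul] }

theorem SimplyGen.exists_representatives {Δ : Set Γ} (h : R.SimplyGen Δ) :
    ∃ (J : Type u) (f : J → Γ), R.SimplyGen (Set.range f) ∧
      ∀ j j', j ≠ j' → ∀ a, R.one (f j) * a * R.one (f j') = 0 := by
  let S := R.linkedSetoid h.1
  -- The nonzero identities at the representatives are distinct elements of `R`, so the set of
  -- classes can be indexed in the universe of `R`, whatever the universe of the objects.
  have hinj : Function.Injective fun q : Quotient S => R.one q.out.1 := fun q q' hq => by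
    have := one_injOn (h.1 _ q.out.2).1 hq
    rw [← q.out_eq, ← q'.out_eq, Subtype.ext this]
  have : Small.{u} (Quotient S) := small_of_injective hinj
  refine ⟨Shrink.{u} (Quotient S), fun j => ((equivShrink _).symm j).out.1,
    ⟨?_, h.2.mono fun g hg => ?_⟩, fun j j' hj a => ?_⟩
  · rintro _ ⟨j, rfl⟩
    exact h.1 _ (Subtype.property _)
  · obtain ⟨a, ha⟩ : ∃ a, R.one g * a * R.one ((⟦⟨g, hg⟩⟧ : Quotient S).out.1) ≠ 0 :=
      S.symm (Quotient.mk_out (s := S) ⟨g, hg⟩)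
    obtain ⟨b, c, hbc⟩ := (h.1 g hg).exists_mul_one_mul ha
    rw [← hbc]
    have hmem : ((⟦⟨g, hg⟩⟧ : Quotient S).out.1) ∈
        Set.range fun j : Shrink.{u} (Quotient S) => ((equivShrink _).symm j).out.1 :=
      ⟨equivShrink _ ⟦⟨g, hg⟩⟧, by simp only [Equiv.symm_apply_apply]⟩
    exact mul_one_mul_mem_objIdeal hmem _ _
  · by_contra ha
    apply hj
    have : ((equivShrink _).symm j : Quotient S) = (equivShrink _).symm j' := by
      rw [← ((equivShrink _).symm j : Quotient S).out_eq, ← ((equivShrink _).symm j').out_eq]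
      exact Quotient.sound ⟨a, ha⟩
    exact (equivShrink _).symm.injective this

theorem IsPfm.exists_iso_prod_matrix (h : R.IsPfm) :
    ∃ (J : Type u) (K : J → Type u) (e f : J → Γ) (D : J → GrRing.{u, v, w} Γ)
      (σ : ∀ j, K j → Mor Γ) (hσ : ∀ j, GrRing.DFinite (σ j)),
      (∀ j, Nonempty (K j)) ∧
      (∀ j, (D j).IsGrDivisionRing ∧ (D j).SupportedAt (e j) ∧ ∀ k, (σ j k).r = e j) ∧
      GrRing.Summable (fun j => (D j).matrix (σ j) (hσ j)) ∧
      R.Iso (GrRing.prod fun j => (D j).matrix (σ j) (hσ j)) ∧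
      ∀ j, (∃! k, (σ j k).d = f j) ∧ {j' | ∃ k, (σ j' k).d = f j} = {j} := by
  obtain ⟨J, f, hsf, hf⟩ := h.simplyGen.exists_representatives
  obtain ⟨I, γ, x, y, hγ, hxy⟩ := hsf.exists_isDualBasis
  choose c hc using hγ
  have hd : ∀ i, (γ i).d = f (c i) := fun i => (hc i).symm
  have hs : ∀ j, R.RSimple (f j) := fun j => hsf.1 _ ⟨j, rfl⟩
  have hu : ∀ j, ∃! k : {i // c i = j}, (γ k).r = f j := fun j => by
    obtain ⟨i, hi, hi'⟩ := hxy.existsUnique (hs j)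
    exact ⟨⟨i, hxy.eq_of_r_eq hd hf hi⟩, hi, fun k hk => Subtype.ext (hi' k hk)⟩
  refine ⟨J, fun j => {i // c i = j}, f, f, fun j => R.corner (f j), fun j k => (γ k).inv,
    fun j => hxy.dFinite c j, fun j => (hu j).exists.nonempty, fun j =>
      ⟨(hs j).corner_isGrDivisionRing, corner_supportedAt _,
        fun k => (hd k).trans (congrArg f k.2)⟩,
    hxy.summable_matrix f c, hxy.iso_prod_matrix hd hf, fun j => ⟨hu j, ?_⟩⟩
  ext j'
  rw [Set.mem_singleton_iff]
  constructor
  · rintro ⟨k, hk⟩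
    exact k.2.symm.trans (hxy.eq_of_r_eq hd hf hk)
  · rintro rfl
    exact (hu _).exists

theorem SimplyGen.exists_iso_matrix {f : Γ} (h : R.SimplyGen {f}) :
    ∃ (e₀ e : Γ) (D : GrRing.{u, v, w} Γ) (I : Type u) (σ : I → Mor Γ)
      (hσ : GrRing.DFinite σ), Nonempty I ∧ D.IsGrDivisionRing ∧ D.SupportedAt e₀ ∧
      (∀ i, (σ i).r = e₀) ∧ R.Iso (D.matrix σ hσ) ∧ ∃! i, (σ i).d = e := by
  obtain ⟨I, γ, x, y, hγ, hxy⟩ := h.exists_isDualBasis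
  have hs := h.1 f rfl
  have hd : ∀ i, (γ i).d = f := hγ
  -- A single object is the case of one block; indexing by this subtype lets the product
  -- decomposition be reused.
  have hu : ∃! k : {i : I // (fun _ => PUnit.unit.{u + 1}) i = PUnit.unit}, (γ k).r = f := by
    obtain ⟨i, hi, hi'⟩ := hxy.existsUnique hs
    exact ⟨⟨i, rfl⟩, hi, fun k hk => Subtype.ext (hi' k hk)⟩
  refine ⟨f, f, R.corner f, {i : I // (fun _ => PUnit.unit.{u + 1}) i = PUnit.unit},
    fun k => (γ k).inv, hxy.dFinite (fun _ => PUnit.unit) PUnit.unit, hu.exists.nonempty,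
    hs.corner_isGrDivisionRing, corner_supportedAt _, fun k => hd k, ?_, hu⟩
  exact (hxy.iso_prod_matrix (J := PUnit) (f := fun _ => f) (c := fun _ => PUnit.unit) hd
    fun j j' hj => absurd rfl hj).trans prod_iso_of_unique

/-! ## The characterizations -/

variable (R) in
/-- `R` is a graded product of a summable family of rings `R_j` such that `R_j(f_j)` is gr-simple,
`R_j` is generated by `1_{f_j}` and `1_{f_j}` vanishes in the other rings. -/
def HasSimplyGenDecomposition : Prop :=
  ∃ (J : Type u) (F : J → GrRing.{u, v, w} Γ) (f : J → Γ), GrRing.Summable F ∧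
    R.Iso (GrRing.prod F) ∧ ∀ j, (F j).SimplyGen {f j} ∧ ∀ j', j' ≠ j → (F j').one (f j) = 0

theorem one_eq_zero_iff {f : Γ} : R.one f = 0 ↔ R.comp (Mor.id f) = ⊥ := by
  refine ⟨fun h => (AddSubgroup.eq_bot_iff_forall _).2 fun a ha => ?_, fun h => ?_⟩
  · rw [← one_mul_of_r rfl ha, h, zero_mul]
  · rw [← AddSubgroup.mem_bot, ← h]; exact R.one_mem f

theorem IsGrSimple.simplyGen (h : R.IsGrSimple) {f : Γ} (hf : R.RSimple f) : R.SimplyGen {f} :=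
  ⟨fun _ hg => Set.mem_singleton_iff.1 hg ▸ hf, h.gen hf.1⟩

/-- Gr-simple rings are gr-prime, so Brauer's lemma applies in the right artinian case. The left
case is the right one for the opposite ring, carried back by the symmetry of `SimplyGen`. -/
theorem IsGrSimple.simplyGen_of_isDivisionRingAt (h : R.IsGrSimple)
    (hA : R.IsRightGammaArtinian ∨ R.IsLeftGammaArtinian) {f : Γ} (hf : R.IsDivisionRingAt f) :
    R.SimplyGen {f} := by
  rcases hA with hA | hA
  · exact h.simplyGen (h.isGrPrime.rSimple hf (isRightGammaArtinian_iff.1 hA f))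
  · exact simplyGen_op.1 (h.op.simplyGen
      (h.op.isGrPrime.rSimple hf.op (isLeftGammaArtinian_iff.1 hA f)))

theorem SimplyGen.isRightGammaArtinian {Δ : Set Γ} (h : R.SimplyGen Δ) : R.IsRightGammaArtinian :=
  isRightGammaArtinian_iff.2 h.rArt

theorem SimplyGen.isLeftGammaArtinian {Δ : Set Γ} (h : R.SimplyGen Δ) : R.IsLeftGammaArtinian :=
  isLeftGammaArtinian_iff.2 (simplyGen_op.2 h).rArt

end GrRing

end GroupoidGraded

end


/-! ### Assembly of the equivalences -/

open GroupoidGraded.GrRing GroupoidGraded.GrMod in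
theorem mainTheorem6 {Γ : Type v} [Groupoid.{w} Γ] (R : GrRing.{u, v, w} Γ) :
    -- characterizations of pfm rings
    List.TFAE [
      -- (1)
      R.IsPfm,
      -- (2)
      ∃ (J : Type u) (K : J → Type u) (e f : J → Γ) (D : J → GrRing.{u, v, w} Γ)
        (σ : ∀ j, K j → Mor Γ) (hσ : ∀ j, GrRing.DFinite (σ j)),
        (∀ j, Nonempty (K j)) ∧
        (∀ j, (D j).IsGrDivisionRing ∧ (D j).SupportedAt (e j) ∧ ∀ k, (σ j k).r = e j) ∧
        GrRing.Summable (fun j => (D j).matrix (σ j) (hσ j)) ∧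
        R.Iso (GrRing.prod fun j => (D j).matrix (σ j) (hσ j)) ∧
        ∀ j, (∃! k, (σ j k).d = f j) ∧ {j' | ∃ k, (σ j' k).d = f j} = {j},
      -- (3)
      ∃ (J : Type u) (F : J → GrRing.{u, v, w} Γ) (f : J → Γ),
        GrRing.Summable F ∧ (∀ j, (F j).IsGrPrime ∧ (F j).IsPfm) ∧ R.Iso (GrRing.prod F) ∧
        ∀ j, ((GrMod.regular R).part (f j)).IsGrSimple ∧
          Nontrivial ((GrMod.regular (F j)).part (f j)),
      -- (4)
      ∃ (J : Type u) (F : J → GrRing.{u, v, w} Γ) (f : J → Γ),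
        GrRing.Summable F ∧ (∀ j, (F j).IsGrSimple) ∧ R.Iso (GrRing.prod F) ∧
        ∀ j, ((GrMod.regular R).part (f j)).IsGrSimple ∧
          Nontrivial ((GrMod.regular (F j)).part (f j)),
      -- (5)
      ∃ Δ : Set Γ, Δ ⊆ (GrMod.regular R).objSupport ∧ (GrMod.ofObjects R Δ).IsGammaSimple ∧
        ∃ (I : Type u) (e : I → Δ) (σ : I → Mor Γ), (GrMod.regular R).Iso
          (GrMod.directSum fun i => ((GrMod.regular R).part (e i)).shift (σ i)),
      -- (6), with right `Γ₀`-artinian rings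
      ∃ (J : Type u) (F : J → GrRing.{u, v, w} Γ) (f : J → Γ),
        GrRing.Summable F ∧ (∀ j, (F j).IsGrSimple ∧ (F j).IsRightGammaArtinian) ∧
        R.Iso (GrRing.prod F) ∧
        ∀ j, R.IsDivisionRingAt (f j) ∧ ∀ j', j' ≠ j → (F j').comp (Mor.id (f j)) = ⊥,
      -- (6), with left `Γ₀`-artinian rings
      ∃ (J : Type u) (F : J → GrRing.{u, v, w} Γ) (f : J → Γ),
        GrRing.Summable F ∧ (∀ j, (F j).IsGrSimple ∧ (F j).IsLeftGammaArtinian) ∧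
        R.Iso (GrRing.prod F) ∧
        ∀ j, R.IsDivisionRingAt (f j) ∧ ∀ j', j' ≠ j → (F j').comp (Mor.id (f j)) = ⊥] ∧
    -- characterizations of gr-prime pfm rings
    List.TFAE [
      -- (1)
      R.IsGrSimple ∧ R.IsPfm,
      -- (2)
      R.IsGrPrime ∧ R.IsPfm,
      -- (3)
      ∃ (e₀ e : Γ) (D : GrRing.{u, v, w} Γ) (I : Type u) (σ : I → Mor Γ)
        (hσ : GrRing.DFinite σ), Nonempty I ∧ D.IsGrDivisionRing ∧ D.SupportedAt e₀ ∧
        (∀ i, (σ i).r = e₀) ∧ R.Iso (D.matrix σ hσ) ∧ ∃! i, (σ i).d = e,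
      -- (4)
      R.IsGrSimple ∧ ∃ e, ((GrMod.regular R).part e).IsGrSimple,
      -- (5)
      ∃ e, ((GrMod.regular R).part e).IsGrSimple ∧ ∃ (I : Type u) (σ : I → Mor Γ),
        (GrMod.regular R).Iso (GrMod.directSum fun i => ((GrMod.regular R).part e).shift (σ i)),
      -- (6), right `Γ₀`-artinian
      (R.IsGrSimple ∧ R.IsRightGammaArtinian) ∧ ∃ e, R.IsDivisionRingAt e,
      -- (6), left `Γ₀`-artinian
      (R.IsGrSimple ∧ R.IsLeftGammaArtinian) ∧ ∃ e, R.IsDivisionRingAt e,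
      -- (7)
      (R.IsRightGrPrimitive ∧ R.IsRightGammaArtinian) ∧ ∃ e, R.IsDivisionRingAt e] ∧
    -- left-right symmetry
    (R.IsPfm ↔ R.IsLeftPfm) := by
  refine ⟨?_, ?_, isPfm_iff_isLeftPfm⟩
  -- The product decompositions in the list can be read off from one with simply generated factors;
  -- vanishing of `1_{f_j}` in the other factors transfers simplicity at `f_j` to `R`.
  · have hsimple : R.HasSimplyGenDecomposition → ∃ (J : Type u) (F : J → GrRing.{u, v, w} Γ)
        (f : J → Γ), GrRing.Summable F ∧ (∀ j, (F j).SimplyGen {f j}) ∧ R.Iso (GrRing.prod F) ∧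
        (∀ j, R.RSimple (f j) ∧ (F j).one (f j) ≠ 0) ∧
        ∀ j j', j' ≠ j → (F j').comp (Mor.id (f j)) = ⊥ := by
      rintro ⟨J, F, f, hF, hiso, h⟩
      exact ⟨J, F, f, hF, fun j => (h j).1, hiso, fun j =>
        ⟨hiso.symm.rSimple (((h j).1.1 _ rfl).prod (h j).2), ((h j).1.1 _ rfl).1⟩,
        fun j j' hj => one_eq_zero_iff.1 ((h j).2 j' hj)⟩
    have h12 := IsPfm.exists_iso_prod_matrix (R := R)
    -- Simplicity at `f_j` is given in `R` itself, and a gr-simple factor is generated by any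
    -- nonzero identity, so `R` is simply generated by the range of `f`.
    have h41 : (∃ (J : Type u) (F : J → GrRing.{u, v, w} Γ) (f : J → Γ),
        GrRing.Summable F ∧ (∀ j, (F j).IsGrSimple) ∧ R.Iso (GrRing.prod F) ∧
        ∀ j, ((GrMod.regular R).part (f j)).IsGrSimple ∧
          Nontrivial ((GrMod.regular (F j)).part (f j))) → R.IsPfm := by
      rintro ⟨J, F, f, hF, hs, hiso, h⟩
      refine isPfm_iff.2 ⟨Set.range f, ?_, hiso.symm.gen (Gen.prod hF fun j =>
        (hs j).gen (nontrivial_part_iff.1 (h j).2))⟩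
      rintro _ ⟨j, rfl⟩
      exact isGrSimple_part_iff.1 (h j).1
    have h6 : (∃ (J : Type u) (F : J → GrRing.{u, v, w} Γ) (f : J → Γ),
        GrRing.Summable F ∧
        (∀ j, (F j).IsGrSimple ∧ ((F j).IsRightGammaArtinian ∨ (F j).IsLeftGammaArtinian)) ∧
        R.Iso (GrRing.prod F) ∧
        ∀ j, R.IsDivisionRingAt (f j) ∧ ∀ j', j' ≠ j → (F j').comp (Mor.id (f j)) = ⊥) →
        R.HasSimplyGenDecomposition := by
      rintro ⟨J, F, f, hF, hs, hiso, h⟩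
      exact ⟨J, F, f, hF, hiso, fun j => ⟨(hs j).1.simplyGen_of_isDivisionRingAt (hs j).2
        (isDivisionRingAt_of_prod (hiso.isDivisionRingAt (h j).1) (h j).2),
        fun j' hj => one_eq_zero_iff.2 ((h j).2 j' hj)⟩⟩
    have hY3 : R.HasSimplyGenDecomposition → ∃ (J : Type u) (F : J → GrRing.{u, v, w} Γ)
        (f : J → Γ), GrRing.Summable F ∧ (∀ j, (F j).IsGrPrime ∧ (F j).IsPfm) ∧
        R.Iso (GrRing.prod F) ∧ ∀ j, ((GrMod.regular R).part (f j)).IsGrSimple ∧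
          Nontrivial ((GrMod.regular (F j)).part (f j)) := by
      intro h
      obtain ⟨J, F, f, hF, hs, hiso, h, -⟩ := hsimple h
      exact ⟨J, F, f, hF, fun j => ⟨(hs j).isGrSimple_of_singleton.isGrPrime, (hs j).isPfm⟩, hiso,
        fun j => ⟨isGrSimple_part_iff.2 (h j).1, nontrivial_part_iff.2 (h j).2⟩⟩
    have h2Y : (∃ (J : Type u) (K : J → Type u) (e f : J → Γ) (D : J → GrRing.{u, v, w} Γ)
        (σ : ∀ j, K j → Mor Γ) (hσ : ∀ j, GrRing.DFinite (σ j)),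
        (∀ j, Nonempty (K j)) ∧
        (∀ j, (D j).IsGrDivisionRing ∧ (D j).SupportedAt (e j) ∧ ∀ k, (σ j k).r = e j) ∧
        GrRing.Summable (fun j => (D j).matrix (σ j) (hσ j)) ∧
        R.Iso (GrRing.prod fun j => (D j).matrix (σ j) (hσ j)) ∧
        ∀ j, (∃! k, (σ j k).d = f j) ∧ {j' | ∃ k, (σ j' k).d = f j} = {j}) →
        R.HasSimplyGenDecomposition := by
      rintro ⟨J, K, e, f, D, σ, hσ, -, hD, hF, hiso, h⟩
      refine ⟨J, _, f, hF, hiso, fun j =>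
        ⟨matrix_simplyGen (hD j).1 (hD j).2.1 (hD j).2.2 (h j).1, fun j' hj => ?_⟩⟩
      exact matrix_one_eq_zero fun k hk => hj ((h j).2.subset ⟨k, hk⟩)
    tfae_have 1 → 2 := h12
    tfae_have 2 → 3 := fun h => hY3 (h2Y h)
    tfae_have 3 → 4 := by
      rintro ⟨J, F, f, hF, hs, h⟩
      exact ⟨J, F, f, hF, fun j => (hs j).2.simplyGen.isGrSimple_of_isGrPrime (hs j).1, h⟩
    tfae_have 4 → 1 := h41
    tfae_have 1 → 5 := fun h => by
      have hs := h.simplyGen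
      have hsub : {f | R.RSimple f} ⊆ (GrMod.regular R).objSupport := fun f hf =>
        nontrivial_part_iff.2 hf.1
      exact ⟨_, hsub, (isGammaSimple_ofObjects_iff hsub).2 hs.1, hs.exists_iso_directSum⟩
    tfae_have 5 → 1 := by
      rintro ⟨Δ, hsub, hΔ, I, e, σ, hiso⟩
      exact isPfm_iff.2 ⟨Δ, (isGammaSimple_ofObjects_iff hsub).1 hΔ,
        gen_of_iso_directSum (fun i => (e i).1) (fun i => (e i).2) σ hiso⟩
    tfae_have 1 → 6 := fun h => by
      obtain ⟨J, F, f, hF, hs, hiso, h, h0⟩ := hsimple (h2Y (h12 h))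
      exact ⟨J, F, f, hF, fun j => ⟨(hs j).isGrSimple_of_singleton, (hs j).isRightGammaArtinian⟩,
        hiso, fun j => ⟨(h j).1.isDivisionRingAt, h0 j⟩⟩
    tfae_have 1 → 7 := fun h => by
      obtain ⟨J, F, f, hF, hs, hiso, h, h0⟩ := hsimple (h2Y (h12 h))
      exact ⟨J, F, f, hF, fun j => ⟨(hs j).isGrSimple_of_singleton, (hs j).isLeftGammaArtinian⟩,
        hiso, fun j => ⟨(h j).1.isDivisionRingAt, h0 j⟩⟩
    tfae_have 6 → 3 := by
      rintro ⟨J, F, f, hF, hs, h⟩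
      exact hY3 (h6 ⟨J, F, f, hF, fun j => ⟨(hs j).1, .inl (hs j).2⟩, h⟩)
    tfae_have 7 → 3 := by
      rintro ⟨J, F, f, hF, hs, h⟩
      exact hY3 (h6 ⟨J, F, f, hF, fun j => ⟨(hs j).1, .inr (hs j).2⟩, h⟩)
    tfae_finish
  · tfae_have 1 → 2 := fun h => ⟨h.1.isGrPrime, h.2⟩
    tfae_have 2 → 4 := fun h => by
      have := h.1.1
      obtain ⟨f, hf⟩ := h.2.simplyGen.2.nonempty
      exact ⟨h.2.simplyGen.isGrSimple_of_isGrPrime h.1, f, isGrSimple_part_iff.2 hf⟩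
    -- Being simply generated by one object serves as the hub through which the remaining items of
    -- this list are connected.
    have key : (R.IsGrSimple ∧ ∃ e, ((GrMod.regular R).part e).IsGrSimple) ↔
        ∃ f, R.SimplyGen {f} :=
      ⟨fun ⟨h, e, he⟩ => ⟨e, h.simplyGen (isGrSimple_part_iff.1 he)⟩,
        fun ⟨f, h⟩ => ⟨h.isGrSimple_of_singleton, f, isGrSimple_part_iff.2 (h.1 f rfl)⟩⟩
    rw [key]
    tfae_have 4 → 1 := fun ⟨f, h⟩ => ⟨h.isGrSimple_of_singleton, h.isPfm⟩
    tfae_have 4 → 3 := fun ⟨f, h⟩ => h.exists_iso_matrix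
    tfae_have 3 → 4 := fun ⟨e₀, e, D, I, σ, hσ, _, hD, hs, hr, hiso, he⟩ =>
      ⟨e, hiso.symm.simplyGen (matrix_simplyGen hD hs hr he)⟩
    tfae_have 4 → 5 := fun ⟨f, h⟩ => by
      obtain ⟨I, e, σ, hiso⟩ := h.exists_iso_directSum
      obtain rfl : e = fun _ => ⟨f, rfl⟩ := funext fun i => Subtype.ext (e i).2
      exact ⟨f, isGrSimple_part_iff.2 (h.1 f rfl), I, σ, hiso⟩
    tfae_have 5 → 4 := by
      rintro ⟨e, he, I, σ, hiso⟩
      exact ⟨e, fun f hf => Set.mem_singleton_iff.1 hf ▸ isGrSimple_part_iff.1 he,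
        gen_of_iso_directSum (fun _ => e) (fun _ => rfl) σ hiso⟩
    tfae_have 4 → 6 := fun ⟨f, h⟩ => ⟨⟨h.isGrSimple_of_singleton, h.isRightGammaArtinian⟩, f,
      (h.1 f rfl).isDivisionRingAt⟩
    tfae_have 4 → 7 := fun ⟨f, h⟩ => ⟨⟨h.isGrSimple_of_singleton, h.isLeftGammaArtinian⟩, f,
      (h.1 f rfl).isDivisionRingAt⟩
    tfae_have 4 → 8 := fun ⟨f, h⟩ => ⟨⟨h.isRightGrPrimitive, h.isRightGammaArtinian⟩, f,
      (h.1 f rfl).isDivisionRingAt⟩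
    tfae_have 6 → 4 := fun ⟨⟨h, hA⟩, e, he⟩ => ⟨e, h.simplyGen_of_isDivisionRingAt (.inl hA) he⟩
    tfae_have 7 → 4 := fun ⟨⟨h, hA⟩, e, he⟩ => ⟨e, h.simplyGen_of_isDivisionRingAt (.inr hA) he⟩
    tfae_have 8 → 4 := fun ⟨⟨h, hA⟩, e, he⟩ => by
      have hA' := isRightGammaArtinian_iff.1 hA
      have hs := h.isGrPrime.rSimple he (hA' e)
      exact ⟨e, fun f hf => Set.mem_singleton_iff.1 hf ▸ hs, h.isGrPrime.gen hs hA'⟩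
    tfae_finish
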